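/- Let $k\ge 3$ be a fixed integer. For a positive integer $N$, let $\mathrm{AP}_k$ be the collection of $k$-element subsets of $\{1,\dots,N\}$ of the form $\{a,a+b,\dots,a+(k-1)b\}$ with $a,b$ positive integers. For $p\in(0,1]$, let $\mathbf R$ be the random subset of $\{1,\dots,N\}$ that includes each element independently with probability $p$, let $X$ be the number of elements of $\mathrm{AP}_k$ contained in $\mathbf R$, and let $\mu=\mathbb E[X]$. For $U\subseteq\{1,\dots,N\}$ write $\mathbb E_U[X]=\mathbb E[X\mid U\subseteq\mathbf R]$. For $t\ge 0$, a *$t$-seed* is a set $U\subseteq\{1,\dots,N\}$ with $\mathbb E_U[X]\ge\mu+t$; let $\mathcal S_{N,p,k}(t)$ be the family of all $t$-seeds and let $$\Psi(t)=\Psi_{N,p,k}(t)=\min\{|U| : U\in\mathcal S_{N,p,k}(t)\},$$ with $\Psi(t)=\infty$ if there is no $t$-seed. **Theorem.** Let $p=p_N\in(0,1]$, $t=t_N\ge 0$ and $m=m_N\ge 0$ be sequences of real numbers such that, as $N\to\infty$, $$t\gg m\cdot\max\{1,Np^{k-1}\}\qquad\text{and}\qquad t\gg m^2p^{k-2}\cdot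 N^{(k-2)(m/t)^{1/(k-1)}},$$ where $t\gg f$ means $f=o(t)$ as $N\to\infty$ (and $m/t$ is read as $0$ when $m=t=0$). Then $$\log\Pr\big(U\subseteq\mathbf R\text{ for some }U\in\mathcal S_{N,p,k}(t)\text{ with }|U|\le m\big)\le(1-o(1))\cdot\Psi(t)\cdot\log p ,$$ that is, for every $\varepsilon>0$ and all sufficiently large $N$ the left-hand side is at most $(1-\varepsilon)\,\Psi(t)\log p$ (with $\log 0=-\infty$, and $\infty\cdot 0=0$). -/

import Mathlib

open MeasureTheory ProbabilityTheory Filter Asymptotics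
open scoped Topology unitInterval

namespace APTail

open Classical in
/-- `AP_k`: the set of `k`-term arithmetic progressions in `{1, …, N}`, that is, the collection of
`k`-element subsets of `{1, …, N}` of the form `{a, a + b, …, a + (k - 1) b}` with `a, b`
positive integers. -/
noncomputable def apSet (N k : ℕ) : Finset (Finset ℕ) :=
  ((Finset.Icc 1 N).powersetCard k).filter
    (fun B : Finset ℕ => ∃ a b : ℕ, 0 < a ∧ 0 < b ∧ B = (Finset.range k).image (fun i => a + i * b))

/-- The law of the `p`-biased random subset `R` of `{1, …, N}`: every element of `{1, …, N}` is
included independently with probability `p`. -/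
noncomputable abbrev randomSet (N : ℕ) (p : I) : Measure (Set ℕ) :=
  setBernoulli (Set.Icc 1 N) p

open Classical in
/-- `X`: the number of `k`-term arithmetic progressions of `{1, …, N}` that are contained in `R`. -/
noncomputable def apCount (N k : ℕ) (R : Set ℕ) : ℝ :=
  (((apSet N k).filter (fun B : Finset ℕ => (B : Set ℕ) ⊆ R)).card : ℝ)

/-- `μ = E[X]`. -/
noncomputable def mean (N : ℕ) (p : I) (k : ℕ) : ℝ :=
  ∫ R, apCount N k R ∂(randomSet N p)

/-- `E_U[X] = E[X | U ⊆ R]`, the expectation of `X` under the law of `R` conditioned on the event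
`U ⊆ R` (which has positive probability whenever `p > 0` and `U ⊆ {1, …, N}`). -/
noncomputable def condMean (N : ℕ) (p : I) (k : ℕ) (U : Finset ℕ) : ℝ :=
  ∫ R, apCount N k R ∂(cond (randomSet N p) {R : Set ℕ | (U : Set ℕ) ⊆ R})

/-- The family of `t`-seeds: the sets `U ⊆ {1, …, N}` with `E_U[X] ≥ μ + t`. -/
def seeds (N : ℕ) (p : I) (k : ℕ) (t : ℝ) : Set (Finset ℕ) :=
  {U | U ⊆ Finset.Icc 1 N ∧ mean N p k + t ≤ condMean N p k U}

/-- `Ψ(t)`: the smallest size of a `t`-seed, equal to `∞` if there is no `t`-seed. -/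
noncomputable def Psi (N : ℕ) (p : I) (k : ℕ) (t : ℝ) : ℕ∞ :=
  ⨅ U ∈ seeds N p k t, (U.card : ℕ∞)

/-- The event that the random set contains some `t`-seed with at most `m` elements. -/
def smallSeedEvent (N : ℕ) (p : I) (k : ℕ) (t m : ℝ) : Set (Set ℕ) :=
  {R | ∃ U ∈ seeds N p k t, (U.card : ℝ) ≤ m ∧ (U : Set ℕ) ⊆ R}

end APTail

namespace APTail

/-! A union bound over all seeds is hopeless, so each small seed `U ⊆ R` is replaced by a
certificate: a set `Q ⊆ R` that is cheap to choose, together with many elements of `R` that complete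
progressions having `j - 1` points in `Q` (the candidates of `Q`). If `Q` has few candidates,
containing many of them is unlikely (`certEvent_le`). Certificates come from sampling: if every
element of `W ⊆ S` lies in many progressions meeting `S` in at least `j` points, then by a second
moment argument a sparse random `Q ⊆ S` turns almost all of `W` into candidates without creating too
many others (`exists_sample`, `mem_certEvent`).

The gain `E_U[X] - μ` splits into levels `j`, according to how many progressions meet `U` in at
least `j` points (`exCount_eq`). The conditions on `t` make levels 1 and 2 negligible, so only `j ≥
3` matters. Let `n = Ψ(t)` and let `F` maximize `E_F[X] - (δt/L)|F|` among the subsets of `U` of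
size at most `L`. Every element of `F` then has marginal gain at least `δt/L`, hence large degree at
level 3, and `F` admits a certificate of probability at most `p^((1 - 6γ)|F|)` as long as `L ≤ √t
p^(-γ)` (`exists_core_event`). If `F` is nearly a seed, adding an interval of length of order `√t`,
or passing to all of `[N]`, gives a seed, so `|F|` is at least nearly `n`
(`exists_card_ge_of_near`). This gives the main term.

If `m ≤ √t p^(-γ)`, the choice `L = m` always leads to this case. Otherwise `L` is `√t` times a
smaller power of `1/p`, and `F` may miss a gain of `δt`. Then `U \ F` contains a set `W` of extremal
density, for which the degrees are large and the candidates few (`exists_dense_subset`). Maximality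
of `F` forces `|W| ≥ √t p^(-a)` for some fixed `a > 0`, and the certificate has probability at most
`exp(-|W|)` (`exists_dense_event`). Since `n = O(√t)` (`le_sqrt_of_forall_seed`), this is far below
`p^n`. Summing over the sizes of `F` and `W` gives the theorem. -/

/-! ### Expectations as sums over progressions -/

lemma randomSet_superset (N : ℕ) (p : I) (T : Finset ℕ) (hT : T ⊆ Finset.Icc 1 N) :
    (randomSet N p).real {R : Set ℕ | (T : Set ℕ) ⊆ R} = (p : ℝ) ^ T.card := by
  classical
  have h : (fun q : ℕ → Prop => {i | q i}) ⁻¹' {R : Set ℕ | (T : Set ℕ) ⊆ R} =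
      Set.pi (T : Set ℕ) (fun _ => {True}) := by
    ext q; simp [Set.subset_def, Set.pi]
  rw [measureReal_def, setBernoulli_apply', h, Measure.infinitePi_pi _ (by simp)]
  rw [Finset.prod_congr rfl (g := fun _ => (unitInterval.toNNReal p : ENNReal))]
  · simp
  · intro i hi
    have := hT hi
    simp_all

lemma measurableSet_superset (T : Finset ℕ) : MeasurableSet {R : Set ℕ | (T : Set ℕ) ⊆ R} := by
  have : {R : Set ℕ | (T : Set ℕ) ⊆ R} = ⋂ i ∈ T, {R : Set ℕ | i ∈ R} := by
    ext R; simp [Set.subset_def]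
  rw [this]
  exact Finset.measurableSet_biInter _ fun i _ => measurableSet_setOfPred.2 (by fun_prop)

/-- The expected number of progressions of `R ∪ U`. -/
noncomputable def exCount (N : ℕ) (p : ℝ) (k : ℕ) (U : Finset ℕ) : ℝ :=
  ∑ B ∈ apSet N k, p ^ (B \ U).card

open Classical in
lemma subset_Icc_of_mem_apSet {N k : ℕ} {B : Finset ℕ} (hB : B ∈ apSet N k) :
    B ⊆ Finset.Icc 1 N := by
  rw [apSet, Finset.mem_filter, Finset.mem_powersetCard] at hB
  exact hB.1.1

open Classical in
lemma card_of_mem_apSet {N k : ℕ} {B : Finset ℕ} (hB : B ∈ apSet N k) : B.card = k := by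
  rw [apSet, Finset.mem_filter, Finset.mem_powersetCard] at hB
  exact hB.1.2

open Classical in
lemma apCount_eq_sum (N k : ℕ) (R : Set ℕ) :
    apCount N k R =
      ∑ B ∈ apSet N k, {R : Set ℕ | (B : Set ℕ) ⊆ R}.indicator (fun _ => (1 : ℝ)) R := by
  rw [apCount, Finset.card_filter, Nat.cast_sum]
  refine Finset.sum_congr rfl fun B _ => ?_
  simp [Set.indicator_apply]

lemma integral_apCount (N k : ℕ) (ν : Measure (Set ℕ)) [IsFiniteMeasure ν] :
    ∫ R, apCount N k R ∂ν = ∑ B ∈ apSet N k, ν.real {R : Set ℕ | (B : Set ℕ) ⊆ R} := by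
  simp_rw [apCount_eq_sum]
  rw [integral_finsetSum]
  · refine Finset.sum_congr rfl fun B _ => ?_
    rw [integral_indicator (measurableSet_superset B)]
    simp
  · intro B _
    exact (integrable_const _).indicator (measurableSet_superset B)

lemma mean_eq (N : ℕ) (p : I) (k : ℕ) : mean N p k = exCount N p k ∅ := by
  rw [mean, integral_apCount, exCount]
  refine Finset.sum_congr rfl fun B hB => ?_
  rw [randomSet_superset _ _ _ (subset_Icc_of_mem_apSet hB)]
  simp

/-- Each progression `B` contributes `p ^ |B ∪ U| / p ^ |U|`, and `|B ∪ U| = |B \ U| + |U|`.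
Positivity of `p` makes the normalization legitimate. -/
lemma condMean_eq (N : ℕ) (p : I) (hp : 0 < p) (k : ℕ) (U : Finset ℕ)
    (hU : U ⊆ Finset.Icc 1 N) : condMean N p k U = exCount N p k U := by
  classical
  rw [condMean, integral_apCount, exCount]
  refine Finset.sum_congr rfl fun B hB => ?_
  have hp' : (0 : ℝ) < p := hp
  rw [measureReal_def, cond_apply (measurableSet_superset U), ENNReal.toReal_mul,
    ENNReal.toReal_inv, ← measureReal_def, ← measureReal_def, randomSet_superset _ _ _ hU]
  have : {R : Set ℕ | (U : Set ℕ) ⊆ R} ∩ {R : Set ℕ | (B : Set ℕ) ⊆ R} =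
      {R : Set ℕ | ((B ∪ U : Finset ℕ) : Set ℕ) ⊆ R} := by
    ext R; simp [and_comm]
  rw [this, randomSet_superset _ _ _ (Finset.union_subset (subset_Icc_of_mem_apSet hB) hU)]
  have hc : (B ∪ U).card = (B \ U).card + U.card := by
    rw [← Finset.sdiff_union_self_eq_union, Finset.card_union_of_disjoint Finset.sdiff_disjoint]
  rw [hc, pow_add]
  field_simp

/-! ### Level counts and degrees -/

/-- The number of progressions that meet `S` in at least `j` elements. -/
noncomputable def cnt (N k j : ℕ) (S : Finset ℕ) : ℕ :=
  ((apSet N k).filter fun B => j ≤ (B ∩ S).card).card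

/-- The number of progressions through `u` that meet `S` in at least `j` elements. -/
noncomputable def deg (N k j : ℕ) (S : Finset ℕ) (u : ℕ) : ℕ :=
  ((apSet N k).filter fun B => u ∈ B ∧ j ≤ (B ∩ S).card).card

/-- Telescoping: consecutive powers differ by `p ^ (k - j) - p ^ (k - j + 1) = (1 - p) p ^ (k - j)`.
-/
lemma pow_sub_eq_sum (p : ℝ) (k i : ℕ) (hi : i ≤ k) :
    p ^ (k - i) = p ^ k + (1 - p) * ∑ j ∈ Finset.Icc 1 k, if j ≤ i then p ^ (k - j) else 0 := by
  induction i with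
  | zero =>
    rw [Finset.sum_eq_zero]
    · simp
    · intro j hj
      rw [Finset.mem_Icc] at hj
      rw [if_neg (by omega)]
  | succ i ih =>
    have h1 : (∑ j ∈ Finset.Icc 1 k, if j ≤ i + 1 then p ^ (k - j) else 0) =
        (∑ j ∈ Finset.Icc 1 k, if j ≤ i then p ^ (k - j) else 0) + p ^ (k - (i + 1)) := by
      rw [← Finset.sum_filter, ← Finset.sum_filter]
      have : (Finset.Icc 1 k).filter (fun j => j ≤ i + 1) =
          insert (i + 1) ((Finset.Icc 1 k).filter (fun j => j ≤ i)) := by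
        ext j; simp only [Finset.mem_filter, Finset.mem_Icc, Finset.mem_insert]; omega
      rw [this, Finset.sum_insert (by simp)]
      ring
    rw [h1, mul_add, ← add_assoc, ← ih (by omega)]
    have : k - i = k - (i + 1) + 1 := by omega
    rw [this, pow_succ]
    ring

/-- Summation by parts over the intersection size `|B ∩ S|`. All coefficients on the right are
nonnegative and the counts are monotone in `S`, so gains can be estimated one level at a time. -/
lemma exCount_eq (N : ℕ) (p : ℝ) (k : ℕ) (S : Finset ℕ) :
    exCount N p k S = (apSet N k).card * p ^ k +
      (1 - p) * ∑ j ∈ Finset.Icc 1 k, p ^ (k - j) * cnt N k j S := by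
  have h : ∀ B ∈ apSet N k, p ^ (B \ S).card = p ^ k +
      (1 - p) * ∑ j ∈ Finset.Icc 1 k, if j ≤ (B ∩ S).card then p ^ (k - j) else 0 := by
    intro B hB
    have hc := card_of_mem_apSet hB
    have := Finset.card_sdiff_add_card_inter B S
    rw [← pow_sub_eq_sum]
    · congr 1; omega
    · omega
  rw [exCount, Finset.sum_congr rfl h, Finset.sum_add_distrib, ← Finset.mul_sum, Finset.sum_comm]
  congr 2
  · simp
  · refine Finset.sum_congr rfl fun j _ => ?_
    rw [← Finset.sum_filter, Finset.sum_const, cnt]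
    simp [mul_comm]

lemma exCount_sub (N : ℕ) (p : ℝ) (k : ℕ) (S F : Finset ℕ) :
    exCount N p k S - exCount N p k F =
      (1 - p) * ∑ j ∈ Finset.Icc 1 k, p ^ (k - j) * ((cnt N k j S : ℝ) - cnt N k j F) := by
  rw [exCount_eq, exCount_eq]
  simp only [mul_sub, Finset.sum_sub_distrib]
  ring

lemma cnt_mono (N k j : ℕ) {S F : Finset ℕ} (h : F ⊆ S) : cnt N k j F ≤ cnt N k j S := by
  refine Finset.card_le_card fun B hB => ?_
  rw [Finset.mem_filter] at hB ⊢
  exact ⟨hB.1, hB.2.trans (Finset.card_le_card (Finset.inter_subset_inter_left h))⟩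

lemma deg_anti (N k : ℕ) {i j : ℕ} (hij : i ≤ j) (S : Finset ℕ) (u : ℕ) :
    deg N k j S u ≤ deg N k i S u := by
  refine Finset.card_le_card fun B hB => ?_
  rw [Finset.mem_filter] at hB ⊢
  exact ⟨hB.1, hB.2.1, hij.trans hB.2.2⟩

/-- Removing `u` from `S` loses at most `deg u` progressions. -/
lemma cnt_le_cnt_erase_add_deg (N k j : ℕ) (S : Finset ℕ) (u : ℕ) :
    cnt N k j S ≤ cnt N k j (S.erase u) + deg N k j S u := by
  classical
  rw [cnt, cnt, deg]
  refine le_trans (Finset.card_le_card ?_) (Finset.card_union_le _ _)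
  intro B hB
  rw [Finset.mem_union, Finset.mem_filter, Finset.mem_filter]
  rw [Finset.mem_filter] at hB
  by_cases hu : u ∈ B
  · exact Or.inr ⟨hB.1, hu, hB.2⟩
  · refine Or.inl ⟨hB.1, ?_⟩
    rw [Finset.inter_erase, Finset.erase_eq_of_notMem (by simp [hu])]
    exact hB.2

lemma exCount_mono (N : ℕ) {p : ℝ} (hp0 : 0 ≤ p) (hp1 : p ≤ 1) (k : ℕ) {S F : Finset ℕ}
    (h : F ⊆ S) : exCount N p k F ≤ exCount N p k S := by
  refine Finset.sum_le_sum fun B _ => ?_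
  exact pow_le_pow_of_le_one hp0 hp1 (Finset.card_le_card (Finset.sdiff_subset_sdiff le_rfl h))

open Classical in
lemma exists_of_mem_apSet {N k : ℕ} {B : Finset ℕ} (hB : B ∈ apSet N k) :
    ∃ a b : ℕ, 0 < a ∧ 0 < b ∧ B = (Finset.range k).image (fun i => a + i * b) := by
  rw [apSet, Finset.mem_filter] at hB
  exact hB.2

/-- There are at most `k N` progressions through a given element. -/
lemma card_through_le (N k : ℕ) (hk : 2 ≤ k) (u : ℕ) :
    ((apSet N k).filter fun B => u ∈ B).card ≤ k * N := by
  classical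
  -- A progression through `u` is determined by the position of `u` in it and its difference, which
  -- is at most `N` because the second term is.
  have key : ∀ B ∈ (apSet N k).filter (fun B => u ∈ B), ∃ ib ∈ (Finset.range k) ×ˢ (Finset.Icc 1 N),
      B = (Finset.range k).image (fun l => (u - ib.1 * ib.2) + l * ib.2) := by
    intro B hB
    rw [Finset.mem_filter] at hB
    obtain ⟨a, b, ha, hb, hab⟩ := exists_of_mem_apSet hB.1
    have hu := hB.2
    rw [hab, Finset.mem_image] at hu
    obtain ⟨i, hi, hiu⟩ := hu
    refine ⟨(i, b), ?_, ?_⟩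
    · rw [Finset.mem_product, Finset.mem_Icc]
      refine ⟨hi, hb, ?_⟩
      have h1 : a + 1 * b ∈ B := by
        rw [hab]; exact Finset.mem_image_of_mem (fun i => a + i * b) (by simp; omega)
      have := subset_Icc_of_mem_apSet hB.1 h1
      rw [Finset.mem_Icc] at this
      omega
    · rw [hab]
      have : u - i * b = a := by omega
      simp only [this]
  choose! f hf hf' using key
  calc _ ≤ ((Finset.range k) ×ˢ (Finset.Icc 1 N)).card := by
        refine Finset.card_le_card_of_injOn f hf ?_
        intro B hB B' hB' h
        rw [hf' B hB, hf' B' hB', h]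
    _ = k * N := by simp

/-- There are at most `k²` progressions through two given elements. -/
lemma card_through_two_le (N k : ℕ) (u v : ℕ) (huv : u ≠ v) :
    ((apSet N k).filter fun B => u ∈ B ∧ v ∈ B).card ≤ k ^ 2 := by
  classical
  -- The positions of `u ≠ v` determine the difference and then the first term.
  have key : ∀ B ∈ (apSet N k).filter (fun B => u ∈ B ∧ v ∈ B),
      ∃ ib : ℕ × ℕ, ib ∈ (Finset.range k) ×ˢ (Finset.range k) ∧ ∃ a b : ℕ,
      B = (Finset.range k).image (fun l => a + l * b) ∧ a + ib.1 * b = u ∧ a + ib.2 * b = v := by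
    intro B hB
    rw [Finset.mem_filter] at hB
    obtain ⟨a, b, ha, hb, hab⟩ := exists_of_mem_apSet hB.1
    have hu := hB.2.1
    have hv := hB.2.2
    rw [hab, Finset.mem_image] at hu hv
    obtain ⟨i, hi, hiu⟩ := hu
    obtain ⟨i', hi', hiv⟩ := hv
    exact ⟨(i, i'), by simp only [Finset.mem_product]; exact ⟨hi, hi'⟩, a, b, hab, hiu, hiv⟩
  choose! f hf hf' using key
  calc _ ≤ ((Finset.range k) ×ˢ (Finset.range k)).card := by
        refine Finset.card_le_card_of_injOn f hf ?_
        intro B hB B' hB' h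
        obtain ⟨a, b, h1, h2, h3⟩ := hf' B hB
        obtain ⟨a', b', h1', h2', h3'⟩ := hf' B' hB'
        rw [← h] at h2' h3'
        have e : (((f B).1 : ℤ) - (f B).2) * ((b : ℤ) - b') = 0 := by
          have e2 : (a : ℤ) + (f B).1 * b = u := by exact_mod_cast h2
          have e3 : (a : ℤ) + (f B).2 * b = v := by exact_mod_cast h3
          have e2' : (a' : ℤ) + (f B).1 * b' = u := by exact_mod_cast h2'
          have e3' : (a' : ℤ) + (f B).2 * b' = v := by exact_mod_cast h3'
          linear_combination e2 - e3 - e2' + e3'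
        have hne : ((f B).1 : ℤ) - (f B).2 ≠ 0 := by
          intro h0
          have h0 : (f B).1 = (f B).2 := by omega
          rw [h0, h3] at h2
          exact huv h2.symm
        have hb : b = b' := by
          rcases mul_eq_zero.1 e with h0 | h0
          · exact absurd h0 hne
          · omega
        subst hb
        have ha : a = a' := by omega
        rw [h1, h1', ha]
    _ = k ^ 2 := by simp [sq]

/-- The degree bound from pairs: progressions through `u` with another element in `S`. -/
lemma deg_two_le (N k : ℕ) (S : Finset ℕ) (u : ℕ) : deg N k 2 S u ≤ k ^ 2 * S.card := by
  classical
  rw [deg]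
  have : ((apSet N k).filter fun B => u ∈ B ∧ 2 ≤ (B ∩ S).card) ⊆
      (S.erase u).biUnion fun v => (apSet N k).filter fun B => u ∈ B ∧ v ∈ B := by
    intro B hB
    rw [Finset.mem_filter] at hB
    have h2 : 1 ≤ ((B ∩ S).erase u).card := by
      have := Finset.pred_card_le_card_erase (s := B ∩ S) (a := u)
      omega
    obtain ⟨v, hv⟩ := Finset.card_pos.1 h2
    simp only [Finset.mem_erase, Finset.mem_inter] at hv
    simp only [Finset.mem_biUnion, Finset.mem_erase, Finset.mem_filter]
    exact ⟨v, ⟨hv.1, hv.2.2⟩, hB.1, hB.2.1, hv.2.1⟩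
  refine (Finset.card_le_card this).trans (Finset.card_biUnion_le.trans ?_)
  calc _ ≤ ∑ v ∈ S.erase u, k ^ 2 := by
        refine Finset.sum_le_sum fun v hv => card_through_two_le N k u v ?_
        rw [Finset.mem_erase] at hv
        exact hv.1.symm
    _ ≤ k ^ 2 * S.card := by
        rw [Finset.sum_const, smul_eq_mul, mul_comm]
        exact Nat.mul_le_mul_left _ (Finset.card_erase_le)

lemma deg_one_le (N k : ℕ) (hk : 2 ≤ k) (S : Finset ℕ) (u : ℕ) : deg N k 1 S u ≤ k * N := by
  refine le_trans (Finset.card_le_card fun B hB => ?_) (card_through_le N k hk u)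
  rw [Finset.mem_filter] at hB ⊢
  exact ⟨hB.1, hB.2.1⟩

/-- A progression gained by passing from `F` to `S` passes through an element of `S \ F`. -/
lemma cnt_le_cnt_add_sum_deg (N k j : ℕ) (S F : Finset ℕ) :
    cnt N k j S ≤ cnt N k j F + ∑ u ∈ S \ F, deg N k j S u := by
  classical
  rw [cnt, cnt]
  calc _ ≤ (((apSet N k).filter fun B => j ≤ (B ∩ F).card) ∪
        (S \ F).biUnion fun u => (apSet N k).filter fun B => u ∈ B ∧ j ≤ (B ∩ S).card).card := by
        refine Finset.card_le_card fun B hB => ?_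
        rw [Finset.mem_filter] at hB
        simp only [Finset.mem_union, Finset.mem_biUnion, Finset.mem_filter]
        by_cases hBF : B ∩ S ⊆ F
        · left
          refine ⟨hB.1, hB.2.trans (Finset.card_le_card ?_)⟩
          exact Finset.subset_inter Finset.inter_subset_left hBF
        · right
          obtain ⟨u, hu, huF⟩ := Finset.not_subset.1 hBF
          rw [Finset.mem_inter] at hu
          exact ⟨u, by simp [hu.2, huF], hB.1, hu.1, hB.2⟩
    _ ≤ _ := (Finset.card_union_le _ _).trans (Nat.add_le_add_left Finset.card_biUnion_le _)

lemma cnt_one_le (N k : ℕ) (hk : 2 ≤ k) (S F : Finset ℕ) :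
    cnt N k 1 S ≤ cnt N k 1 F + (S \ F).card * (k * N) := by
  refine (cnt_le_cnt_add_sum_deg N k 1 S F).trans (Nat.add_le_add_left ?_ _)
  refine (Finset.sum_le_card_nsmul _ _ _ fun u _ => deg_one_le N k hk S u)

lemma cnt_two_le (N k : ℕ) (S F : Finset ℕ) {j : ℕ} (hj : 2 ≤ j) :
    cnt N k j S ≤ cnt N k j F + (S \ F).card * (k ^ 2 * S.card) := by
  refine (cnt_le_cnt_add_sum_deg N k j S F).trans (Nat.add_le_add_left ?_ _)
  exact Finset.sum_le_card_nsmul _ _ _ fun u _ => (deg_anti N k hj S u).trans (deg_two_le N k S u)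

lemma cnt_empty (N k j : ℕ) (hj : 1 ≤ j) : cnt N k j ∅ = 0 := by
  rw [cnt, Finset.card_eq_zero, Finset.filter_eq_empty_iff]
  intro B _
  simp
  omega

/-! ### Biased random subsets of a finite set -/

/-- The weight of `Q` as the `q`-biased random subset of a set with `n` elements. -/
noncomputable def wt (q : ℝ) (n : ℕ) (Q : Finset ℕ) : ℝ := q ^ Q.card * (1 - q) ^ (n - Q.card)

lemma wt_nonneg {q : ℝ} (h0 : 0 ≤ q) (h1 : q ≤ 1) (n : ℕ) (Q : Finset ℕ) : 0 ≤ wt q n Q :=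
  mul_nonneg (pow_nonneg h0 _) (pow_nonneg (by linarith) _)

lemma sum_wt (q : ℝ) (S : Finset ℕ) : ∑ Q ∈ S.powerset, wt q S.card Q = 1 := by
  simp only [wt, Finset.sum_pow_mul_eq_add_pow]
  simp

lemma sum_wt_superset (q : ℝ) {S T : Finset ℕ} (hT : T ⊆ S) :
    ∑ Q ∈ S.powerset, wt q S.card Q * (if T ⊆ Q then 1 else 0) = q ^ T.card := by
  have h : ∑ Q ∈ S.powerset, wt q S.card Q * (if T ⊆ Q then 1 else 0) =
      ∑ Q ∈ S.powerset.filter (fun Q => T ⊆ Q), wt q S.card Q := by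
    rw [Finset.sum_filter]
    refine Finset.sum_congr rfl fun Q _ => ?_
    split_ifs <;> simp
  rw [h]
  have h2 : ∑ Q ∈ S.powerset.filter (fun Q => T ⊆ Q), wt q S.card Q =
      ∑ Q ∈ (S \ T).powerset, q ^ T.card * wt q (S \ T).card Q := by
    refine Finset.sum_nbij' (fun Q => Q \ T) (fun Q => Q ∪ T) ?_ ?_ ?_ ?_ ?_
    · intro Q hQ
      simp only [Finset.mem_filter, Finset.mem_powerset] at hQ ⊢
      exact Finset.sdiff_subset_sdiff hQ.1 le_rfl
    · intro Q hQ
      simp only [Finset.mem_filter, Finset.mem_powerset] at hQ ⊢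
      exact ⟨Finset.union_subset (hQ.trans Finset.sdiff_subset) hT, Finset.subset_union_right⟩
    · intro Q hQ
      simp only [Finset.mem_filter, Finset.mem_powerset] at hQ
      exact Finset.sdiff_union_of_subset hQ.2
    · intro Q hQ
      simp only [Finset.mem_powerset] at hQ
      rw [Finset.union_sdiff_right, Finset.sdiff_eq_self_iff_disjoint]
      exact Finset.disjoint_of_subset_left hQ Finset.sdiff_disjoint
    · intro Q hQ
      simp only [Finset.mem_filter, Finset.mem_powerset] at hQ
      have e1 := Finset.card_sdiff_add_card_eq_card hQ.2
      have e2 := Finset.card_sdiff_add_card_eq_card hT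
      have e3 := Finset.card_le_card hQ.1
      rw [wt, wt, ← mul_assoc, ← pow_add]
      congr 2 <;> omega
  rw [h2, ← Finset.mul_sum, sum_wt, mul_one]

/-- Second moment bound: a `q`-biased random subset of `S` contains one of many `r`-sets that are
mostly disjoint from each other. -/
lemma sum_wt_avoid_le {ι : Type*} (𝓑 : Finset ι) (T : ι → Finset ℕ) (S : Finset ℕ) (r M : ℕ) {q : ℝ}
    (h0 : 0 < q) (h1 : q ≤ 1) (hT : ∀ b ∈ 𝓑, T b ⊆ S) (hr : ∀ b ∈ 𝓑, (T b).card = r)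
    (hM : ∀ b ∈ 𝓑, (𝓑.filter fun b' => ¬ Disjoint (T b) (T b')).card ≤ M) :
    (∑ Q ∈ S.powerset, wt q S.card Q * (if ∀ b ∈ 𝓑, ¬ T b ⊆ Q then 1 else 0)) *
      (𝓑.card * q ^ r) ≤ M := by
  classical
  set P := ∑ Q ∈ S.powerset, wt q S.card Q * (if ∀ b ∈ 𝓑, ¬ T b ⊆ Q then 1 else 0) with hP
  set e : ℝ := 𝓑.card * q ^ r with he
  have hqr : 0 < q ^ r := pow_pos h0 _
  have he0 : 0 ≤ e := by positivity
  rcases he0.eq_or_lt with h | hepos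
  · rw [← h]; simp
  let X : Finset ℕ → ℝ := fun Q => ∑ b ∈ 𝓑, if T b ⊆ Q then 1 else 0
  have hEX : ∑ Q ∈ S.powerset, wt q S.card Q * X Q = e := by
    simp only [X, Finset.mul_sum]
    rw [Finset.sum_comm, Finset.sum_congr rfl fun b hb => sum_wt_superset q (hT b hb),
      Finset.sum_congr rfl fun b hb => by rw [hr b hb]]
    simp [he]
  -- Disjoint pairs are independent and contribute at most `e ^ 2` in total. Each `b` has at most
  -- `M` intersecting partners, and such a pair has probability at most `q ^ r`.
  have hEX2 : ∑ Q ∈ S.powerset, wt q S.card Q * X Q ^ 2 ≤ e ^ 2 + M * e := by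
    have hX2 : ∀ Q, X Q ^ 2 = ∑ b ∈ 𝓑, ∑ b' ∈ 𝓑, if T b ∪ T b' ⊆ Q then (1 : ℝ) else 0 := by
      intro Q
      rw [sq, Finset.sum_mul_sum]
      refine Finset.sum_congr rfl fun b _ => Finset.sum_congr rfl fun b' _ => ?_
      by_cases h1 : T b ⊆ Q <;> by_cases h2 : T b' ⊆ Q <;> simp [Finset.union_subset_iff, h1, h2]
    simp only [hX2, Finset.mul_sum]
    rw [Finset.sum_comm]
    calc _ = ∑ b ∈ 𝓑, ∑ b' ∈ 𝓑, q ^ (T b ∪ T b').card := by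
          refine Finset.sum_congr rfl fun b hb => ?_
          rw [Finset.sum_comm]
          refine Finset.sum_congr rfl fun b' hb' => ?_
          exact sum_wt_superset q (Finset.union_subset (hT b hb) (hT b' hb'))
      _ ≤ ∑ b ∈ 𝓑, ∑ b' ∈ 𝓑, (q ^ r * q ^ r + if ¬ Disjoint (T b) (T b') then q ^ r else 0) := by
          refine Finset.sum_le_sum fun b hb => Finset.sum_le_sum fun b' hb' => ?_
          by_cases hd : Disjoint (T b) (T b')
          · rw [Finset.card_union_of_disjoint hd, hr b hb, hr b' hb', pow_add]
            simp [hd]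
          · rw [if_pos hd]
            have : q ^ (T b ∪ T b').card ≤ q ^ r := by
              refine pow_le_pow_of_le_one h0.le h1 ?_
              rw [← hr b hb]
              exact Finset.card_le_card Finset.subset_union_left
            have := mul_pos hqr hqr
            linarith
      _ ≤ ∑ b ∈ 𝓑, (𝓑.card * (q ^ r * q ^ r) + M * q ^ r) := by
          refine Finset.sum_le_sum fun b hb => ?_
          rw [Finset.sum_add_distrib, ← Finset.sum_filter]
          simp only [Finset.sum_const, nsmul_eq_mul]
          gcongr
          exact hM b hb
      _ = e ^ 2 + M * e := by
          rw [Finset.sum_const, nsmul_eq_mul, he]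
          ring
  have hvar : ∑ Q ∈ S.powerset, wt q S.card Q * (X Q - e) ^ 2 ≤ M * e := by
    have : ∀ Q, wt q S.card Q * (X Q - e) ^ 2 =
        wt q S.card Q * X Q ^ 2 - 2 * e * (wt q S.card Q * X Q) + e ^ 2 * wt q S.card Q := by
      intro Q; ring
    simp only [this, Finset.sum_add_distrib, Finset.sum_sub_distrib, ← Finset.mul_sum]
    rw [hEX, sum_wt]
    linarith
  -- Chebyshev: when every `T b` is avoided, `X = 0` deviates from its mean by exactly `e`.
  have hPe : P * e ^ 2 ≤ ∑ Q ∈ S.powerset, wt q S.card Q * (X Q - e) ^ 2 := by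
    rw [hP, Finset.sum_mul]
    refine Finset.sum_le_sum fun Q _ => ?_
    rw [mul_assoc]
    refine mul_le_mul_of_nonneg_left ?_ (wt_nonneg h0.le h1 _ _)
    split_ifs with h
    · have : X Q = 0 := Finset.sum_eq_zero fun b hb => if_neg (h b hb)
      rw [this]; linarith [sq_nonneg e]
    · simpa using sq_nonneg (X Q - e)
  have := hPe.trans hvar
  have h3 : (P * e) * e ≤ M * e := by linarith
  exact le_of_mul_le_mul_right h3 hepos

/-! ### Candidates and the sampling argument -/

open Classical in
/-- The elements that complete a progression of which `j - 1` other elements lie in `Q`. -/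
noncomputable def cand (N k j : ℕ) (Q : Finset ℕ) : Finset ℕ :=
  (Finset.Icc 1 N).filter fun x => ∃ B ∈ apSet N k, x ∈ B ∧ j - 1 ≤ (B.erase x ∩ Q).card

open Classical in
lemma card_cand_le (N k j : ℕ) (Q : Finset ℕ) : (cand N k j Q).card ≤ k * cnt N k (j - 1) Q := by
  have : cand N k j Q ⊆ ((apSet N k).filter fun B => j - 1 ≤ (B ∩ Q).card).biUnion id := by
    intro x hx
    rw [cand, Finset.mem_filter] at hx
    obtain ⟨_, B, hB, hxB, hc⟩ := hx
    rw [Finset.mem_biUnion]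
    refine ⟨B, ?_, hxB⟩
    rw [Finset.mem_filter]
    exact ⟨hB, hc.trans (Finset.card_le_card
      (Finset.inter_subset_inter_right (Finset.erase_subset _ _)))⟩
  refine (Finset.card_le_card this).trans (Finset.card_biUnion_le.trans ?_)
  rw [cnt, mul_comm]
  refine Finset.sum_le_card_nsmul _ _ _ fun B hB => ?_
  rw [Finset.mem_filter] at hB
  exact (card_of_mem_apSet hB.1).le

/-- From each progression `B` counted by the degree of `u`, pick `j - 1` points of `B ∩ S` other
than `u`; if they all fall into `Q`, then `u` is a candidate. Two such sets intersect only when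
their progressions share a point besides `u`, so each intersects at most `(j - 1) k² ≤ k³` of them,
and `sum_wt_avoid_le` applies. -/
lemma sum_wt_notMem_cand_le (N k j : ℕ) (hj : 2 ≤ j) (hjk : j ≤ k) (S : Finset ℕ) {D q : ℝ}
    (hD : 0 < D) (h0 : 0 < q) (h1 : q ≤ 1) (u : ℕ) (hdeg : D ≤ deg N k j S u) :
    ∑ Q ∈ S.powerset, wt q S.card Q * (if u ∉ cand N k j Q then 1 else 0) ≤
      k ^ 3 / (D * q ^ (j - 1)) := by
  classical
  set 𝓑 := (apSet N k).filter fun B => u ∈ B ∧ j ≤ (B ∩ S).card with h𝓑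
  have hex : ∀ B ∈ 𝓑, ∃ T ⊆ (B ∩ S).erase u, T.card = j - 1 := by
    intro B hB
    rw [h𝓑, Finset.mem_filter] at hB
    refine Finset.exists_subset_card_eq ?_
    have := Finset.pred_card_le_card_erase (s := B ∩ S) (a := u)
    omega
  choose! T hT hTc using hex
  have hTS : ∀ B ∈ 𝓑, T B ⊆ S := fun B hB =>
    (hT B hB).trans ((Finset.erase_subset _ _).trans Finset.inter_subset_right)
  have hM : ∀ B ∈ 𝓑, (𝓑.filter fun B' => ¬ Disjoint (T B) (T B')).card ≤ k ^ 3 := by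
    intro B hB
    have hsub : (𝓑.filter fun B' => ¬ Disjoint (T B) (T B')) ⊆
        (T B).biUnion fun v => (apSet N k).filter fun B' => u ∈ B' ∧ v ∈ B' := by
      intro B' hB'
      rw [Finset.mem_filter, Finset.not_disjoint_iff] at hB'
      obtain ⟨hB'1, v, hv, hv'⟩ := hB'
      rw [Finset.mem_biUnion]
      refine ⟨v, hv, ?_⟩
      have := hT B' hB'1 hv'
      rw [h𝓑, Finset.mem_filter] at hB'1
      simp only [Finset.mem_erase, Finset.mem_inter] at this
      rw [Finset.mem_filter]
      exact ⟨hB'1.1, hB'1.2.1, this.2.1⟩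
    refine (Finset.card_le_card hsub).trans (Finset.card_biUnion_le.trans ?_)
    calc _ ≤ ∑ v ∈ T B, k ^ 2 := by
          refine Finset.sum_le_sum fun v hv => card_through_two_le N k u v ?_
          have := hT B hB hv
          simp only [Finset.mem_erase] at this
          exact this.1.symm
      _ = (j - 1) * k ^ 2 := by rw [Finset.sum_const, hTc B hB, smul_eq_mul]
      _ ≤ k * k ^ 2 := Nat.mul_le_mul_right _ (by omega)
      _ = k ^ 3 := by ring
  have key := sum_wt_avoid_le 𝓑 T S (j - 1) (k ^ 3) h0 h1 hTS hTc hM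
  have hcard : (𝓑.card : ℝ) = deg N k j S u := by rw [h𝓑, deg]
  have hq : 0 < q ^ (j - 1) := pow_pos h0 _
  rw [le_div_iff₀ (mul_pos hD hq)]
  have hmono : ∑ Q ∈ S.powerset, wt q S.card Q * (if u ∉ cand N k j Q then 1 else 0) ≤
      ∑ Q ∈ S.powerset, wt q S.card Q * (if ∀ B ∈ 𝓑, ¬ T B ⊆ Q then 1 else 0) := by
    refine Finset.sum_le_sum fun Q _ => mul_le_mul_of_nonneg_left ?_ (wt_nonneg h0.le h1 _ _)
    by_cases hu : u ∈ cand N k j Q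
    · simp only [hu, not_true_eq_false, if_false]
      split_ifs <;> norm_num
    · rw [if_pos hu, if_pos]
      intro B hB hTQ
      apply hu
      have hB' := hB
      rw [h𝓑, Finset.mem_filter] at hB'
      rw [cand, Finset.mem_filter]
      refine ⟨subset_Icc_of_mem_apSet hB'.1 hB'.2.1, B, hB'.1, hB'.2.1, ?_⟩
      rw [← hTc B hB]
      refine Finset.card_le_card fun v hv => ?_
      have := hT B hB hv
      simp only [Finset.mem_erase, Finset.mem_inter] at this ⊢
      exact ⟨⟨this.1, this.2.1⟩, hTQ hv⟩
  have hnn : 0 ≤ ∑ Q ∈ S.powerset, wt q S.card Q * (if ∀ B ∈ 𝓑, ¬ T B ⊆ Q then 1 else 0) := by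
    refine Finset.sum_nonneg fun Q _ => mul_nonneg (wt_nonneg h0.le h1 _ _) ?_
    split_ifs <;> norm_num
  calc _ ≤ (∑ Q ∈ S.powerset, wt q S.card Q * (if ∀ B ∈ 𝓑, ¬ T B ⊆ Q then 1 else 0)) *
        (𝓑.card * q ^ (j - 1)) := by
        rw [hcard]; gcongr
    _ ≤ _ := by exact_mod_cast key

lemma sum_wt_card (q : ℝ) (S : Finset ℕ) :
    ∑ Q ∈ S.powerset, wt q S.card Q * Q.card = q * S.card := by
  classical
  have : ∀ Q ∈ S.powerset, wt q S.card Q * (Q.card : ℝ) =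
      ∑ x ∈ S, wt q S.card Q * (if {x} ⊆ Q then 1 else 0) := by
    intro Q hQ
    rw [Finset.mem_powerset] at hQ
    rw [← Finset.mul_sum]
    congr 1
    simp only [Finset.singleton_subset_iff]
    rw [Finset.sum_ite_mem, Finset.inter_eq_right.2 hQ]
    simp
  rw [Finset.sum_congr rfl this, Finset.sum_comm,
    Finset.sum_congr rfl fun x hx => sum_wt_superset q (Finset.singleton_subset_iff.2 hx)]
  simp [mul_comm]

/-- A progression counted for `Q` has an `i`-subset of `B ∩ S` inside `Q`; there are at most `2 ^ k`
such subsets, each contained in `Q` with probability `q ^ i`. -/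
lemma sum_wt_cnt_le (N k i : ℕ) (S : Finset ℕ) {q : ℝ} (h0 : 0 < q) (h1 : q ≤ 1) :
    ∑ Q ∈ S.powerset, wt q S.card Q * cnt N k i Q ≤ 2 ^ k * q ^ i * cnt N k i S := by
  classical
  set 𝓑 := (apSet N k).filter fun B => i ≤ (B ∩ S).card with h𝓑
  have hQ : ∀ Q ∈ S.powerset, wt q S.card Q * (cnt N k i Q : ℝ) ≤
      ∑ B ∈ 𝓑, ∑ T ∈ (B ∩ S).powersetCard i, wt q S.card Q * (if T ⊆ Q then 1 else 0) := by
    intro Q hQ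
    rw [Finset.mem_powerset] at hQ
    simp only [← Finset.mul_sum]
    refine mul_le_mul_of_nonneg_left ?_ (wt_nonneg h0.le h1 _ _)
    have : cnt N k i Q = ∑ B ∈ 𝓑, if i ≤ (B ∩ Q).card then 1 else 0 := by
      rw [cnt, ← Finset.card_filter]
      congr 1
      ext B
      simp only [h𝓑, Finset.mem_filter]
      constructor
      · rintro ⟨h, h'⟩
        exact ⟨⟨h, h'.trans (Finset.card_le_card (Finset.inter_subset_inter_left hQ))⟩, h'⟩
      · rintro ⟨⟨h, _⟩, h'⟩
        exact ⟨h, h'⟩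
    rw [this, Nat.cast_sum]
    refine Finset.sum_le_sum fun B hB => ?_
    split_ifs with hi
    · obtain ⟨T, hT, hTc⟩ := Finset.exists_subset_card_eq hi
      have hmem : T ∈ (B ∩ S).powersetCard i :=
        Finset.mem_powersetCard.2 ⟨hT.trans (Finset.inter_subset_inter_left hQ), hTc⟩
      have h2 : (1 : ℝ) = if T ⊆ Q then 1 else 0 :=
        (if_pos (hT.trans Finset.inter_subset_right)).symm
      rw [Nat.cast_one]
      refine h2.le.trans ?_
      refine Finset.single_le_sum (f := fun T => if T ⊆ Q then (1 : ℝ) else 0) ?_ hmem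
      intro T _
      split_ifs <;> norm_num
    · simp only [Nat.cast_zero]
      refine Finset.sum_nonneg fun T _ => ?_
      split_ifs <;> norm_num
  refine (Finset.sum_le_sum hQ).trans ?_
  rw [Finset.sum_comm]
  calc _ ≤ ∑ B ∈ 𝓑, 2 ^ k * q ^ i := by
        refine Finset.sum_le_sum fun B hB => ?_
        rw [Finset.sum_comm]
        have : ∀ T ∈ (B ∩ S).powersetCard i,
            ∑ Q ∈ S.powerset, wt q S.card Q * (if T ⊆ Q then 1 else 0) = q ^ i := by
          intro T hT
          rw [Finset.mem_powersetCard] at hT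
          rw [sum_wt_superset q (hT.1.trans Finset.inter_subset_right), hT.2]
        rw [Finset.sum_congr rfl this, Finset.sum_const, nsmul_eq_mul, Finset.card_powersetCard]
        refine mul_le_mul_of_nonneg_right ?_ (by positivity)
        have hBk : (B ∩ S).card ≤ k := by
          rw [h𝓑, Finset.mem_filter] at hB
          rw [← card_of_mem_apSet hB.1]
          exact Finset.card_le_card Finset.inter_subset_left
        have h2 : ((B ∩ S).card).choose i ≤ 2 ^ k :=
          (Nat.choose_le_two_pow _ _).trans (Nat.pow_le_pow_right (by norm_num) hBk)
        exact_mod_cast h2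
    _ = 2 ^ k * q ^ i * cnt N k i S := by
        rw [Finset.sum_const, nsmul_eq_mul, cnt]
        ring

/-- If every element of `W ⊆ S` lies in many progressions that meet `S` in `j` elements, then a
small subset `Q` of `S` makes most elements of `W` candidates, without creating too many
candidates. -/
theorem exists_sample (N k j : ℕ) (hj : 2 ≤ j) (hjk : j ≤ k) (S W : Finset ℕ) (hW : W ⊆ S)
    (hne : W.Nonempty) {D q : ℝ} (hD : 0 < D) (h0 : 0 < q) (h1 : q ≤ 1)
    (hdeg : ∀ u ∈ W, D ≤ deg N k j S u) :
    ∃ Q ⊆ S, (Q.card : ℝ) ≤ 3 * (q * S.card) ∧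
      (cnt N k (j - 1) Q : ℝ) ≤ 3 * (2 ^ k * q ^ (j - 1) * cnt N k (j - 1) S) ∧
      ((W \ cand N k j Q).card : ℝ) ≤ 3 * (k ^ 3 / (D * q ^ (j - 1)) * W.card) := by
  classical
  have hq : 0 < q ^ (j - 1) := pow_pos h0 _
  have hk0 : (0 : ℝ) < k := by
    have : 0 < k := by omega
    exact_mod_cast this
  have hWc : (0 : ℝ) < W.card := by exact_mod_cast hne.card_pos
  have ha1 : 0 < q * S.card := by
    have : (0 : ℝ) < S.card := by exact_mod_cast (hne.mono hW).card_pos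
    positivity
  have hcpos : (0 : ℝ) < cnt N k (j - 1) S := by
    obtain ⟨u, hu⟩ := hne
    have h2 : deg N k j S u ≤ cnt N k (j - 1) S := by
      refine Finset.card_le_card fun B hB => ?_
      rw [Finset.mem_filter] at hB ⊢
      exact ⟨hB.1, by omega⟩
    have h3 : (deg N k j S u : ℝ) ≤ cnt N k (j - 1) S := by exact_mod_cast h2
    linarith [hdeg u hu]
  have ha2 : 0 < 2 ^ k * q ^ (j - 1) * (cnt N k (j - 1) S : ℝ) := by positivity
  have ha3 : 0 < k ^ 3 / (D * q ^ (j - 1)) * (W.card : ℝ) := by positivity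
  set a1 := q * (S.card : ℝ)
  set a2 := 2 ^ k * q ^ (j - 1) * (cnt N k (j - 1) S : ℝ)
  set a3 := k ^ 3 / (D * q ^ (j - 1)) * (W.card : ℝ) with ha3def
  have e3 : ∑ Q ∈ S.powerset, wt q S.card Q * ((W \ cand N k j Q).card : ℝ) ≤ a3 := by
    have : ∀ Q ∈ S.powerset, wt q S.card Q * ((W \ cand N k j Q).card : ℝ) =
        ∑ u ∈ W, wt q S.card Q * (if u ∉ cand N k j Q then 1 else 0) := by
      intro Q _
      rw [← Finset.mul_sum]
      congr 1
      rw [← Finset.sum_filter, ← Finset.sdiff_eq_filter]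
      simp
    rw [Finset.sum_congr rfl this, Finset.sum_comm]
    calc _ ≤ ∑ u ∈ W, k ^ 3 / (D * q ^ (j - 1)) := Finset.sum_le_sum fun u hu =>
          sum_wt_notMem_cand_le N k j hj hjk S hD h0 h1 u (hdeg u hu)
      _ = a3 := by rw [Finset.sum_const, nsmul_eq_mul, ha3def, mul_comm]
  by_contra hcon
  push Not at hcon
  -- Three nonnegative quantities, each normalized to have mean at most 1. If every `Q` violated one
  -- of the three bounds, the sum would exceed 3 everywhere although its mean is at most 3.
  let f : Finset ℕ → ℝ := fun Q => (Q.card : ℝ) / a1 + (cnt N k (j - 1) Q : ℝ) / a2 +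
    ((W \ cand N k j Q).card : ℝ) / a3
  have hf : ∀ Q ∈ S.powerset, 3 < f Q := by
    intro Q hQ
    rw [Finset.mem_powerset] at hQ
    have n1 : 0 ≤ (Q.card : ℝ) / a1 := by positivity
    have n2 : 0 ≤ (cnt N k (j - 1) Q : ℝ) / a2 := by positivity
    have n3 : 0 ≤ ((W \ cand N k j Q).card : ℝ) / a3 := by positivity
    by_contra hle
    push Not at hle
    have := hcon Q hQ ((div_le_iff₀ ha1).1 (by simp only [f] at hle; linarith))
      ((div_le_iff₀ ha2).1 (by simp only [f] at hle; linarith))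
    have h3 := (div_le_iff₀ ha3).1 (show ((W \ cand N k j Q).card : ℝ) / a3 ≤ 3 by
      simp only [f] at hle; linarith)
    linarith
  have hE : ∑ Q ∈ S.powerset, wt q S.card Q * f Q ≤ 3 := by
    have : ∀ Q, wt q S.card Q * f Q = (wt q S.card Q * Q.card) / a1 +
        (wt q S.card Q * cnt N k (j - 1) Q) / a2 +
        (wt q S.card Q * (W \ cand N k j Q).card) / a3 := by
      intro Q; simp only [f]; ring
    simp only [this, Finset.sum_add_distrib, ← Finset.sum_div]
    have i1 : (∑ Q ∈ S.powerset, wt q S.card Q * (Q.card : ℝ)) / a1 ≤ 1 :=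
      (div_le_one ha1).2 (sum_wt_card q S).le
    have i2 := (div_le_one ha2).2 (sum_wt_cnt_le N k (j - 1) S h0 h1)
    have i3 := (div_le_one ha3).2 e3
    linarith
  have hlt : ∑ Q ∈ S.powerset, wt q S.card Q * 3 < ∑ Q ∈ S.powerset, wt q S.card Q * f Q := by
    -- Strictness comes from `Q = S`, whose weight `q ^ |S|` is positive even when `q = 1`.
    refine Finset.sum_lt_sum (fun Q hQ => mul_le_mul_of_nonneg_left (hf Q hQ).le
      (wt_nonneg h0.le h1 _ _)) ⟨S, Finset.mem_powerset_self S, ?_⟩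
    refine mul_lt_mul_of_pos_left (hf S (Finset.mem_powerset_self S)) ?_
    rw [wt, Nat.sub_self, pow_zero, mul_one]
    exact pow_pos h0 _
  rw [← Finset.sum_mul, sum_wt] at hlt
  linarith

/-! ### Certificate events and their probability -/

/-- The event that `R` contains a set `Q` of at most `r₀` elements with at most `M` candidates,
together with `n` further candidates of `Q`. -/
def certEvent (N k j : ℕ) (r₀ M : ℝ) (n : ℕ) : Set (Set ℕ) :=
  {R | ∃ Q G : Finset ℕ, Q ⊆ Finset.Icc 1 N ∧ (Q : Set ℕ) ⊆ R ∧ (G : Set ℕ) ⊆ R ∧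
    (Q.card : ℝ) ≤ r₀ ∧ ((cand N k j Q).card : ℝ) ≤ M ∧ G ⊆ cand N k j Q \ Q ∧ G.card = n}

/-- Exponential tilting: with `ρ = r₀ / Y ≤ 1`, the constraint `|Q| ≤ r₀` gives `1 ≤ ρ ^ (|Q| -
r₀)`, after which the sum may be taken over all `Q` by the binomial theorem. An upper bound `Y` on
`Np` suffices, which keeps `N` out of later estimates. -/
lemma sum_pow_card_le {N : ℕ} {p r₀ Y : ℝ} (hp : 0 ≤ p) (hr : 0 < r₀) (hrY : r₀ ≤ Y)
    (hY : N * p ≤ Y) :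
    ∑ Q ∈ (Finset.Icc 1 N).powerset with (Q.card : ℝ) ≤ r₀, p ^ Q.card ≤
      Real.exp (r₀ * (1 + Real.log (Y / r₀))) := by
  have hYpos : 0 < Y := hr.trans_le hrY
  set ρ := r₀ / Y with hρ
  have hρ0 : 0 < ρ := div_pos hr hYpos
  have hρ1 : ρ ≤ 1 := (div_le_one hYpos).2 hrY
  calc _ ≤ ∑ Q ∈ (Finset.Icc 1 N).powerset with (Q.card : ℝ) ≤ r₀,
        ρ ^ (-r₀) * (ρ * p) ^ Q.card := by
        refine Finset.sum_le_sum fun Q hQ => ?_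
        rw [Finset.mem_filter] at hQ
        have h1 : 1 ≤ ρ ^ (-r₀) * ρ ^ Q.card := by
          rw [← Real.rpow_natCast ρ, ← Real.rpow_add hρ0]
          exact Real.one_le_rpow_of_pos_of_le_one_of_nonpos hρ0 hρ1 (by linarith [hQ.2])
        rw [mul_pow, ← mul_assoc]
        exact le_mul_of_one_le_left (pow_nonneg hp _) h1
    _ ≤ ∑ Q ∈ (Finset.Icc 1 N).powerset, ρ ^ (-r₀) * (ρ * p) ^ Q.card := by
        refine Finset.sum_le_sum_of_subset_of_nonneg (Finset.filter_subset _ _) fun Q _ _ => ?_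
        positivity
    _ = ρ ^ (-r₀) * (1 + ρ * p) ^ N := by
        rw [← Finset.mul_sum]
        have := Finset.sum_pow_mul_eq_add_pow (ρ * p) 1 (Finset.Icc 1 N)
        simp only [one_pow, mul_one, Nat.card_Icc, Nat.add_sub_cancel] at this
        rw [this, add_comm]
    _ ≤ ρ ^ (-r₀) * Real.exp r₀ := by
        gcongr
        calc (1 + ρ * p) ^ N ≤ (Real.exp (ρ * p)) ^ N := by
              gcongr
              linarith [Real.add_one_le_exp (ρ * p)]
          _ = Real.exp (N * (ρ * p)) := (Real.exp_nat_mul _ _).symm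
          _ ≤ Real.exp r₀ := by
              rw [Real.exp_le_exp]
              calc N * (ρ * p) = ρ * (N * p) := by ring
                _ ≤ ρ * Y := by gcongr
                _ = r₀ := by rw [hρ]; field_simp
    _ = Real.exp (r₀ * (1 + Real.log (Y / r₀))) := by
        rw [Real.rpow_def_of_pos hρ0, ← Real.exp_add]
        congr 1
        have : Real.log (Y / r₀) = - Real.log ρ := by
          rw [hρ, ← Real.log_inv, inv_div]
        rw [this]; ring

/-- Union bound over `Q` and `G`. As `G` avoids `Q`, the pair has probability `p ^ |Q| p ^ n`; there
are at most `M ^ n / n!` choices of `G`, and `n! ≥ (n / e) ^ n`. -/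
theorem certEvent_le (N k j : ℕ) (p : I) {r₀ M Y : ℝ} {n : ℕ} (hr : 0 < r₀) (hrY : r₀ ≤ Y)
    (hY : N * (p : ℝ) ≤ Y) (hM : 0 ≤ M) (hn : 0 < n) :
    (randomSet N p).real (certEvent N k j r₀ M n) ≤
      Real.exp (r₀ * (1 + Real.log (Y / r₀))) * (Real.exp 1 * M * p / n) ^ n := by
  classical
  have hp0 : 0 ≤ (p : ℝ) := p.2.1
  set 𝓠 := (Finset.Icc 1 N).powerset.filter
    (fun Q => (Q.card : ℝ) ≤ r₀ ∧ ((cand N k j Q).card : ℝ) ≤ M) with h𝓠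
  have hsub : certEvent N k j r₀ M n ⊆
      ⋃ Q ∈ 𝓠, ⋃ G ∈ (cand N k j Q \ Q).powersetCard n,
        {R : Set ℕ | ((Q ∪ G : Finset ℕ) : Set ℕ) ⊆ R} := by
    rintro R ⟨Q, G, hQ, hQR, hGR, hQr, hcM, hG, hGn⟩
    simp only [Set.mem_iUnion]
    refine ⟨Q, ?_, G, Finset.mem_powersetCard.2 ⟨hG, hGn⟩, ?_⟩
    · rw [h𝓠, Finset.mem_filter, Finset.mem_powerset]
      exact ⟨hQ, hQr, hcM⟩
    · simp [hQR, hGR]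
  have hcand : ∀ Q, cand N k j Q ⊆ Finset.Icc 1 N := fun Q => Finset.filter_subset _ _
  have hnf : (0 : ℝ) < n.factorial := by exact_mod_cast n.factorial_pos
  have hfac : (M * p) ^ n / n.factorial ≤ (Real.exp 1 * M * p / n) ^ n := by
    have h1 := Real.pow_div_factorial_le_exp (x := (n : ℝ)) (by positivity) n
    have hn' : (0 : ℝ) < n := by exact_mod_cast hn
    have h2 : (M * p) ^ n / n.factorial = (M * p / n) ^ n * ((n : ℝ) ^ n / n.factorial) := by
      rw [div_pow]; field_simp
    rw [h2]
    calc _ ≤ (M * p / n) ^ n * Real.exp n := by gcongr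
      _ = _ := by
        rw [← Real.exp_one_pow, ← mul_pow]; congr 1; ring
  calc _ ≤ (randomSet N p).real (⋃ Q ∈ 𝓠, ⋃ G ∈ (cand N k j Q \ Q).powersetCard n,
        {R : Set ℕ | ((Q ∪ G : Finset ℕ) : Set ℕ) ⊆ R}) :=
        measureReal_mono hsub (measure_ne_top _ _)
    _ ≤ ∑ Q ∈ 𝓠, ∑ G ∈ (cand N k j Q \ Q).powersetCard n,
        (randomSet N p).real {R : Set ℕ | ((Q ∪ G : Finset ℕ) : Set ℕ) ⊆ R} :=
        (measureReal_biUnion_finset_le _ _).trans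
          (Finset.sum_le_sum fun Q _ => measureReal_biUnion_finset_le _ _)
    _ ≤ ∑ Q ∈ 𝓠, (p : ℝ) ^ Q.card * ((M * p) ^ n / n.factorial) := by
        refine Finset.sum_le_sum fun Q hQ => ?_
        rw [h𝓠, Finset.mem_filter, Finset.mem_powerset] at hQ
        have h1 : ∀ G ∈ (cand N k j Q \ Q).powersetCard n,
            (randomSet N p).real {R : Set ℕ | ((Q ∪ G : Finset ℕ) : Set ℕ) ⊆ R} =
              (p : ℝ) ^ Q.card * (p : ℝ) ^ n := by
          intro G hG
          rw [Finset.mem_powersetCard] at hG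
          rw [randomSet_superset, Finset.card_union_of_disjoint, hG.2, pow_add]
          · exact Finset.disjoint_of_subset_right hG.1 Finset.disjoint_sdiff
          · exact Finset.union_subset hQ.1
              (hG.1.trans (Finset.sdiff_subset.trans (hcand Q)))
        rw [Finset.sum_congr rfl h1, Finset.sum_const, nsmul_eq_mul, Finset.card_powersetCard]
        have h2 : (((cand N k j Q \ Q).card.choose n : ℕ) : ℝ) ≤ M ^ n / n.factorial := by
          refine (Nat.choose_le_pow_div n _).trans ?_
          gcongr
          refine le_trans ?_ hQ.2.2
          exact_mod_cast Finset.card_le_card Finset.sdiff_subset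
        calc _ ≤ M ^ n / n.factorial * ((p : ℝ) ^ Q.card * (p : ℝ) ^ n) := by gcongr
          _ = _ := by rw [mul_pow]; ring
    _ = (∑ Q ∈ 𝓠, (p : ℝ) ^ Q.card) * ((M * p) ^ n / n.factorial) := by rw [Finset.sum_mul]
    _ ≤ (∑ Q ∈ (Finset.Icc 1 N).powerset with (Q.card : ℝ) ≤ r₀, (p : ℝ) ^ Q.card) *
        ((M * p) ^ n / n.factorial) := by
        refine mul_le_mul_of_nonneg_right ?_ (by positivity)
        refine Finset.sum_le_sum_of_subset_of_nonneg ?_ fun Q _ _ => pow_nonneg hp0 _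
        intro Q hQ
        rw [h𝓠, Finset.mem_filter] at hQ
        rw [Finset.mem_filter]
        exact ⟨hQ.1, hQ.2.1⟩
    _ ≤ _ := by
        refine mul_le_mul (sum_pow_card_le hp0 hr hrY hY) hfac (by positivity) (by positivity)

/-- The sampling lemma, phrased as membership in a certificate event. -/
theorem mem_certEvent (N k j : ℕ) (hj : 2 ≤ j) (hjk : j ≤ k) (S W : Finset ℕ) (hW : W ⊆ S)
    (hSN : S ⊆ Finset.Icc 1 N) (hne : W.Nonempty) {D γ C r₀ M : ℝ} {n : ℕ} (hγ : 0 < γ)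
    (hC : C = 3 * k ^ 3 / γ) (hD : C ≤ D)
    (hdeg : ∀ u ∈ W, D ≤ deg N k j S u)
    (hr₀ : 3 * ((C / D) ^ (1 / ((j : ℝ) - 1)) * S.card) ≤ r₀)
    (hM : 3 * k * 2 ^ k * C * (cnt N k (j - 1) S / D) ≤ M)
    (hn : (n : ℝ) < (1 - γ) * W.card - r₀ + 1) {R : Set ℕ} (hR : (S : Set ℕ) ⊆ R) :
    R ∈ certEvent N k j r₀ M n := by
  have hk0 : (0 : ℝ) < k := by
    have : 0 < k := by omega
    exact_mod_cast this
  have hCpos : 0 < C := by rw [hC]; positivity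
  have hDpos : 0 < D := hCpos.trans_le hD
  have hj1 : (0 : ℝ) < (j : ℝ) - 1 := by
    have : (2 : ℝ) ≤ j := by exact_mod_cast hj
    linarith
  have hCD : 0 < C / D := div_pos hCpos hDpos
  have hCD1 : C / D ≤ 1 := (div_le_one hDpos).2 hD
  -- The rate with `D q ^ (j - 1) = C = 3 k³ / γ`: sampling then leaves at most a fraction `γ` of
  -- `W` outside the candidates.
  set q := (C / D) ^ (1 / ((j : ℝ) - 1)) with hq
  have hq0 : 0 < q := Real.rpow_pos_of_pos hCD _
  have hq1 : q ≤ 1 := Real.rpow_le_one hCD.le hCD1 (by positivity)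
  have hqj : q ^ (j - 1) = C / D := by
    rw [← Real.rpow_natCast, hq, ← Real.rpow_mul hCD.le, Nat.cast_sub (by omega), Nat.cast_one,
      one_div_mul_cancel hj1.ne', Real.rpow_one]
  obtain ⟨Q, hQS, h1, h2, h3⟩ := exists_sample N k j hj hjk S W hW hne hDpos hq0 hq1 hdeg
  rw [hqj] at h2 h3
  have h3' : ((W \ cand N k j Q).card : ℝ) ≤ γ * W.card := by
    refine h3.trans (le_of_eq ?_)
    have : D * (C / D) = C := by field_simp
    rw [this, hC]
    field_simp
  have hcount : n ≤ ((W ∩ cand N k j Q) \ Q).card := by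
    have e1 := Finset.card_sdiff_add_card_inter W (cand N k j Q)
    have e2 := Finset.le_card_sdiff Q (W ∩ cand N k j Q)
    have e1' : ((W \ cand N k j Q).card : ℝ) + (W ∩ cand N k j Q).card = W.card := by
      exact_mod_cast e1
    have e2' : ((W ∩ cand N k j Q).card : ℝ) ≤ ((W ∩ cand N k j Q) \ Q).card + Q.card := by
      have : (W ∩ cand N k j Q).card ≤ ((W ∩ cand N k j Q) \ Q).card + Q.card := by omega
      exact_mod_cast this
    have : (n : ℝ) < ((W ∩ cand N k j Q) \ Q).card + 1 := by
      have := h1.trans hr₀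
      nlinarith
    have : n < ((W ∩ cand N k j Q) \ Q).card + 1 := by exact_mod_cast this
    omega
  obtain ⟨G, hG, hGn⟩ := Finset.exists_subset_card_eq hcount
  refine ⟨Q, G, hQS.trans hSN, ?_, ?_, h1.trans hr₀, ?_, ?_, hGn⟩
  · exact (Finset.coe_subset.2 hQS).trans hR
  · refine (Finset.coe_subset.2 ?_).trans hR
    exact hG.trans (Finset.sdiff_subset.trans (Finset.inter_subset_left.trans hW))
  · refine le_trans ?_ hM
    have h4 : ((cand N k j Q).card : ℝ) ≤ k * cnt N k (j - 1) Q := by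
      exact_mod_cast card_cand_le N k j Q
    refine h4.trans ?_
    calc (k : ℝ) * cnt N k (j - 1) Q ≤ k * (3 * (2 ^ k * (C / D) * cnt N k (j - 1) S)) := by gcongr
      _ = _ := by ring
  · exact hG.trans (Finset.sdiff_subset_sdiff Finset.inter_subset_right le_rfl)

/-! ### Progressions in intervals and the completion of near-seeds -/

open Classical in
lemma mem_apSet_of_range {N k a b : ℕ} (ha : 0 < a) (hb : 0 < b) (hN : a + (k - 1) * b ≤ N) :
    (Finset.range k).image (fun i => a + i * b) ∈ apSet N k := by
  rw [apSet, Finset.mem_filter, Finset.mem_powersetCard]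
  refine ⟨⟨?_, ?_⟩, a, b, ha, hb, rfl⟩
  · intro x hx
    rw [Finset.mem_image] at hx
    obtain ⟨i, hi, rfl⟩ := hx
    rw [Finset.mem_range] at hi
    have : i * b ≤ (k - 1) * b := Nat.mul_le_mul_right _ (by omega)
    rw [Finset.mem_Icc]
    omega
  · rw [Finset.card_image_of_injective _ (fun i i' h => ?_), Finset.card_range]
    exact Nat.eq_of_mul_eq_mul_right hb (by simpa using h)

lemma image_range_subset {k a b x y : ℕ} (h1 : x ≤ a) (h2 : a + (k - 1) * b ≤ y) :
    (Finset.range k).image (fun i => a + i * b) ⊆ Finset.Icc x y := by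
  intro z hz
  rw [Finset.mem_image] at hz
  obtain ⟨i, hi, rfl⟩ := hz
  rw [Finset.mem_range] at hi
  have : i * b ≤ (k - 1) * b := Nat.mul_le_mul_right _ (by omega)
  rw [Finset.mem_Icc]
  omega

/-- Every element of an interval of length `r` lies in many progressions inside the interval. -/
lemma le_card_through_in_interval (N k : ℕ) (hk : 2 ≤ k) {x r : ℕ} (hN : x + r ≤ N) {v : ℕ}
    (hv : v ∈ Finset.Icc (x + 1) (x + r)) :
    r / (2 * k) ≤ ((apSet N k).filter fun B => v ∈ B ∧ B ⊆ Finset.Icc (x + 1) (x + r)).card := by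
  classical
  rw [Finset.mem_Icc] at hv
  set h := r / (2 * k) with hh
  have hhr : 2 * k * h ≤ r := Nat.mul_div_le r (2 * k)
  have hroom : ∀ b ∈ Finset.Icc 1 h, 2 * ((k - 1) * b) + 2 ≤ r := by
    intro b hb
    rw [Finset.mem_Icc] at hb
    have h1 : (k - 1) * b + b = k * b := by
      rw [← Nat.succ_mul]; congr 1; omega
    have h2 : k * b ≤ k * h := Nat.mul_le_mul_left _ hb.2
    have : 2 * k * h = 2 * (k * h) := by ring
    omega
  have hcard : h = (Finset.Icc 1 h).card := by simp
  rw [hcard]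
  -- In the lower half, `v` serves as first term of progressions running right; in the upper half,
  -- as last term of progressions running left. Every difference up to `r / (2k)` fits.
  rcases le_or_gt (2 * (v - x)) (r + 1) with hlow | hhigh
  · refine Finset.card_le_card_of_injOn
      (fun b => (Finset.range k).image (fun i => v + i * b)) ?_ ?_
    · intro b hb
      have hb1 := hroom b hb
      have hb2 := (Finset.mem_Icc.1 hb).1
      simp only [Finset.coe_filter, Set.mem_ofPred_eq]
      refine ⟨mem_apSet_of_range (by omega) hb2 (by omega), ?_, ?_⟩
      · exact Finset.mem_image.2 ⟨0, by simp; omega, by simp⟩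
      · exact image_range_subset (by omega) (by omega)
    · have key : ∀ b b' : ℕ, (Finset.range k).image (fun i => v + i * b) =
          (Finset.range k).image (fun i => v + i * b') → b ≤ b' := by
        intro b b' hbb
        have : v + (k - 1) * b ∈ (Finset.range k).image (fun i => v + i * b') := by
          rw [← hbb]
          exact Finset.mem_image_of_mem (fun i => v + i * b) (by simp; omega)
        rw [Finset.mem_image] at this
        obtain ⟨i, hi, hi'⟩ := this
        rw [Finset.mem_range] at hi
        have h3 : i * b' ≤ (k - 1) * b' := Nat.mul_le_mul_right _ (by omega)
        have : (k - 1) * b ≤ (k - 1) * b' := by omega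
        exact Nat.le_of_mul_le_mul_left this (by omega)
      intro b _ b' _ hbb
      exact le_antisymm (key b b' hbb) (key b' b hbb.symm)
  · refine Finset.card_le_card_of_injOn
      (fun b => (Finset.range k).image (fun i => v - (k - 1) * b + i * b)) ?_ ?_
    · intro b hb
      have hb1 := hroom b hb
      have hb2 := (Finset.mem_Icc.1 hb).1
      simp only [Finset.coe_filter, Set.mem_ofPred_eq]
      refine ⟨mem_apSet_of_range (by omega) hb2 (by omega), ?_, ?_⟩
      · exact Finset.mem_image.2 ⟨k - 1, by simp; omega, by omega⟩
      · exact image_range_subset (by omega) (by omega)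
    · have key : ∀ b ∈ Finset.Icc 1 h, ∀ b' ∈ Finset.Icc 1 h,
          (Finset.range k).image (fun i => v - (k - 1) * b + i * b) =
          (Finset.range k).image (fun i => v - (k - 1) * b' + i * b') → b ≤ b' := by
        intro b hb b' hb' hbb
        have hb1 := hroom b hb
        have hb1' := hroom b' hb'
        have : v - (k - 1) * b ∈
            (Finset.range k).image (fun i => v - (k - 1) * b' + i * b') := by
          rw [← hbb]
          exact Finset.mem_image.2 ⟨0, by simp; omega, by simp⟩
        rw [Finset.mem_image] at this
        obtain ⟨i, hi, hi'⟩ := this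
        have : (k - 1) * b ≤ (k - 1) * b' := by omega
        exact Nat.le_of_mul_le_mul_left this (by omega)
      intro b hb b' hb' hbb
      exact le_antisymm (key b hb b' hb' hbb) (key b' hb' b hb hbb.symm)

/-- Adding an interval of length `r` to `U` gains in proportion to the number of new elements. -/
lemma interval_gain (N k : ℕ) (hk : 2 ≤ k) {p : ℝ} (hp0 : 0 ≤ p) (hp1 : p ≤ 1) (U : Finset ℕ)
    {x r : ℕ} (hN : x + r ≤ N) :
    (1 - p) * (((Finset.Icc (x + 1) (x + r) \ U).card : ℝ) * (r / (2 * k) : ℕ)) ≤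
      k * (exCount N p k (U ∪ Finset.Icc (x + 1) (x + r)) - exCount N p k U) := by
  classical
  set J := Finset.Icc (x + 1) (x + r) with hJ
  set 𝓑 := (apSet N k).filter fun B => B ⊆ J ∧ ¬ B ⊆ U with h𝓑
  -- Double counting of incidences: a new element lies in at least `r / (2k)` progressions of `𝓑`,
  -- and each progression has `k` elements.
  have hcount : (J \ U).card * (r / (2 * k)) ≤ 𝓑.card * k := by
    refine Finset.card_mul_le_card_mul (fun v B => v ∈ B) ?_ ?_
    · intro v hv
      rw [Finset.mem_sdiff] at hv
      refine (le_card_through_in_interval N k hk hN hv.1).trans (Finset.card_le_card ?_)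
      intro B hB
      rw [Finset.mem_filter] at hB
      rw [Finset.mem_bipartiteAbove, h𝓑, Finset.mem_filter]
      exact ⟨⟨hB.1, hB.2.2, fun h => hv.2 (h hB.2.1)⟩, hB.2.1⟩
    · intro B hB
      rw [h𝓑, Finset.mem_filter] at hB
      rw [← card_of_mem_apSet hB.1]
      refine Finset.card_le_card fun v hv => ?_
      rw [Finset.mem_bipartiteBelow] at hv
      exact hv.2
  have hgain : (1 - p) * (𝓑.card : ℝ) ≤ exCount N p k (U ∪ J) - exCount N p k U := by
    rw [exCount, exCount, ← Finset.sum_sub_distrib]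
    calc (1 - p) * (𝓑.card : ℝ) = ∑ B ∈ 𝓑, (1 - p) := by
          rw [Finset.sum_const, nsmul_eq_mul, mul_comm]
      _ ≤ ∑ B ∈ 𝓑, (p ^ (B \ (U ∪ J)).card - p ^ (B \ U).card) := by
          refine Finset.sum_le_sum fun B hB => ?_
          rw [h𝓑, Finset.mem_filter] at hB
          have h1 : B \ (U ∪ J) = ∅ :=
            Finset.sdiff_eq_empty_iff_subset.2 (hB.2.1.trans Finset.subset_union_right)
          have h2 : 1 ≤ (B \ U).card :=
            Finset.card_pos.2 (Finset.sdiff_nonempty.2 hB.2.2)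
          have h3 := pow_le_pow_of_le_one hp0 hp1 h2
          rw [h1, Finset.card_empty, pow_zero]
          linarith
      _ ≤ _ := by
          refine Finset.sum_le_sum_of_subset_of_nonneg (Finset.filter_subset _ _) fun B _ _ => ?_
          have := pow_le_pow_of_le_one hp0 hp1
            (Finset.card_le_card (Finset.sdiff_subset_sdiff (le_refl B)
              (Finset.subset_union_left (s₁ := U) (s₂ := J))))
          linarith
  have hcount' : ((J \ U).card : ℝ) * (r / (2 * k) : ℕ) ≤ 𝓑.card * k := by exact_mod_cast hcount
  calc _ ≤ (1 - p) * (𝓑.card * k) := mul_le_mul_of_nonneg_left hcount' (by linarith)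
    _ = k * ((1 - p) * 𝓑.card) := by ring
    _ ≤ _ := mul_le_mul_of_nonneg_left hgain (by positivity)

/-- A set whose expectation is nearly that of a seed can be completed to a seed by few elements. -/
theorem exists_seed_of_near (N k : ℕ) (hk : 2 ≤ k) {p : ℝ} (hp0 : 0 ≤ p) (hp1 : p ≤ 1 / 2)
    {t δ η : ℝ} (hη0 : 0 ≤ η)
    (hfull : exCount N p k ∅ + t ≤ exCount N p k (Finset.Icc 1 N)) (S : Finset ℕ)
    (hS : S ⊆ Finset.Icc 1 N) (hnear : exCount N p k ∅ + (1 - δ) * t ≤ exCount N p k S)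
    {r : ℕ} (hr : 0 < r) (hgain : 2 * k * (δ * t) ≤ η * r * (r / (2 * k) : ℕ)) :
    ∃ U ⊆ Finset.Icc 1 N, exCount N p k ∅ + t ≤ exCount N p k U ∧
      (1 - η) * U.card ≤ S.card + r := by
  classical
  -- Cut `[N]` into blocks of length `r`. A block with many missing elements supplies the gain. If
  -- there is none, `S` omits at most `ηN + r` elements of `[N]`, and `[N]` itself is the required
  -- seed.
  by_cases hblock : ∃ i < N / r, η * r ≤ ((Finset.Icc (i * r + 1) (i * r + r) \ S).card : ℝ)
  · obtain ⟨i, hi, hmiss⟩ := hblock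
    have hiN : i * r + r ≤ N := by
      have h1 : (i + 1) * r ≤ N / r * r := Nat.mul_le_mul_right _ hi
      have h2 := Nat.div_mul_le_self N r
      rw [Nat.succ_mul] at h1
      omega
    have hg := interval_gain N k hk hp0 (by linarith) S hiN
    set J := Finset.Icc (i * r + 1) (i * r + r) with hJ
    refine ⟨S ∪ J, Finset.union_subset hS ?_, ?_, ?_⟩
    · intro x hx
      rw [hJ, Finset.mem_Icc] at hx
      rw [Finset.mem_Icc]
      omega
    · have hk0 : (0 : ℝ) < k := by
        have : 0 < k := by omega
        exact_mod_cast this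
      have h1 : η * r * (r / (2 * k) : ℕ) ≤ ((J \ S).card : ℝ) * (r / (2 * k) : ℕ) := by gcongr
      have h2 : 0 ≤ ((J \ S).card : ℝ) * (r / (2 * k) : ℕ) := by positivity
      have h3 : k * (δ * t) ≤ k * (exCount N p k (S ∪ J) - exCount N p k S) := by
        nlinarith
      have := le_of_mul_le_mul_left h3 hk0
      linarith
    · have h1 : ((S ∪ J).card : ℝ) ≤ S.card + r := by
        have : (S ∪ J).card ≤ S.card + J.card := Finset.card_union_le _ _
        have hJr : J.card = r := by rw [hJ, Nat.card_Icc]; omega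
        rw [hJr] at this
        exact_mod_cast this
      have h2 : (0 : ℝ) ≤ (S ∪ J).card := by positivity
      nlinarith
  · push Not at hblock
    refine ⟨Finset.Icc 1 N, le_rfl, hfull, ?_⟩
    have hsub : Finset.Icc 1 N ⊆ S ∪ ((Finset.range (N / r)).biUnion
        (fun i => Finset.Icc (i * r + 1) (i * r + r) \ S) ∪ Finset.Icc (N / r * r + 1) N) := by
      intro x hx
      rw [Finset.mem_Icc] at hx
      simp only [Finset.mem_union, Finset.mem_biUnion, Finset.mem_range, Finset.mem_sdiff,
        Finset.mem_Icc]
      by_cases hxS : x ∈ S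
      · exact Or.inl hxS
      · right
        by_cases hxN : x ≤ N / r * r
        · left
          refine ⟨(x - 1) / r, ?_, ⟨?_, ?_⟩, hxS⟩
          · rw [Nat.div_lt_iff_lt_mul hr]; omega
          · have := Nat.div_mul_le_self (x - 1) r
            omega
          · have := Nat.lt_div_mul_add (a := x - 1) hr
            omega
        · exact Or.inr ⟨by omega, hx.2⟩
    have hc := (Finset.card_le_card hsub).trans (Finset.card_union_le _ _)
    have hc2 := Finset.card_union_le ((Finset.range (N / r)).biUnion
        (fun i => Finset.Icc (i * r + 1) (i * r + r) \ S)) (Finset.Icc (N / r * r + 1) N)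
    have hc3 : (((Finset.range (N / r)).biUnion
        (fun i => Finset.Icc (i * r + 1) (i * r + r) \ S)).card : ℝ) ≤ η * N := by
      have h1 : (((Finset.range (N / r)).biUnion
          (fun i => Finset.Icc (i * r + 1) (i * r + r) \ S)).card : ℝ) ≤
          ∑ i ∈ Finset.range (N / r), ((Finset.Icc (i * r + 1) (i * r + r) \ S).card : ℝ) := by
        exact_mod_cast Finset.card_biUnion_le
      refine h1.trans ?_
      calc _ ≤ ∑ i ∈ Finset.range (N / r), η * r :=
            Finset.sum_le_sum fun i hi => (hblock i (Finset.mem_range.1 hi)).le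
        _ = η * ((N / r : ℕ) * r) := by rw [Finset.sum_const, nsmul_eq_mul, Finset.card_range]; ring
        _ ≤ η * N := by
            gcongr
            exact_mod_cast Nat.div_mul_le_self N r
    have hc4 : (Finset.Icc (N / r * r + 1) N).card ≤ r := by
      rw [Nat.card_Icc]
      have := Nat.lt_div_mul_add (a := N) hr
      omega
    have hcN : (N : ℝ) ≤ S.card + (((Finset.range (N / r)).biUnion
        (fun i => Finset.Icc (i * r + 1) (i * r + r) \ S)).card + r) := by
      have h0 : (Finset.Icc 1 N).card = N := by simp
      rw [h0] at hc
      have : N ≤ S.card + (((Finset.range (N / r)).biUnion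
        (fun i => Finset.Icc (i * r + 1) (i * r + r) \ S)).card + r) := by omega
      exact_mod_cast this
    rw [Nat.card_Icc, Nat.add_sub_cancel]
    linarith

/-! ### Gains by level and extremal subsets -/

lemma cnt_sub_nonneg (N k j : ℕ) {S F : Finset ℕ} (h : F ⊆ S) :
    0 ≤ (cnt N k j S : ℝ) - cnt N k j F :=
  sub_nonneg.2 (Nat.cast_le.2 (cnt_mono N k j h))

lemma exCount_sub_le (N k : ℕ) {p : ℝ} (hp0 : 0 ≤ p) {S F : Finset ℕ} (h : F ⊆ S) :
    exCount N p k S - exCount N p k F ≤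
      ∑ j ∈ Finset.Icc 1 k, p ^ (k - j) * ((cnt N k j S : ℝ) - cnt N k j F) := by
  rw [exCount_sub]
  refine mul_le_of_le_one_left (Finset.sum_nonneg fun j _ => ?_) (by linarith)
  exact mul_nonneg (pow_nonneg hp0 _) (cnt_sub_nonneg N k j h)

lemma le_exCount_sub (N k : ℕ) {p : ℝ} (hp0 : 0 ≤ p) (hp1 : p ≤ 1 / 2) {S F : Finset ℕ}
    (h : F ⊆ S) {j : ℕ} (hj : j ∈ Finset.Icc 1 k) :
    p ^ (k - j) * ((cnt N k j S : ℝ) - cnt N k j F) ≤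
      2 * (exCount N p k S - exCount N p k F) := by
  have hnn : ∀ i ∈ Finset.Icc 1 k, 0 ≤ p ^ (k - i) * ((cnt N k i S : ℝ) - cnt N k i F) :=
    fun i _ => mul_nonneg (pow_nonneg hp0 _) (cnt_sub_nonneg N k i h)
  have h1 := Finset.single_le_sum hnn hj
  have h2 := Finset.sum_nonneg hnn
  rw [exCount_sub]
  nlinarith

/-- The first-order part of the gain. -/
lemma cnt_one_gain_le (N k : ℕ) (hk : 2 ≤ k) (p : ℝ) (hp0 : 0 ≤ p) (S F : Finset ℕ) :
    p ^ (k - 1) * ((cnt N k 1 S : ℝ) - cnt N k 1 F) ≤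
      k * ((S \ F).card * (N * p ^ (k - 1))) := by
  have h := cnt_one_le N k hk S F
  have h' : (cnt N k 1 S : ℝ) ≤ cnt N k 1 F + (S \ F).card * (k * N) := by exact_mod_cast h
  have hp : 0 ≤ p ^ (k - 1) := pow_nonneg hp0 _
  calc _ ≤ p ^ (k - 1) * ((S \ F).card * (k * N)) := by gcongr; linarith
    _ = _ := by ring

lemma cnt_gain_le (N k : ℕ) (S F : Finset ℕ) {j : ℕ} (hj : 2 ≤ j) :
    (cnt N k j S : ℝ) - cnt N k j F ≤ k ^ 2 * (S \ F).card * S.card := by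
  have h := cnt_two_le N k S F hj
  have h' : (cnt N k j S : ℝ) ≤ cnt N k j F + (S \ F).card * (k ^ 2 * S.card) := by
    exact_mod_cast h
  linarith

lemma sum_Icc_one (k : ℕ) (hk : 1 ≤ k) (f : ℕ → ℝ) :
    ∑ j ∈ Finset.Icc 1 k, f j = f 1 + ∑ j ∈ Finset.Icc 2 k, f j := by
  rw [← Finset.add_sum_Ioc_eq_sum_Icc hk]
  rfl

/-- A set with a large expectation is large. -/
lemma le_card_sq_of_exCount (N k : ℕ) (hk : 2 ≤ k) {p t : ℝ} (hp0 : 0 ≤ p) (hp1 : p ≤ 1)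
    (S : Finset ℕ) (h1 : k * (S.card * (N * p ^ (k - 1))) ≤ t / 4)
    (h2 : exCount N p k ∅ + t / 2 ≤ exCount N p k S) : t ≤ 4 * k ^ 3 * S.card ^ 2 := by
  have h := exCount_sub_le N k hp0 (Finset.empty_subset S)
  rw [sum_Icc_one k (by omega)] at h
  have e1 := cnt_one_gain_le N k hk p hp0 S ∅
  rw [Finset.sdiff_empty] at e1
  have e2 : ∑ j ∈ Finset.Icc 2 k, p ^ (k - j) * ((cnt N k j S : ℝ) - cnt N k j ∅) ≤
      ∑ j ∈ Finset.Icc 2 k, (k : ℝ) ^ 2 * S.card * S.card := by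
    refine Finset.sum_le_sum fun j hj => ?_
    have hj2 := (Finset.mem_Icc.1 hj).1
    have := cnt_gain_le N k S ∅ hj2
    rw [Finset.sdiff_empty] at this
    exact (mul_le_of_le_one_left (cnt_sub_nonneg N k j (Finset.empty_subset S))
      (pow_le_one₀ hp0 hp1)).trans this
  rw [Finset.sum_const, nsmul_eq_mul, Nat.card_Icc] at e2
  have e3 : ((k + 1 - 2 : ℕ) : ℝ) * ((k : ℝ) ^ 2 * S.card * S.card) ≤ k * (k ^ 2 * S.card * S.card) := by
    gcongr
    omega
  linarith

/-- A subset of `U` of bounded size that maximizes the expectation penalized by its size. -/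
lemma exists_penalized_max (N k : ℕ) (p lam : ℝ) (U : Finset ℕ) {L : ℝ} (hL : 0 ≤ L) :
    ∃ F ⊆ U, (F.card : ℝ) ≤ L ∧ ∀ F' ⊆ U, (F'.card : ℝ) ≤ L →
      exCount N p k F' - lam * F'.card ≤ exCount N p k F - lam * F.card := by
  obtain ⟨F, hF, hmax⟩ := Finset.exists_max_image (U.powerset.filter fun F => (F.card : ℝ) ≤ L)
    (fun F => exCount N p k F - lam * F.card) ⟨∅, by simp [hL]⟩
  simp only [Finset.mem_filter, Finset.mem_powerset] at hF hmax
  exact ⟨F, hF.1, hF.2, fun F' h1 h2 => hmax F' ⟨h1, h2⟩⟩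

/-- An element with a large marginal gain lies in many progressions that meet `F` in at least three
elements. -/
lemma le_deg_three_of_marginal (N k : ℕ) (hk : 3 ≤ k) {p lam : ℝ} (hp0 : 0 ≤ p) (hp1 : p ≤ 1)
    (F : Finset ℕ) (u : ℕ) (hu : lam ≤ exCount N p k F - exCount N p k (F.erase u))
    (h1 : k * (N * p ^ (k - 1)) ≤ lam / 4) (h2 : p ^ (k - 2) * (k ^ 2 * F.card) ≤ lam / 4) :
    lam / (2 * k) ≤ deg N k 3 F u := by
  have hk0 : (0 : ℝ) < k := by
    have : 0 < k := by omega
    exact_mod_cast this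
  have h := exCount_sub_le N k hp0 (Finset.erase_subset u F)
  have hterm : ∀ j, p ^ (k - j) * ((cnt N k j F : ℝ) - cnt N k j (F.erase u)) ≤
      p ^ (k - j) * deg N k j F u := by
    intro j
    refine mul_le_mul_of_nonneg_left ?_ (pow_nonneg hp0 _)
    have := cnt_le_cnt_erase_add_deg N k j F u
    have : (cnt N k j F : ℝ) ≤ cnt N k j (F.erase u) + deg N k j F u := by exact_mod_cast this
    linarith
  have h' := hu.trans (h.trans (Finset.sum_le_sum fun j _ => hterm j))
  rw [sum_Icc_one k (by omega)] at h'
  have hsplit : ∑ j ∈ Finset.Icc 2 k, p ^ (k - j) * (deg N k j F u : ℝ) =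
      p ^ (k - 2) * deg N k 2 F u + ∑ j ∈ Finset.Icc 3 k, p ^ (k - j) * (deg N k j F u : ℝ) := by
    rw [← Finset.add_sum_Ioc_eq_sum_Icc (by omega : 2 ≤ k)]
    rfl
  rw [hsplit] at h'
  have e1 : p ^ (k - 1) * (deg N k 1 F u : ℝ) ≤ lam / 4 := by
    have : (deg N k 1 F u : ℝ) ≤ k * N := by exact_mod_cast deg_one_le N k (by omega) F u
    calc _ ≤ p ^ (k - 1) * (k * N) := by gcongr
      _ = k * (N * p ^ (k - 1)) := by ring
      _ ≤ _ := h1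
  have e2 : p ^ (k - 2) * (deg N k 2 F u : ℝ) ≤ lam / 4 := by
    have : (deg N k 2 F u : ℝ) ≤ k ^ 2 * F.card := by exact_mod_cast deg_two_le N k F u
    calc _ ≤ p ^ (k - 2) * (k ^ 2 * F.card) := by gcongr
      _ ≤ _ := h2
  have e3 : ∑ j ∈ Finset.Icc 3 k, p ^ (k - j) * (deg N k j F u : ℝ) ≤
      ∑ j ∈ Finset.Icc 3 k, (deg N k 3 F u : ℝ) := by
    refine Finset.sum_le_sum fun j hj => ?_
    have h3 : (deg N k j F u : ℝ) ≤ deg N k 3 F u := by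
      exact_mod_cast deg_anti N k (Finset.mem_Icc.1 hj).1 F u
    exact (mul_le_of_le_one_left (Nat.cast_nonneg _) (pow_le_one₀ hp0 hp1)).trans h3
  rw [Finset.sum_const, nsmul_eq_mul, Nat.card_Icc] at e3
  have e4 : ((k + 1 - 3 : ℕ) : ℝ) * (deg N k 3 F u : ℝ) ≤ k * deg N k 3 F u := by
    gcongr
    omega
  rw [div_le_iff₀ (by positivity)]
  linarith

/-- Some subset of `U \ F` of extremal density: it is the source of a good part of the gain
at some level `j ≥ 3`, has large minimum degree at level `j`, and few progressions at
level `j - 1`. -/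
theorem exists_dense_subset (N k : ℕ) (hk : 3 ≤ k) {p t δ g β m : ℝ} (hp0 : 0 < p)
    (hg : 1 ≤ g) (hβ0 : 0 ≤ β) (hβ1 : β ≤ 1) (hδt : 0 < δ * t) (F U : Finset ℕ)
    (hFU : F ⊆ U) (hUm : (U.card : ℝ) ≤ m)
    (hgain : δ * t ≤ exCount N p k U - exCount N p k F)
    (h1 : k * (m * (N * p ^ (k - 1))) ≤ δ * t / 2)
    (h2 : 2 * k * (k ^ 2 * (m ^ 2 * p ^ (k - 2))) * g ^ (k - 2) < δ * t) :
    ∃ W ⊆ U \ F, W.Nonempty ∧ ∃ j, 3 ≤ j ∧ j ≤ k ∧ ∃ a : ℝ,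
      a = (cnt N k j (F ∪ W) : ℝ) - cnt N k j F ∧
      (∀ u ∈ W, β * a / W.card ≤ deg N k j (F ∪ W) u) ∧
      δ * t / (2 * k) * (g ^ j / g ^ k) * ((W.card : ℝ) / m) ^ β ≤ p ^ (k - j) * a ∧
      p * g * ((cnt N k (j - 1) (F ∪ W) : ℝ) - cnt N k (j - 1) F) ≤ a := by
  classical
  have hk0 : (0 : ℝ) < k := by
    have : 0 < k := by omega
    exact_mod_cast this
  have hg0 : 0 < g := by linarith
  let a : ℕ → Finset ℕ → ℝ := fun j W => (cnt N k j (F ∪ W) : ℝ) - cnt N k j F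
  have ha_nn : ∀ j W, 0 ≤ a j W := fun j W => cnt_sub_nonneg N k j Finset.subset_union_left
  have hFUU : F ∪ (U \ F) = U := Finset.union_sdiff_of_subset hFU
  have hUF : (U \ F).Nonempty := by
    rw [Finset.sdiff_nonempty]
    intro h
    rw [Finset.Subset.antisymm h hFU] at hgain
    linarith
  have hUFm : ((U \ F).card : ℝ) ≤ m :=
    le_trans (by exact_mod_cast Finset.card_le_card Finset.sdiff_subset) hUm
  have hm0 : 0 < m := lt_of_lt_of_le (by exact_mod_cast hUF.card_pos) hUFm
  -- Level 1 accounts for at most half of the gain by `h1`; pigeonhole on the remaining levels.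
  obtain ⟨j₀, hj₀, hj₀a⟩ : ∃ j ∈ Finset.Icc 2 k, δ * t / (2 * k) ≤ p ^ (k - j) * a j (U \ F) := by
    by_contra hcon
    push Not at hcon
    have h := exCount_sub_le N k hp0.le hFU
    rw [sum_Icc_one k (by omega)] at h
    have e1 := cnt_one_gain_le N k (by omega) p hp0.le U F
    have e1' : (k : ℝ) * ((U \ F).card * (N * p ^ (k - 1))) ≤ k * (m * (N * p ^ (k - 1))) := by
      gcongr
    have e2 : ∑ j ∈ Finset.Icc 2 k, p ^ (k - j) * ((cnt N k j U : ℝ) - cnt N k j F) <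
        ∑ j ∈ Finset.Icc 2 k, δ * t / (2 * k) := by
      refine Finset.sum_lt_sum_of_nonempty ⟨2, by simp; omega⟩ fun j hj => ?_
      have := hcon j hj
      simp only [a, hFUU] at this
      exact this
    rw [Finset.sum_const, nsmul_eq_mul, Nat.card_Icc] at e2
    have e3 : ((k + 1 - 2 : ℕ) : ℝ) * (δ * t / (2 * k)) ≤ k * (δ * t / (2 * k)) := by
      gcongr
      omega
    have e4 : (k : ℝ) * (δ * t / (2 * k)) = δ * t / 2 := by field_simp
    linarith
  -- The potential whose maximizer is `(j, W)`. The factor `|W| ^ β` yields the minimum degree when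
  -- `W` is compared with `W.erase u`; the factor `g ^ j` yields the bound on level `j - 1` when `j`
  -- is compared with `j - 1`. Both cost little against `(j₀, U \ F)`.
  let φ : ℕ × Finset ℕ → ℝ := fun x =>
    p ^ (k - x.1) * a x.1 x.2 / (g ^ x.1 * (x.2.card : ℝ) ^ β)
  obtain ⟨⟨j, W⟩, hjW, hmax⟩ := Finset.exists_max_image
    (Finset.Icc 2 k ×ˢ ((U \ F).powerset.filter fun W => W.Nonempty)) φ
    ⟨(j₀, U \ F), by
      simp only [Finset.mem_product, Finset.mem_filter, Finset.mem_powerset]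
      exact ⟨hj₀, le_rfl, hUF⟩⟩
  simp only [Finset.mem_product, Finset.mem_filter, Finset.mem_powerset, Finset.mem_Icc] at hjW
  obtain ⟨⟨hj2, hjk⟩, hWU, hWne⟩ := hjW
  have hmax' : ∀ i W', 2 ≤ i → i ≤ k → W' ⊆ U \ F → W'.Nonempty → φ (i, W') ≤ φ (j, W) := by
    intro i W' hi hik hW' hne
    refine hmax (i, W') ?_
    simp only [Finset.mem_product, Finset.mem_filter, Finset.mem_powerset, Finset.mem_Icc]
    exact ⟨⟨hi, hik⟩, hW', hne⟩
  have hw : (0 : ℝ) < W.card := by exact_mod_cast hWne.card_pos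
  have hwβ : 0 < (W.card : ℝ) ^ β := Real.rpow_pos_of_pos hw _
  have hmβ : 0 < m ^ β := Real.rpow_pos_of_pos hm0 _
  have hwm : (W.card : ℝ) ≤ m :=
    le_trans (by exact_mod_cast Finset.card_le_card hWU) hUFm
  have hgj : 0 < g ^ j := pow_pos hg0 _
  have hgk : 0 < g ^ k := pow_pos hg0 _
  have hlow : δ * t / (2 * k) * (g ^ j / g ^ k) * ((W.card : ℝ) / m) ^ β ≤ p ^ (k - j) * a j W := by
    have h0 := hmax' j₀ (U \ F) (Finset.mem_Icc.1 hj₀).1 (Finset.mem_Icc.1 hj₀).2 le_rfl hUF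
    have hc : (0 : ℝ) < (U \ F).card := by exact_mod_cast hUF.card_pos
    have h3 : δ * t / (2 * k) / (g ^ k * m ^ β) ≤ φ (j₀, U \ F) := by
      simp only [φ]
      have hcβ := Real.rpow_pos_of_pos hc β
      gcongr
      · exact mul_nonneg (pow_nonneg hp0.le _) (ha_nn _ _)
      · exact (Finset.mem_Icc.1 hj₀).2
    have h4 := h3.trans h0
    simp only [φ] at h4
    rw [le_div_iff₀ (by positivity)] at h4
    rw [Real.div_rpow hw.le hm0.le]
    calc _ = δ * t / (2 * k) / (g ^ k * m ^ β) * (g ^ j * (W.card : ℝ) ^ β) := by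
          field_simp
      _ ≤ _ := h4
  have hFWm : ((F ∪ W).card : ℝ) ≤ m := by
    refine le_trans ?_ hUm
    exact_mod_cast Finset.card_le_card
      (Finset.union_subset hFU (hWU.trans Finset.sdiff_subset))
  -- At level 2 the gain of `W` is at most `k² |W| m`, because two points lie in at most `k²` common
  -- progressions; this contradicts `hlow` through `h2`.
  have hj3 : 3 ≤ j := by
    by_contra hlt
    have hj : j = 2 := by omega
    subst hj
    have e1 := cnt_gain_le N k (F ∪ W) F (le_refl 2)
    have hsd : (F ∪ W) \ F ⊆ W := by
      intro x hx
      simp only [Finset.mem_sdiff, Finset.mem_union] at hx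
      tauto
    have e2 : a 2 W ≤ k ^ 2 * W.card * m := by
      refine e1.trans ?_
      have : (((F ∪ W) \ F).card : ℝ) ≤ W.card := by exact_mod_cast Finset.card_le_card hsd
      gcongr
    have e3 : (W.card : ℝ) / m ≤ ((W.card : ℝ) / m) ^ β := by
      conv_lhs => rw [← Real.rpow_one ((W.card : ℝ) / m)]
      exact Real.rpow_le_rpow_of_exponent_ge (by positivity) ((div_le_one hm0).2 hwm) hβ1
    have hgg : g ^ 2 / g ^ k = 1 / g ^ (k - 2) := by
      have : g ^ k = g ^ 2 * g ^ (k - 2) := by rw [← pow_add]; congr 1; omega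
      rw [this]; field_simp
    rw [hgg] at hlow
    have e4 : δ * t / (2 * k) * (1 / g ^ (k - 2)) * ((W.card : ℝ) / m) ≤
        p ^ (k - 2) * (k ^ 2 * W.card * m) :=
      (mul_le_mul_of_nonneg_left e3 (by positivity)).trans (hlow.trans (by gcongr))
    have hgk2 : 0 < g ^ (k - 2) := pow_pos hg0 _
    have e5 : δ * t * (W.card : ℝ) ≤
        (2 * k * (k ^ 2 * (m ^ 2 * p ^ (k - 2))) * g ^ (k - 2)) * W.card := by
      have : δ * t / (2 * k) * (1 / g ^ (k - 2)) * ((W.card : ℝ) / m) =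
          δ * t * W.card / (2 * k * g ^ (k - 2) * m) := by field_simp
      rw [this, div_le_iff₀ (by positivity)] at e4
      linarith
    have := le_of_mul_le_mul_right e5 hw
    linarith
  refine ⟨W, hWU, hWne, j, hj3, hjk, a j W, rfl, ?_, hlow, ?_⟩
  · intro u hu
    have huF : u ∉ F := (Finset.mem_sdiff.1 (hWU hu)).2
    have hdeg := cnt_le_cnt_erase_add_deg N k j (F ∪ W) u
    have herase : (F ∪ W).erase u = F ∪ W.erase u := by
      rw [Finset.erase_union_distrib, Finset.erase_eq_of_notMem huF]
    rw [herase] at hdeg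
    have hdeg' : (cnt N k j (F ∪ W) : ℝ) ≤ cnt N k j (F ∪ W.erase u) + deg N k j (F ∪ W) u := by
      exact_mod_cast hdeg
    have hcard : ((W.erase u).card : ℝ) = W.card - 1 := by
      rw [Finset.card_erase_of_mem hu, Nat.cast_sub hWne.card_pos, Nat.cast_one]
    have hle : a j (W.erase u) ≤ a j W * (1 - β / W.card) := by
      rcases (W.erase u).eq_empty_or_nonempty with hem | hne
      · have h0 : a j (W.erase u) = 0 := by simp [a, hem]
        rw [h0]
        refine mul_nonneg (ha_nn j W) ?_
        have : β / W.card ≤ 1 := by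
          rw [div_le_one hw]
          have : (1 : ℝ) ≤ W.card := by exact_mod_cast hWne.card_pos
          linarith
        linarith
      · have h0 := hmax' j (W.erase u) hj2 hjk ((Finset.erase_subset _ _).trans hWU) hne
        have hw' : (0 : ℝ) < (W.erase u).card := by exact_mod_cast hne.card_pos
        have hw'β : 0 < ((W.erase u).card : ℝ) ^ β := Real.rpow_pos_of_pos hw' _
        simp only [φ] at h0
        rw [div_le_div_iff₀ (by positivity) (by positivity)] at h0
        have hpk : 0 < p ^ (k - j) := pow_pos hp0 _
        have h3 : a j (W.erase u) * (W.card : ℝ) ^ β ≤ a j W * ((W.erase u).card : ℝ) ^ β := by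
          have : (p ^ (k - j) * g ^ j) * (a j (W.erase u) * (W.card : ℝ) ^ β) ≤
              (p ^ (k - j) * g ^ j) * (a j W * ((W.erase u).card : ℝ) ^ β) := by linarith
          exact le_of_mul_le_mul_left this (by positivity)
        have h4 : ((W.erase u).card : ℝ) ^ β ≤ (1 - β / W.card) * (W.card : ℝ) ^ β := by
          -- Set up for Bernoulli's inequality with exponent `β ≤ 1`.
          have h5 : ((W.erase u).card : ℝ) = (1 + -(1 / (W.card : ℝ))) * W.card := by
            rw [hcard]; field_simp; ring
          have h6 : 0 ≤ 1 + -(1 / (W.card : ℝ)) := by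
            by_contra hneg
            push Not at hneg
            have := mul_neg_of_neg_of_pos hneg hw
            linarith
          rw [h5, Real.mul_rpow h6 hw.le]
          refine mul_le_mul_of_nonneg_right ?_ hwβ.le
          have := rpow_one_add_le_one_add_mul_self (s := -(1 / (W.card : ℝ))) (by linarith) hβ0 hβ1
          calc _ ≤ 1 + β * -(1 / (W.card : ℝ)) := this
            _ = _ := by ring
        have h7 : a j (W.erase u) * (W.card : ℝ) ^ β ≤
            (a j W * (1 - β / W.card)) * (W.card : ℝ) ^ β :=
          h3.trans ((mul_le_mul_of_nonneg_left h4 (ha_nn j W)).trans (le_of_eq (by ring)))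
        exact le_of_mul_le_mul_right h7 hwβ
    have h8 : a j W - a j (W.erase u) ≤ deg N k j (F ∪ W) u := by
      simp only [a]; linarith
    have h9 : a j W * (1 - β / W.card) = a j W - β * a j W / W.card := by ring
    linarith
  · have h0 := hmax' (j - 1) W (by omega) (by omega) hWU hWne
    simp only [φ] at h0
    rw [div_le_div_iff₀ (by positivity) (by positivity)] at h0
    have e1 : p ^ (k - (j - 1)) = p ^ (k - j) * p := by
      rw [← pow_succ]; congr 1; omega
    have e2 : g ^ j = g ^ (j - 1) * g := by
      rw [← pow_succ]; congr 1; omega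
    rw [e1, e2] at h0
    have hpk : 0 < p ^ (k - j) := pow_pos hp0 _
    have hgj1 : 0 < g ^ (j - 1) := pow_pos hg0 _
    have h3 : (p ^ (k - j) * g ^ (j - 1) * (W.card : ℝ) ^ β) * (p * g * a (j - 1) W) ≤
        (p ^ (k - j) * g ^ (j - 1) * (W.card : ℝ) ^ β) * a j W := by linarith
    exact le_of_mul_le_mul_left h3 (by positivity)

/-! ### The parameter regime -/

/-- The range of parameters in which the estimates are carried out. -/
structure Regime (N k : ℕ) (p K t m : ℝ) : Prop where
  p_pos : 0 < p
  t_pos : 0 < t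
  m_pos : 0 < m
  K_mul_m_le : K * m ≤ t
  K_mul_N_le : K * (m * (N * p ^ (k - 1))) ≤ t
  K_mul_sq_le : K * (m ^ 2 * p ^ (k - 2)) ≤ t
  sqrt_le : √t ≤ 2 * k ^ 2 * m

namespace Regime

variable {N k : ℕ} {p K K' t m : ℝ}

lemma mono (h : Regime N k p K t m) (hK : K' ≤ K) : Regime N k p K' t m where
  p_pos := h.p_pos
  t_pos := h.t_pos
  m_pos := h.m_pos
  K_mul_m_le := by have := h.m_pos; exact le_trans (by gcongr) h.K_mul_m_le
  K_mul_N_le := by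
    have := h.m_pos; have := h.p_pos; exact le_trans (by gcongr) h.K_mul_N_le
  K_mul_sq_le := by
    have := h.m_pos; have := h.p_pos; exact le_trans (by gcongr) h.K_mul_sq_le
  sqrt_le := h.sqrt_le

lemma sqrt_pos (h : Regime N k p K t m) : 0 < √t := Real.sqrt_pos.2 h.t_pos

/-- The first-order condition solved for `Np`; the right side is the `Y` of `certEvent_le` for dense
sets. -/
lemma N_mul_le (h : Regime N k p K t m) (hk : 3 ≤ k) (hK : 1 ≤ K) :
    N * p ≤ t / (m * p ^ (k - 2)) := by
  have hp := h.p_pos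
  have hm := h.m_pos
  rw [le_div_iff₀ (by positivity)]
  have e : p ^ (k - 1) = p ^ (k - 2) * p := by rw [← pow_succ]; congr 1; omega
  have h1 := h.K_mul_N_le
  have h2 : 0 ≤ m * (N * p ^ (k - 1)) := by positivity
  rw [e] at h1 h2
  nlinarith

/-- For small `p`, `sqrt_le` gives `√t p² ≤ m`. With `N_mul_le`, this bounds `Np` by `√t` times a
power of `1 / p`, so logarithms of such ratios are `O(log (1 / p))`. -/
lemma div_le_rpow (h : Regime N k p K t m) (hk : 3 ≤ k) (hp : 2 * (k : ℝ) ^ 2 * p ^ 2 ≤ 1) :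
    t / (m * p ^ (k - 2)) ≤ √t * p ^ (-(k : ℝ)) := by
  have hp0 := h.p_pos
  have hm := h.m_pos
  have hT := h.sqrt_pos
  rw [Real.rpow_neg hp0.le, Real.rpow_natCast, ← div_eq_mul_inv, div_le_div_iff₀ (by positivity)
    (by positivity)]
  have e : p ^ k = p ^ (k - 2) * p ^ 2 := by rw [← pow_add]; congr 1; omega
  have ht : t = √t * √t := (Real.mul_self_sqrt h.t_pos.le).symm
  have h1 : √t * p ^ 2 ≤ m := by
    calc √t * p ^ 2 ≤ 2 * k ^ 2 * m * p ^ 2 := by gcongr; exact h.sqrt_le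
      _ = (2 * (k : ℝ) ^ 2 * p ^ 2) * m := by ring
      _ ≤ 1 * m := by gcongr
      _ = m := one_mul m
  calc t * p ^ k = √t * p ^ (k - 2) * (√t * p ^ 2) := by rw [e]; nth_rewrite 1 [ht]; ring
    _ ≤ √t * p ^ (k - 2) * m := by gcongr
    _ = √t * (m * p ^ (k - 2)) := by ring

lemma m_le (h : Regime N k p K t m) (hK : 1 ≤ K) (hp : p ≤ 1) :
    m ≤ √t * p ^ (-(k : ℝ)) := by
  have hp0 := h.p_pos
  have hm := h.m_pos
  have hT := h.sqrt_pos
  rw [Real.rpow_neg hp0.le, Real.rpow_natCast, ← div_eq_mul_inv, le_div_iff₀ (by positivity)]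
  refine abs_le_of_sq_le_sq' ?_ hT.le |>.2
  rw [Real.sq_sqrt h.t_pos.le]
  have h1 : p ^ k * p ^ k ≤ p ^ (k - 2) := by
    rw [← pow_add]; exact pow_le_pow_of_le_one hp0.le hp (by omega)
  have h2 : 0 ≤ m ^ 2 * p ^ (k - 2) := by positivity
  calc (m * p ^ k) ^ 2 = m ^ 2 * (p ^ k * p ^ k) := by ring
    _ ≤ m ^ 2 * p ^ (k - 2) := by gcongr
    _ ≤ K * (m ^ 2 * p ^ (k - 2)) := le_mul_of_one_le_left h2 hK
    _ ≤ t := h.K_mul_sq_le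

end Regime

lemma eventually_le_rpow_neg {a : ℝ} (ha : 0 < a) (x : ℝ) :
    ∀ᶠ p in 𝓝[>] (0 : ℝ), x ≤ p ^ (-a) :=
  (tendsto_rpow_neg_nhdsGT_zero (by linarith : -a < 0)).eventually_ge_atTop x

lemma eventually_lt_nhdsGT {a : ℝ} (ha : 0 < a) : ∀ᶠ p in 𝓝[>] (0 : ℝ), p < a :=
  nhdsWithin_le_nhds (Iio_mem_nhds ha)

lemma exp_le_rpow_of_le {p x y : ℝ} (hp : 0 < p) (h : x ≤ y * Real.log p) :
    Real.exp x ≤ p ^ y := by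
  rw [Real.rpow_def_of_pos hp, Real.exp_le_exp]
  linarith

/-! ### Certificates for sets with large marginal gains -/

set_option maxHeartbeats 1000000 in
/-- The certificate event for sets with large marginal gains. -/
theorem exists_core_event (k : ℕ) (hk : 3 ≤ k) {γ δ : ℝ} (hγ : 0 < γ) (hγ1 : γ ≤ 1 / 48)
    (hδ : 0 < δ) : ∃ K : ℝ, 1 ≤ K ∧ ∀ᶠ x in 𝓝[>] (0 : ℝ), ∀ p : I, (p : ℝ) = x →
    ∀ (N : ℕ) (t m L : ℝ), Regime N k p K t m → 0 < L → L ≤ m → L ≤ √t * (p : ℝ) ^ (-γ) →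
    ∃ E : ℕ → Set (Set ℕ),
      (∀ f : ℕ, √t ≤ 4 * k ^ 2 * f → (f : ℝ) ≤ L →
        (randomSet N p).real (E f) ≤ (p : ℝ) ^ ((1 - 6 * γ) * f)) ∧
      ∀ F ⊆ Finset.Icc 1 N, F.Nonempty → (F.card : ℝ) ≤ L →
        (∀ u ∈ F, δ * t / L ≤ exCount N p k F - exCount N p k (F.erase u)) →
        ∀ R : Set ℕ, (F : Set ℕ) ⊆ R → R ∈ E F.card := by
  have hk0 : (3 : ℝ) ≤ k := by exact_mod_cast hk
  set C : ℝ := 3 * k ^ 3 / γ with hC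
  have hC0 : 0 < C := by positivity
  -- Choosing `Q` costs at most `3 q f (k + 2) log (1 / p)` in the exponent, and this choice makes
  -- it `γ f log (1 / p)`.
  set q : ℝ := γ / (3 * (k + 2)) with hq
  have hq0 : 0 < q := by positivity
  have hqγ : 3 * q * (k + 2) = γ := by rw [hq]; field_simp
  have hq3 : 3 * q ≤ γ := by
    rw [← hqγ]
    exact le_mul_of_one_le_right (by positivity) (by linarith)
  set K₁ : ℝ := 12 * Real.exp 1 * k ^ 4 * 2 ^ k * C / δ with hK₁
  refine ⟨max (max 1 (4 * k ^ 2 / δ)) (2 * k * C / (δ * q ^ 2)),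
    le_trans (le_max_left _ _) (le_max_left _ _), ?_⟩
  set K := max (max 1 (4 * (k : ℝ) ^ 2 / δ)) (2 * k * C / (δ * q ^ 2)) with hK
  have hKone : 1 ≤ K := le_trans (le_max_left _ _) (le_max_left _ _)
  have hK2 : 4 * (k : ℝ) ^ 2 / δ ≤ K := le_trans (le_max_right _ _) (le_max_left _ _)
  have hK3 : 2 * k * C / (δ * q ^ 2) ≤ K := le_max_right _ _
  clear_value K
  filter_upwards [self_mem_nhdsWithin, eventually_lt_nhdsGT (show (0 : ℝ) < 1 / 3 by norm_num),
    eventually_lt_nhdsGT (show (0 : ℝ) < 1 / (2 * k ^ 2) by positivity),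
    eventually_le_rpow_neg hγ K₁, eventually_le_rpow_neg one_pos (4 * (k : ℝ) ^ 2 / (3 * q))]
    with x hx0 hx1 hxk hxK hxq p hpx N t m L hreg hL0 hLm hLT
  rw [← hpx] at hx0 hx1 hxk hxK hxq
  have hp0 : 0 < (p : ℝ) := hx0
  have hp1 : (p : ℝ) ≤ 1 := by linarith
  have hlog : Real.log p ≤ -1 := by
    have h1 : (p : ℝ) ≤ Real.exp (-1) := by
      rw [Real.exp_neg]
      have := Real.exp_one_lt_d9
      have h3 : (1 : ℝ) / 3 ≤ (Real.exp 1)⁻¹ := by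
        rw [← one_div]; exact one_div_le_one_div_of_le (Real.exp_pos 1) (by linarith)
      linarith
    exact (Real.log_le_iff_le_exp hp0).2 h1
  have ht := hreg.t_pos
  have hm := hreg.m_pos
  have hT := hreg.sqrt_pos
  have hTT : √t * √t = t := Real.mul_self_sqrt ht.le
  have hpk2 : 2 * (k : ℝ) ^ 2 * (p : ℝ) ^ 2 ≤ 1 := by
    rw [lt_div_iff₀ (by positivity)] at hxk
    nlinarith [hp0, hp1, sq_nonneg (k : ℝ)]
  set D : ℝ := δ * t / (2 * k * L) with hD
  have hD0 : 0 < D := by positivity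
  have hKm := hreg.K_mul_m_le
  have hDC : C / q ^ 2 ≤ D := by
    rw [div_le_iff₀ (by positivity)] at hK3
    rw [hD, div_le_div_iff₀ (by positivity) (by positivity)]
    calc C * (2 * k * L) ≤ C * (2 * k * m) := by gcongr
      _ = (2 * k * C) * m := by ring
      _ ≤ (K * (δ * q ^ 2)) * m := by gcongr
      _ = δ * q ^ 2 * (K * m) := by ring
      _ ≤ δ * q ^ 2 * t := by gcongr
      _ = _ := by ring
  have hCDq : C / D ≤ q ^ 2 := by
    rw [div_le_iff₀ (by positivity)] at hDC
    rw [div_le_iff₀ hD0]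
    linarith
  have hq1 : q ≤ 1 := by linarith
  have hCD : C ≤ D := by
    have : C / D ≤ 1 := hCDq.trans (pow_le_one₀ hq0.le hq1)
    rwa [div_le_one hD0] at this
  -- At least `(1 - γ) f` elements become candidates; removing the at most `3 q f ≤ γ f` elements of
  -- `Q` leaves `(1 - 2γ) f`.
  refine ⟨fun f => certEvent N k 3 (3 * q * f) (3 * k * 2 ^ k * C * (k ^ 2 * f ^ 2 / D))
    ⌈(1 - 2 * γ) * f⌉₊, ?_, ?_⟩
  · intro f hf hfL
    have hf0 : (0 : ℝ) < f := pos_of_mul_pos_right (hT.trans_le hf) (by positivity)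
    have hn0 : 0 < ⌈(1 - 2 * γ) * f⌉₊ := Nat.ceil_pos.2 (mul_pos (by linarith) hf0)
    have hnf : (1 - 2 * γ) * f ≤ (⌈(1 - 2 * γ) * f⌉₊ : ℝ) := Nat.le_ceil _
    beta_reduce
    generalize ⌈(1 - 2 * γ) * f⌉₊ = n at hn0 hnf ⊢
    have hn0' : (0 : ℝ) < n := by exact_mod_cast hn0
    have hpk1 : (1 : ℝ) ≤ (p : ℝ) ^ (-(k : ℝ)) :=
      Real.one_le_rpow_of_pos_of_le_one_of_nonpos hp0 hp1 (by linarith)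
    have hr0Y : 3 * q * f ≤ √t * (p : ℝ) ^ (-(k : ℝ)) := by
      calc 3 * q * f ≤ 1 * f := by gcongr; linarith
        _ ≤ L := by linarith
        _ ≤ √t * (p : ℝ) ^ (-γ) := hLT
        _ ≤ _ := by
          gcongr ?_ * ?_
          exact Real.rpow_le_rpow_of_exponent_ge hp0 hp1 (by linarith)
    refine (certEvent_le N k 3 p (by positivity) hr0Y
      ((hreg.N_mul_le hk hKone).trans (hreg.div_le_rpow hk hpk2)) (by positivity) hn0).trans ?_
    have h1 : Real.exp (3 * q * f * (1 + Real.log (√t * (p : ℝ) ^ (-(k : ℝ)) / (3 * q * f)))) ≤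
        (p : ℝ) ^ (-γ * f) := by
      refine exp_le_rpow_of_le hp0 ?_
      have h2 : √t * (p : ℝ) ^ (-(k : ℝ)) / (3 * q * f) ≤ (p : ℝ) ^ (-((k : ℝ) + 1)) := by
        have e : (p : ℝ) ^ (-((k : ℝ) + 1)) = (p : ℝ) ^ (-(1 : ℝ)) * (p : ℝ) ^ (-(k : ℝ)) := by
          rw [← Real.rpow_add hp0]; congr 1; ring
        rw [e, div_le_iff₀ (by positivity)]
        rw [div_le_iff₀ (by positivity)] at hxq
        calc _ ≤ 4 * k ^ 2 * f * (p : ℝ) ^ (-(k : ℝ)) := by gcongr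
          _ ≤ ((p : ℝ) ^ (-(1 : ℝ)) * (3 * q)) * f * (p : ℝ) ^ (-(k : ℝ)) := by gcongr
          _ = _ := by ring
      have h3 : Real.log (√t * (p : ℝ) ^ (-(k : ℝ)) / (3 * q * f)) ≤ -((k : ℝ) + 1) * Real.log p := by
        rw [← Real.log_rpow hp0]
        exact Real.log_le_log (by positivity) h2
      calc _ ≤ 3 * q * f * (-Real.log p + -((k : ℝ) + 1) * Real.log p) := by gcongr; linarith
        _ = -(3 * q * (k + 2)) * f * Real.log p := by ring
        _ = _ := by rw [hqγ]
    -- Price per candidate: a constant times `p f L / t`. Since `f` and `L` are at most `√t p ^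
    -- (-γ)`, this is `p ^ (1 - 2γ)` up to a constant, which another `p ^ (-γ)` absorbs.
    have h2 : Real.exp 1 * (3 * k * 2 ^ k * C * (k ^ 2 * f ^ 2 / D)) * p / n ≤
        (p : ℝ) ^ (1 - 3 * γ) := by
      have hn2 : (f : ℝ) / 2 ≤ n := by
        refine le_trans ?_ hnf
        rw [div_eq_inv_mul]
        exact mul_le_mul_of_nonneg_right (by linarith) hf0.le
      have hfLt : (f : ℝ) * L ≤ t * (p : ℝ) ^ (-(2 * γ)) := by
        have e : (p : ℝ) ^ (-(2 * γ)) = (p : ℝ) ^ (-γ) * (p : ℝ) ^ (-γ) := by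
          rw [← Real.rpow_add hp0]; congr 1; ring
        rw [e, ← hTT]
        calc (f : ℝ) * L ≤ (√t * (p : ℝ) ^ (-γ)) * (√t * (p : ℝ) ^ (-γ)) := by
              gcongr
              exact hfL.trans hLT
          _ = _ := by ring
      have e : (p : ℝ) ^ (1 - 3 * γ) = (p : ℝ) ^ (-γ) * (p : ℝ) ^ (-(2 * γ)) * p := by
        rw [← Real.rpow_add hp0, ← Real.rpow_add_one hp0.ne']; congr 1; ring
      calc _ ≤ Real.exp 1 * (3 * k * 2 ^ k * C * (k ^ 2 * f ^ 2 / D)) * p / (f / 2) := by gcongr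
        _ = K₁ * (f * L / t) * p := by
          rw [hK₁, hD]; field_simp; ring
        _ ≤ (p : ℝ) ^ (-γ) * (p : ℝ) ^ (-(2 * γ)) * p := by
          gcongr
          rw [div_le_iff₀ ht]
          linarith
        _ = _ := e.symm
    calc _ ≤ (p : ℝ) ^ (-γ * f) * ((p : ℝ) ^ (1 - 3 * γ)) ^ n := by
          gcongr
      _ = (p : ℝ) ^ (-γ * f + (1 - 3 * γ) * n) := by
          rw [← Real.rpow_natCast, ← Real.rpow_mul hp0.le, ← Real.rpow_add hp0]
      _ ≤ (p : ℝ) ^ ((1 - 6 * γ) * f) := by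
          refine Real.rpow_le_rpow_of_exponent_ge hp0 hp1 ?_
          have : (1 - 3 * γ) * ((1 - 2 * γ) * f) ≤ (1 - 3 * γ) * n :=
            mul_le_mul_of_nonneg_left hnf (by linarith)
          have h4 : 0 < 6 * (γ * γ * f) := by positivity
          linarith
  · intro F hFN hFne hFL hmarg R hR
    have hlamm : δ * t / m ≤ δ * t / L := by gcongr
    have hδK : 4 * (k : ℝ) ^ 2 ≤ K * δ := by rwa [div_le_iff₀ hδ] at hK2
    have hkk : (k : ℝ) ≤ k ^ 2 := by nlinarith
    have hsmall : ∀ y : ℝ, 0 ≤ y → K * (m * y) ≤ t → k ^ 2 * y ≤ δ * t / L / 4 := by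
      intro y hy hKy
      have : k ^ 2 * y ≤ δ * t / m / 4 := by
        rw [div_div, le_div_iff₀ (by positivity)]
        calc k ^ 2 * y * (m * 4) = 4 * (k : ℝ) ^ 2 * (m * y) := by ring
          _ ≤ K * δ * (m * y) := by gcongr
          _ = δ * (K * (m * y)) := by ring
          _ ≤ δ * t := by gcongr
      linarith
    have h1 : k * (N * (p : ℝ) ^ (k - 1)) ≤ δ * t / L / 4 := by
      have hy : 0 ≤ (N * (p : ℝ) ^ (k - 1)) := by positivity
      exact le_trans (by gcongr) (hsmall _ hy hreg.K_mul_N_le)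
    have h2 : (p : ℝ) ^ (k - 2) * (k ^ 2 * F.card) ≤ δ * t / L / 4 := by
      have h3 := hsmall (m * (p : ℝ) ^ (k - 2)) (by positivity)
        (le_trans (le_of_eq (by ring)) hreg.K_mul_sq_le)
      refine le_trans ?_ h3
      calc _ ≤ (p : ℝ) ^ (k - 2) * (k ^ 2 * m) := by gcongr; linarith
        _ = _ := by ring
    have hdeg : ∀ u ∈ F, D ≤ deg N k 3 F u := by
      intro u hu
      have := le_deg_three_of_marginal N k hk hp0.le hp1 F u (hmarg u hu) h1 h2
      refine le_trans (le_of_eq ?_) this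
      rw [hD]; ring
    have hcnt : (cnt N k 2 F : ℝ) ≤ k ^ 2 * F.card ^ 2 := by
      have := cnt_gain_le N k F ∅ (le_refl 2)
      rw [cnt_empty N k 2 (by norm_num), Finset.sdiff_empty] at this
      push_cast at this
      linarith
    refine mem_certEvent N k 3 (by norm_num) hk F F le_rfl hFN hFne hγ hC hCD hdeg ?_ ?_ ?_ hR
    · have hs : (C / D) ^ (1 / (((3 : ℕ) : ℝ) - 1)) ≤ q := by
        have e : (1 / (((3 : ℕ) : ℝ) - 1)) = 1 / 2 := by norm_num
        rw [e, ← Real.sqrt_eq_rpow, Real.sqrt_le_left hq0.le]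
        exact hCDq
      calc _ ≤ 3 * (q * (F.card : ℝ)) := by gcongr
        _ = _ := by ring
    · gcongr
    · have hFc : (0 : ℝ) < F.card := by exact_mod_cast hFne.card_pos
      have h3 := Nat.ceil_lt_add_one (a := (1 - 2 * γ) * (F.card : ℝ))
        (mul_nonneg (by linarith) hFc.le)
      have h4 : 3 * q * (F.card : ℝ) ≤ γ * F.card := mul_le_mul_of_nonneg_right hq3 hFc.le
      linarith

/-! ### Certificates for dense sets -/

/-- A scale `g` that is large, but at most a small power of `1 / p` and of
`ω = t / (m² p ^ (k - 2))`. -/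
lemma exists_scale (k : ℕ) (hk : 3 ≤ k) {β δ G : ℝ} (hβ : 0 < β) (hβk : β * k ≤ 1 / 2)
    (hδ : 0 < δ) (hG : 1 ≤ G) : ∃ K : ℝ, 1 ≤ K ∧ ∀ᶠ p in 𝓝[>] (0 : ℝ),
    ∀ (N : ℕ) (t m : ℝ), Regime N k p K t m → ∃ g : ℝ, G ≤ g ∧ g ≤ p ^ (-β) ∧
      1 ≤ t / (m ^ 2 * p ^ (k - 2)) ∧
      Real.log (t / (m ^ 2 * p ^ (k - 2))) ≤ k / β * Real.log g ∧
      2 * k * (k ^ 2 * (m ^ 2 * p ^ (k - 2))) * g ^ (k - 2) < δ * t := by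
  have hk0 : (3 : ℝ) ≤ k := by exact_mod_cast hk
  refine ⟨max (G ^ (1 / β)) ((2 * k ^ 3 / δ) ^ 2 + 1), ?_, ?_⟩
  · refine le_trans ?_ (le_max_right _ _)
    have := sq_nonneg (2 * (k : ℝ) ^ 3 / δ)
    linarith
  set K := max (G ^ (1 / β)) ((2 * (k : ℝ) ^ 3 / δ) ^ 2 + 1) with hK
  have hK1 : G ^ (1 / β) ≤ K := le_max_left _ _
  have hK2 : (2 * (k : ℝ) ^ 3 / δ) ^ 2 < K := by
    have : (2 * (k : ℝ) ^ 3 / δ) ^ 2 + 1 ≤ K := le_max_right _ _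
    linarith
  clear_value K
  filter_upwards [self_mem_nhdsWithin, eventually_lt_nhdsGT one_pos,
    eventually_le_rpow_neg one_pos (G ^ (1 / β)),
    eventually_lt_nhdsGT (show (0 : ℝ) < 1 / (4 * k ^ 4) by positivity)]
    with p hp0 hp1 hpG hpk N t m hreg
  replace hp0 : 0 < p := hp0
  have ht := hreg.t_pos
  have hm := hreg.m_pos
  have hGβ : 1 ≤ G ^ (1 / β) := Real.one_le_rpow hG (by positivity)
  set ω := t / (m ^ 2 * p ^ (k - 2)) with hω
  have hωK : K ≤ ω := by
    rw [hω, le_div_iff₀ (by positivity)]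
    exact hreg.K_mul_sq_le
  have hωG : G ^ (1 / β) ≤ ω := hK1.trans hωK
  have hω0 : 0 < ω := by linarith
  have hωp : ω ≤ p ^ (-(k : ℝ)) := by
    rw [Real.rpow_neg hp0.le, Real.rpow_natCast, hω, div_le_iff₀ (by positivity)]
    have e : (p ^ k)⁻¹ * (m ^ 2 * p ^ (k - 2)) = m ^ 2 / p ^ 2 := by
      have : p ^ k = p ^ (k - 2) * p ^ 2 := by rw [← pow_add]; congr 1; omega
      rw [this]; field_simp
    rw [e, le_div_iff₀ (by positivity)]
    have h1 : t ≤ (2 * k ^ 2 * m) ^ 2 := by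
      have := hreg.sqrt_le
      rw [Real.sqrt_le_left (by positivity)] at this
      exact this
    have h2 : 4 * (k : ℝ) ^ 4 * p ^ 2 ≤ 1 := by
      rw [lt_div_iff₀ (by positivity)] at hpk
      have h3 : p ^ 2 ≤ p := by nlinarith
      calc 4 * (k : ℝ) ^ 4 * p ^ 2 ≤ 4 * (k : ℝ) ^ 4 * p := by gcongr
        _ ≤ 1 := by linarith
    calc t * p ^ 2 ≤ (2 * k ^ 2 * m) ^ 2 * p ^ 2 := by gcongr
      _ = (4 * (k : ℝ) ^ 4 * p ^ 2) * m ^ 2 := by ring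
      _ ≤ 1 * m ^ 2 := by gcongr
      _ = m ^ 2 := one_mul _
  -- The scale is `g = x ^ β`. As `ω ≤ p ^ (-k)`, `log ω` is at most `k log x`, while `β k ≤ 1 / 2`
  -- keeps `g ^ (k - 2)` below `√ω`.
  set x := min ω (p ^ (-(1 : ℝ))) with hx
  have hxG : G ^ (1 / β) ≤ x := le_min hωG hpG
  have hx1 : 1 ≤ x := hGβ.trans hxG
  have hx0 : 0 < x := by linarith
  refine ⟨x ^ β, ?_, ?_, hGβ.trans hωG, ?_, ?_⟩
  · calc G = (G ^ (1 / β)) ^ β := by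
          rw [← Real.rpow_mul (by linarith), one_div_mul_cancel hβ.ne', Real.rpow_one]
      _ ≤ x ^ β := by gcongr
  · calc x ^ β ≤ (p ^ (-(1 : ℝ))) ^ β := by
          gcongr
          exact min_le_right _ _
      _ = p ^ (-β) := by rw [← Real.rpow_mul hp0.le]; congr 1; ring
  · rw [Real.log_rpow hx0]
    have e : k / β * (β * Real.log x) = k * Real.log x := by field_simp
    rw [e]
    rcases le_total ω (p ^ (-(1 : ℝ))) with h | h
    · rw [hx, min_eq_left h]
      have := Real.log_nonneg (hGβ.trans hωG)
      nlinarith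
    · rw [hx, min_eq_right h, Real.log_rpow hp0]
      calc Real.log ω ≤ Real.log (p ^ (-(k : ℝ))) := Real.log_le_log hω0 hωp
        _ = -(k : ℝ) * Real.log p := Real.log_rpow hp0 _
        _ = _ := by ring
  · have h1 : (x ^ β) ^ (k - 2) ≤ √ω := by
      rw [← Real.rpow_natCast, ← Real.rpow_mul hx0.le, Real.sqrt_eq_rpow]
      calc x ^ (β * ((k - 2 : ℕ) : ℝ)) ≤ x ^ ((1 : ℝ) / 2) := by
            refine Real.rpow_le_rpow_of_exponent_le hx1 ?_
            refine le_trans ?_ hβk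
            gcongr
            omega
        _ ≤ ω ^ ((1 : ℝ) / 2) := by
            gcongr
            exact min_le_left _ _
    have h2 : 2 * (k : ℝ) ^ 3 / δ < √ω := by
      rw [Real.lt_sqrt (by positivity)]
      exact hK2.trans_le hωK
    rw [div_lt_iff₀ hδ] at h2
    have h3 : m ^ 2 * p ^ (k - 2) = t / ω := by rw [hω]; field_simp
    rw [h3]
    have hsω : 0 < √ω := Real.sqrt_pos.2 hω0
    calc 2 * k * (k ^ 2 * (t / ω)) * (x ^ β) ^ (k - 2) ≤ 2 * k * (k ^ 2 * (t / ω)) * √ω := by gcongr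
      _ = (2 * (k : ℝ) ^ 3) * (t / ω * √ω) := by ring
      _ < (√ω * δ) * (t / ω * √ω) := by gcongr
      _ = (√ω * √ω) * (δ * t / ω) := by ring
      _ = δ * t := by rw [Real.mul_self_sqrt hω0.le]; field_simp

/-- Cost of the certificates of dense sets. -/
lemma dense_cost {w r₀ m ω g c X : ℝ} {n : ℕ} (hw : 0 < w) (hr : 0 < r₀) (hm : 0 < m) (hω : 0 < ω)
    (hc : 0 < c) (hcg : c ≤ g) (hn : w / 2 ≤ n) (hX0 : 0 ≤ X) (hX : X ≤ c / g)
    (h1 : r₀ * (1 + Real.log (m / r₀)) ≤ w / 8) (h2 : r₀ * Real.log ω ≤ w / 8 * Real.log g)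
    (h3 : 9 + 4 * Real.log c ≤ 3 * Real.log g) :
    Real.exp (r₀ * (1 + Real.log (ω * m / r₀))) * X ^ n ≤ Real.exp (-w) := by
  have hg : 0 < g := hc.trans_le hcg
  have hcg0 : 0 < c / g := div_pos hc hg
  have h4 : X ^ n ≤ Real.exp (w / 2 * (Real.log c - Real.log g)) := by
    calc X ^ n ≤ (c / g) ^ n := by gcongr
      _ = (c / g) ^ (n : ℝ) := (Real.rpow_natCast _ _).symm
      _ ≤ (c / g) ^ (w / 2) :=
          Real.rpow_le_rpow_of_exponent_ge hcg0 ((div_le_one hg).2 hcg) hn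
      _ = _ := by
          rw [Real.rpow_def_of_pos hcg0, Real.log_div hc.ne' hg.ne', mul_comm]
  have h5 : Real.log (ω * m / r₀) = Real.log ω + Real.log (m / r₀) := by
    rw [mul_div_assoc, Real.log_mul hω.ne' (div_pos hm hr).ne']
  calc _ ≤ Real.exp (r₀ * (1 + Real.log (ω * m / r₀))) *
        Real.exp (w / 2 * (Real.log c - Real.log g)) := by gcongr
    _ = Real.exp (r₀ * (1 + Real.log (ω * m / r₀)) + w / 2 * (Real.log c - Real.log g)) :=
        (Real.exp_add _ _).symm
    -- After `h1` and `h2` the exponent is at most `w/8 + (w/8) log g + (w/2)(log c - log g)`; it is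
    -- at most `-w` exactly under `h3`.
    _ ≤ Real.exp (-w) := by
        rw [Real.exp_le_exp, h5]
        nlinarith

lemma exists_sampling_rate {θ : ℝ} (hθ : 0 < θ) (hθ1 : θ ≤ 1) {A : ℝ} (hA : 1 ≤ A) :
    ∃ q : ℝ, 0 < q ∧ q ≤ 1 ∧ 6 * q * A ≤ 1 / 8 ∧ ∀ w m : ℝ, 0 < w → w ≤ m →
      6 * q * w * (w / m) ^ θ * (1 + Real.log (m / (6 * q * w * (w / m) ^ θ))) ≤ w / 8 := by
  have hlim : Tendsto (fun q : ℝ => 6 * q * (1 + 2 / θ) - (Real.log (6 * q) * (6 * q) ^ (1 : ℝ)))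
      (𝓝[>] 0) (𝓝 (6 * 0 * (1 + 2 / θ) - 0)) := by
    refine Tendsto.sub ?_ ?_
    · have : Continuous (fun q : ℝ => 6 * q * (1 + 2 / θ)) := by fun_prop
      exact (this.tendsto 0).mono_left nhdsWithin_le_nhds
    · refine (tendsto_log_mul_rpow_nhdsGT_zero one_pos).comp ?_
      refine tendsto_nhdsWithin_iff.2 ⟨?_, ?_⟩
      · have : Continuous (fun q : ℝ => 6 * q) := by fun_prop
        have h := (this.tendsto 0).mono_left (nhdsWithin_le_nhds (s := Set.Ioi 0))
        rwa [mul_zero] at h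
      · filter_upwards [self_mem_nhdsWithin] with q hq
        have : 0 < q := hq
        exact Set.mem_Ioi.2 (by positivity)
  have hev := hlim.eventually_lt_const (show 6 * 0 * (1 + 2 / θ) - 0 < (1 : ℝ) / 8 by norm_num)
  have hpos : ∀ᶠ q in 𝓝[>] (0 : ℝ), 0 < q := self_mem_nhdsWithin
  obtain ⟨q, hq, hq0, hqA⟩ := (hev.and (hpos.and
    (eventually_lt_nhdsGT (show 0 < 1 / (48 * A) by positivity)))).exists
  rw [lt_div_iff₀ (by positivity)] at hqA
  refine ⟨q, hq0, by nlinarith, by linarith, ?_⟩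
  intro w m hw hwm
  have hm : 0 < m := hw.trans_le hwm
  set z := m / w with hz
  have hz1 : 1 ≤ z := (one_le_div hw).2 hwm
  have hz0 : 0 < z := by linarith
  have hwz : w / m = z⁻¹ := by rw [hz, inv_div]
  set y := z ^ θ with hy
  have hy0 : 0 < y := Real.rpow_pos_of_pos hz0 _
  have hy1 : 1 ≤ y := Real.one_le_rpow hz1 hθ.le
  have hwy : (w / m) ^ θ = y⁻¹ := by rw [hwz, Real.inv_rpow hz0.le]
  rw [hwy]
  have e : m / (6 * q * w * y⁻¹) = z * y / (6 * q) := by rw [hz]; field_simp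
  have hlogz : Real.log z ≤ y / θ := Real.log_le_rpow_div hz0.le hθ
  have hlogy : Real.log y ≤ y / θ := by
    rw [hy, Real.log_rpow hz0]
    have := Real.log_nonneg hz1
    nlinarith
  rw [e, Real.log_div (by positivity) (by positivity), Real.log_mul hz0.ne' hy0.ne']
  rw [Real.rpow_one] at hq
  have h6 : Real.log (6 * q) ≤ 0 := Real.log_nonpos (by positivity) (by nlinarith)
  -- The factor `y⁻¹ = (w / m) ^ θ` in the sample size pays for the logarithm of `m / w`, uniformly
  -- in `w`; what remains depends on `q` only and tends to 0 with it.
  have h7 : 1 + (Real.log z + Real.log y - Real.log (6 * q)) ≤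
      y * (1 + 2 / θ - Real.log (6 * q)) := by
    have : y * (1 + 2 / θ - Real.log (6 * q)) = y + 2 * (y / θ) - y * Real.log (6 * q) := by ring
    rw [this]
    nlinarith
  calc _ ≤ 6 * q * w * y⁻¹ * (y * (1 + 2 / θ - Real.log (6 * q))) := by gcongr
    _ = (6 * q * (1 + 2 / θ) - Real.log (6 * q) * (6 * q)) * w := by field_simp
    _ ≤ 1 / 8 * w := by gcongr
    _ = w / 8 := by ring

/-- The size of the free part of the certificate of a dense set of size `w`. -/
noncomputable def sampleSize (k : ℕ) (q a p L m w : ℝ) : ℝ :=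
  if L / 2 ≤ w then 6 * q * w * (w / m) ^ (1 / (2 * (k : ℝ))) else 3 * p ^ (a / 2) * w

/-- The conditions of `dense_cost` on the free part. For `w ≥ L / 2` they follow from the choice of
`q`. For smaller `w`, `m` over the sample size is at most `p ^ (-2k)`, and the factor `p ^ (a / 2)`
outweighs the resulting `log (1 / p)`. -/
lemma sampleSize_spec {k : ℕ} (hk : 3 ≤ k) {q a p L m w T A : ℝ} (hq0 : 0 < q)
    (ha1 : a ≤ 1) (hp0 : 0 < p) (hp1 : p ≤ 1) (hT : 0 < T) (hTw : T ≤ w) (hwm : w ≤ m)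
    (hmT : m ≤ T * p ^ (-(k : ℝ))) (hA0 : 0 ≤ A) (hqA : 6 * q * A ≤ 1 / 8)
    (hq : ∀ w m : ℝ, 0 < w → w ≤ m →
      6 * q * w * (w / m) ^ (1 / (2 * (k : ℝ))) *
        (1 + Real.log (m / (6 * q * w * (w / m) ^ (1 / (2 * (k : ℝ)))))) ≤ w / 8)
    (hpA : 24 * A ≤ p ^ (-(a / 2))) (hpl : 3 * p ^ (a / 2) * (1 - 2 * k * Real.log p) ≤ 1 / 8) :
    0 < sampleSize k q a p L m w ∧ sampleSize k q a p L m w * A ≤ w / 8 ∧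
      sampleSize k q a p L m w * (1 + Real.log (m / sampleSize k q a p L m w)) ≤ w / 8 := by
  have hw0 : 0 < w := hT.trans_le hTw
  have hm0 : 0 < m := hw0.trans_le hwm
  have hk0 : (3 : ℝ) ≤ k := by exact_mod_cast hk
  rw [sampleSize]
  split_ifs with hL
  · have hwm0 : 0 < w / m := div_pos hw0 hm0
    have h1 : (w / m) ^ (1 / (2 * (k : ℝ))) ≤ 1 :=
      Real.rpow_le_one hwm0.le ((div_le_one hm0).2 hwm) (by positivity)
    have h2 : 0 < (w / m) ^ (1 / (2 * (k : ℝ))) := Real.rpow_pos_of_pos hwm0 _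
    refine ⟨by positivity, ?_, hq w m hw0 hwm⟩
    calc _ ≤ 6 * q * w * 1 * A := by gcongr
      _ = (6 * q * A) * w := by ring
      _ ≤ 1 / 8 * w := by gcongr
      _ = w / 8 := by ring
  · have hpa : 0 < p ^ (a / 2) := Real.rpow_pos_of_pos hp0 _
    have hinv : p ^ (-(a / 2)) = (p ^ (a / 2))⁻¹ := Real.rpow_neg hp0.le _
    refine ⟨by positivity, ?_, ?_⟩
    · rw [hinv, ← one_div, le_div_iff₀ hpa] at hpA
      nlinarith
    · have h1 : m / (3 * p ^ (a / 2) * w) ≤ p ^ (-(2 * (k : ℝ))) := by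
        rw [div_le_iff₀ (by positivity)]
        have e : p ^ (-(k : ℝ)) ≤ p ^ (-(2 * (k : ℝ))) * p ^ (a / 2) := by
          rw [← Real.rpow_add hp0]
          exact Real.rpow_le_rpow_of_exponent_ge hp0 hp1 (by linarith)
        have hpk : 0 < p ^ (-(k : ℝ)) := Real.rpow_pos_of_pos hp0 _
        calc m ≤ T * p ^ (-(k : ℝ)) := hmT
          _ ≤ w * (p ^ (-(2 * (k : ℝ))) * p ^ (a / 2)) := by gcongr
          _ ≤ 3 * (w * (p ^ (-(2 * (k : ℝ))) * p ^ (a / 2))) := by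
              have : 0 < w * (p ^ (-(2 * (k : ℝ))) * p ^ (a / 2)) := by positivity
              linarith
          _ = _ := by ring
      have h2 : Real.log (m / (3 * p ^ (a / 2) * w)) ≤ -(2 * (k : ℝ)) * Real.log p := by
        rw [← Real.log_rpow hp0]
        exact Real.log_le_log (by positivity) h1
      calc _ ≤ 3 * p ^ (a / 2) * w * (1 + -(2 * (k : ℝ)) * Real.log p) := by gcongr
        _ = 3 * p ^ (a / 2) * (1 - 2 * k * Real.log p) * w := by ring
        _ ≤ 1 / 8 * w := by gcongr
        _ = w / 8 := by ring

/-- Here `s` is the size of the set sampled from, `F` together with `W`. If `w ≥ L / 2` then `s ≤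
2w`. Otherwise only `s ≤ L = T p ^ (-a)` is known, but `w / m ≤ p ^ (γ - a)` with `γ = 4ka`, so the
rate is at most `p ^ (3a / 2)` and the loss is recovered. -/
lemma le_sampleSize {k j : ℕ} (hj : 3 ≤ j) (hjk : j ≤ k) {q a γ p L m w T s x : ℝ}
    (hq0 : 0 < q) (hq1 : q ≤ 1) (ha0 : 0 < a) (haγ : γ = 4 * k * a) (hp0 : 0 < p) (hp1 : p ≤ 1)
    (hT : 0 < T) (hTw : T ≤ w) (hwm : w ≤ m) (hL : L = T * p ^ (-a)) (hLm : T * p ^ (-γ) ≤ m)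
    (hs : s ≤ L / 2 + w) (hs0 : 0 ≤ s) (hx0 : 0 < x) (hx : x ≤ q ^ k * (w / m) ^ ((1 : ℝ) / 2)) :
    3 * (x ^ (1 / ((j : ℝ) - 1)) * s) ≤ sampleSize k q a p L m w := by
  have hw0 : 0 < w := hT.trans_le hTw
  have hm0 : 0 < m := hw0.trans_le hwm
  have hwm0 : 0 < w / m := div_pos hw0 hm0
  have hwm1 : w / m ≤ 1 := (div_le_one hm0).2 hwm
  have hj0 : (3 : ℝ) ≤ j := by exact_mod_cast hj
  have hjk0 : (j : ℝ) ≤ k := by exact_mod_cast hjk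
  have hk0 : (0 : ℝ) < k := by linarith
  set θ : ℝ := 1 / (2 * (k : ℝ)) with hθ
  have hrt0 : 0 < (w / m) ^ ((1 : ℝ) / 2) := Real.rpow_pos_of_pos hwm0 _
  have hrt1 : (w / m) ^ ((1 : ℝ) / 2) ≤ 1 := Real.rpow_le_one hwm0.le hwm1 (by norm_num)
  have hqk1 : q ^ k ≤ 1 := pow_le_one₀ hq0.le hq1
  have hxx : x ^ (1 / ((j : ℝ) - 1)) ≤ q * (w / m) ^ θ := by
    have hj1 : (0 : ℝ) < (j : ℝ) - 1 := by linarith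
    calc x ^ (1 / ((j : ℝ) - 1)) ≤ (q ^ k * (w / m) ^ ((1 : ℝ) / 2)) ^ (1 / ((j : ℝ) - 1)) := by
          gcongr
      _ ≤ (q ^ k * (w / m) ^ ((1 : ℝ) / 2)) ^ (1 / (k : ℝ)) := by
          refine Real.rpow_le_rpow_of_exponent_ge (by positivity)
            (mul_le_one₀ hqk1 hrt0.le hrt1) ?_
          exact one_div_le_one_div_of_le hj1 (by linarith)
      _ = q * (w / m) ^ θ := by
          rw [Real.mul_rpow (by positivity) hrt0.le, ← Real.rpow_natCast, ← Real.rpow_mul hq0.le,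
            ← Real.rpow_mul hwm0.le, mul_one_div_cancel hk0.ne', Real.rpow_one, hθ]
          congr 2
          field_simp
  have hθ0 : 0 < (w / m) ^ θ := Real.rpow_pos_of_pos hwm0 _
  rw [sampleSize]
  split_ifs with hLw
  · calc _ ≤ 3 * (q * (w / m) ^ θ * (2 * w)) := by gcongr; linarith
      _ = _ := by rw [hθ]; ring
  · push Not at hLw
    have hL0 : 0 < L := by rw [hL]; positivity
    have hsmall : w / m ≤ p ^ (γ - a) := by
      rw [div_le_iff₀ hm0]
      calc w ≤ L := by linarith
        _ = p ^ (γ - a) * (T * p ^ (-γ)) := by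
            rw [hL]
            have : p ^ (-a) = p ^ (γ - a) * p ^ (-γ) := by
              rw [← Real.rpow_add hp0]; congr 1; ring
            rw [this]; ring
        _ ≤ p ^ (γ - a) * m := by gcongr
    have h1 : (w / m) ^ θ ≤ p ^ (3 * a / 2) := by
      calc (w / m) ^ θ ≤ (p ^ (γ - a)) ^ θ := by gcongr
        _ = p ^ ((γ - a) * θ) := (Real.rpow_mul hp0.le _ _).symm
        _ ≤ p ^ (3 * a / 2) := by
            refine Real.rpow_le_rpow_of_exponent_ge hp0 hp1 ?_
            rw [hθ, haγ, mul_one_div, div_le_div_iff₀ (by norm_num) (by positivity)]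
            nlinarith
    calc _ ≤ 3 * (1 * p ^ (3 * a / 2) * L) := by
          gcongr
          · exact hxx.trans (by gcongr)
          · linarith
      _ = 3 * p ^ (a / 2) * T := by
          rw [hL]
          have : p ^ (3 * a / 2) * p ^ (-a) = p ^ (a / 2) := by
            rw [← Real.rpow_add hp0]; congr 1; ring
          rw [← this]; ring
      _ ≤ _ := by gcongr

/-- The number of candidates created by an extremal dense set `W` relative to `F`. -/
lemma cnt_div_le {k : ℕ} {a cF cS κ β g p w c t m L e T : ℝ} (hw : 0 < w) (hβ : 0 < β)
    (hg : 0 < g) (hp0 : 0 < p) (hp1 : p ≤ 1) (hT : 0 < T) (hTt : T * T = t) (hc : 0 < c)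
    (ha : c * t * (w / m) ^ β ≤ a) (hcS : p * g * (cS - cF) ≤ a)
    (hcF : cF ≤ κ * L ^ 2) (hL : L = T * p ^ (-e)) (hgp : g ≤ p ^ (-β))
    (hTw : T ≤ w) (hwm : w ≤ m) (hmT : m ≤ T * p ^ (-(k : ℝ))) (hκ0 : 0 ≤ κ)
    (hexp : 2 * e + k * β + β ≤ 1 / 2) (hκ : κ / c ≤ p ^ (-(1 / 2 : ℝ))) :
    cS / (β * a / w) ≤ 2 * w / (β * g * p) := by
  have hm0 : 0 < m := hw.trans_le hwm
  have ht0 : 0 < t := by rw [← hTt]; positivity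
  have hwm0 : 0 < w / m := div_pos hw hm0
  have ha0 : 0 < a := lt_of_lt_of_le (by positivity) ha
  have hlow : p ^ (k * β) ≤ (w / m) ^ β := by
    rw [Real.rpow_mul hp0.le]
    gcongr
    rw [le_div_iff₀ hm0]
    calc p ^ (k : ℝ) * m ≤ p ^ (k : ℝ) * (T * p ^ (-(k : ℝ))) := by gcongr
      _ = T * (p ^ (k : ℝ) * p ^ (-(k : ℝ))) := by ring
      _ = T := by rw [← Real.rpow_add hp0]; simp
      _ ≤ w := hTw
  -- The progressions already present in `F` number at most `κ L² = κ t p ^ (-2e)`; the factor `p`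
  -- dominates all the small powers lost, by `hexp`.
  have hcF2 : cF * (g * p) ≤ a := by
    have e1 : L ^ 2 = t * p ^ (-(2 * e)) := by
      have : p ^ (-(2 * e)) = p ^ (-e) * p ^ (-e) := by
        rw [← Real.rpow_add hp0]; congr 1; ring
      rw [hL, this, ← hTt]; ring
    have e2 : p ^ (-(1 / 2 : ℝ)) * (p ^ (-(2 * e)) * (p ^ (-β) * p)) ≤ p ^ (k * β) := by
      rw [← Real.rpow_add_one hp0.ne', ← Real.rpow_add hp0, ← Real.rpow_add hp0]
      exact Real.rpow_le_rpow_of_exponent_ge hp0 hp1 (by linarith)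
    rw [div_le_iff₀ hc] at hκ
    calc cF * (g * p) ≤ κ * L ^ 2 * (p ^ (-β) * p) := by gcongr
      _ = κ * t * (p ^ (-(2 * e)) * (p ^ (-β) * p)) := by rw [e1]; ring
      _ ≤ (p ^ (-(1 / 2 : ℝ)) * c) * t * (p ^ (-(2 * e)) * (p ^ (-β) * p)) := by gcongr
      _ = c * t * (p ^ (-(1 / 2 : ℝ)) * (p ^ (-(2 * e)) * (p ^ (-β) * p))) := by ring
      _ ≤ c * t * p ^ (k * β) := by gcongr
      _ ≤ c * t * (w / m) ^ β := by gcongr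
      _ ≤ a := ha
  have hcS2 : cS * (g * p) ≤ 2 * a := by linarith
  rw [div_le_div_iff₀ (by positivity) (by positivity)]
  have h3 : 0 ≤ β * (2 * a - cS * (g * p)) := mul_nonneg hβ.le (by linarith)
  have h4 : 2 * w * (β * a / w) = 2 * β * a := by field_simp
  rw [h4]
  linarith

/-- The extremal dense set relative to a penalized maximizer is large. -/
lemma dense_card_ge {k j : ℕ} {pa g β w δ t m L e T p : ℝ}
    (hw : 0 < w) (hβ0 : 0 < β) (hβ1 : β ≤ 1) (hg : 0 < g) (hp0 : 0 < p) (hp1 : p ≤ 1) (hT : 0 < T)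
    (hg1 : 1 ≤ g) (hk : 0 < k) (hδt : 0 < δ * t) (hm : 0 < m)
    (hlow : δ * t / (2 * k) * (g ^ j / g ^ k) * (w / m) ^ β ≤ pa)
    (hup : pa ≤ 2 * (δ * t / L * w)) (hL : L = T * p ^ (-e))
    (hgp : g ≤ p ^ (-β)) (hmT : m ≤ T * p ^ (-(k : ℝ))) (he : e = 8 * k * β)
    (hpk : 4 * k < p ^ (-(e / 4))) : T * p ^ (-(e / 2)) ≤ w := by
  by_contra hlt
  push Not at hlt
  have hk0 : (0 : ℝ) < k := by exact_mod_cast hk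
  have hL0 : 0 < L := by rw [hL]; positivity
  have hwβ : 0 < w ^ β := Real.rpow_pos_of_pos hw _
  have hmβ : 0 < m ^ β := Real.rpow_pos_of_pos hm _
  have hgk : 0 < g ^ k := pow_pos hg _
  have hgj : 1 ≤ g ^ j := one_le_pow₀ hg1
  have h1 : δ * t / (2 * k) * (1 / g ^ k) * (w / m) ^ β ≤ 2 * (δ * t / L * w) := by
    refine le_trans ?_ (hlow.trans hup)
    gcongr
  rw [Real.div_rpow hw.le hm.le] at h1
  have h2 : L * w ^ β ≤ 4 * k * g ^ k * w * m ^ β := by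
    have e1 : δ * t / (2 * k) * (1 / g ^ k) * (w ^ β / m ^ β) =
        δ * t * (w ^ β / (2 * k * g ^ k * m ^ β)) := by field_simp
    have e2 : 2 * (δ * t / L * w) = δ * t * (2 * w / L) := by ring
    rw [e1, e2] at h1
    have h3 := le_of_mul_le_mul_left h1 hδt
    rw [div_le_div_iff₀ (by positivity) hL0] at h3
    linarith
  have hsplit : w = w ^ (1 - β) * w ^ β := by
    rw [← Real.rpow_add hw]; simp
  -- The two bounds on the gain of `W` combined. With `β` tiny, the factors `g ^ k` and `m ^ β` are
  -- small powers of `1 / p`, so `w` cannot be much below `L`.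
  have h3 : L ≤ 4 * k * g ^ k * (w ^ (1 - β) * m ^ β) := by
    have : L * w ^ β ≤ (4 * k * g ^ k * (w ^ (1 - β) * m ^ β)) * w ^ β := by
      refine h2.trans (le_of_eq ?_)
      nth_rewrite 1 [hsplit]
      ring
    exact le_of_mul_le_mul_right this hwβ
  have h4 : w ^ (1 - β) * m ^ β ≤ T * p ^ (-(e / 2) - k * β) := by
    have hwT : w ≤ T * p ^ (-(e / 2)) := hlt.le
    calc w ^ (1 - β) * m ^ β ≤ (T * p ^ (-(e / 2))) ^ (1 - β) * (T * p ^ (-(k : ℝ))) ^ β := by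
          gcongr
      _ = (T ^ (1 - β) * T ^ β) * (p ^ (-(e / 2) * (1 - β)) * p ^ (-(k : ℝ) * β)) := by
          rw [Real.mul_rpow hT.le (by positivity), Real.mul_rpow hT.le (by positivity),
            ← Real.rpow_mul hp0.le, ← Real.rpow_mul hp0.le]
          ring
      _ = T * p ^ (-(e / 2) * (1 - β) + -(k : ℝ) * β) := by
          rw [← Real.rpow_add hT, ← Real.rpow_add hp0]
          simp
      _ ≤ T * p ^ (-(e / 2) - k * β) := by
          gcongr ?_ * ?_
          refine Real.rpow_le_rpow_of_exponent_ge hp0 hp1 ?_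
          have : 0 ≤ e / 2 * β := by rw [he]; positivity
          linarith
  have h5 : g ^ k ≤ p ^ (-(k * β)) := by
    calc g ^ k ≤ (p ^ (-β)) ^ k := by gcongr
      _ = p ^ (-(k * β)) := by
        rw [← Real.rpow_natCast, ← Real.rpow_mul hp0.le]; congr 1; ring
  have h6 : p ^ (-(k * β)) * p ^ (-(e / 2) - k * β) = p ^ (-(3 * e / 4)) := by
    rw [← Real.rpow_add hp0, he]; congr 1; ring
  have h7 : p ^ (-e) = p ^ (-(e / 4)) * p ^ (-(3 * e / 4)) := by
    rw [← Real.rpow_add hp0]; congr 1; ring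
  have h8 : 0 < p ^ (-(3 * e / 4)) := Real.rpow_pos_of_pos hp0 _
  have h9 : L ≤ 4 * k * (T * p ^ (-(3 * e / 4))) := by
    calc L ≤ 4 * k * g ^ k * (w ^ (1 - β) * m ^ β) := h3
      _ ≤ 4 * k * p ^ (-(k * β)) * (T * p ^ (-(e / 2) - k * β)) := by gcongr
      _ = 4 * k * T * (p ^ (-(k * β)) * p ^ (-(e / 2) - k * β)) := by ring
      _ = 4 * k * (T * p ^ (-(3 * e / 4))) := by rw [h6]; ring
  have h10 : 4 * k * (T * p ^ (-(3 * e / 4))) < L := by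
    rw [hL, h7]
    calc _ < p ^ (-(e / 4)) * (T * p ^ (-(3 * e / 4))) := by gcongr
      _ = _ := by ring
  linarith

/-- The minimum degree of an extremal dense set. -/
lemma dense_degree {k j : ℕ} (hjk : j ≤ k) {a g β p w c t m C K q : ℝ} (hw : 0 < w) (hwm : w ≤ m)
    (hm : 0 < m) (hp0 : 0 < p) (hp1 : p ≤ 1) (hg : 0 < g) (hgp : g ≤ p ^ (-β)) (hβ0 : 0 < β)
    (hβ1 : β ≤ 1 / 2) (hc : 0 < c) (ht : 0 < t) (hq : 0 < q)
    (hK : C / (β * c * q ^ k) ≤ K) (hKm : K * m ≤ t)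
    (hlow : c * t * (g ^ j / g ^ k) * (w / m) ^ β ≤ p ^ (k - j) * a) :
    c * t * (w / m) ^ β ≤ a ∧ C / (β * a / w) ≤ q ^ k * (w / m) ^ ((1 : ℝ) / 2) := by
  have hwm0 : 0 < w / m := div_pos hw hm
  have hwm1 : w / m ≤ 1 := (div_le_one hm).2 hwm
  have hX : 0 < c * t * (w / m) ^ β := by positivity
  have hac : c * t * (w / m) ^ β ≤ a := by
    have e1 : g ^ j / g ^ k = 1 / g ^ (k - j) := by
      have : g ^ k = g ^ j * g ^ (k - j) := by rw [← pow_add]; congr 1; omega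
      rw [this]; field_simp
    -- Since `g ≤ p ^ (-β)`, the loss `g ^ (k - j)` in `hlow` is covered by the factor `p ^ (k -
    -- j)`.
    have hgp1 : (g * p) ^ (k - j) ≤ 1 := by
      refine pow_le_one₀ (by positivity) ?_
      calc g * p ≤ p ^ (-β) * p := by gcongr
        _ = p ^ (-β + 1) := (Real.rpow_add_one hp0.ne' _).symm
        _ ≤ 1 := Real.rpow_le_one hp0.le hp1 (by linarith)
    rw [e1] at hlow
    have hgkj : 0 < g ^ (k - j) := pow_pos hg _
    have h2 : c * t * (w / m) ^ β ≤ (g * p) ^ (k - j) * a := by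
      calc c * t * (w / m) ^ β = g ^ (k - j) * (c * t * (1 / g ^ (k - j)) * (w / m) ^ β) := by
            field_simp
        _ ≤ g ^ (k - j) * (p ^ (k - j) * a) := by gcongr
        _ = (g * p) ^ (k - j) * a := by rw [mul_pow]; ring
    have ha0 : 0 < a := pos_of_mul_pos_right (hX.trans_le h2) (by positivity)
    exact h2.trans (mul_le_of_le_one_left ha0.le hgp1)
  refine ⟨hac, ?_⟩
  have ha0 : 0 < a := hX.trans_le hac
  set D := β * a / w with hD
  have hD0 : 0 < D := by positivity
  rw [div_le_iff₀ hD0]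
  have h1 : C ≤ q ^ k * (β * c * K) := by
    rw [div_le_iff₀ (by positivity)] at hK
    linarith
  have hrt0 : 0 < (w / m) ^ ((1 : ℝ) / 2) := Real.rpow_pos_of_pos hwm0 _
  have h2 : β * c * K ≤ (w / m) ^ ((1 : ℝ) / 2) * D := by
    have h3 : w / m ≤ (w / m) ^ ((1 : ℝ) / 2) * (w / m) ^ β := by
      rw [← Real.rpow_add hwm0]
      conv_lhs => rw [← Real.rpow_one (w / m)]
      exact Real.rpow_le_rpow_of_exponent_ge hwm0 hwm1 (by linarith)
    calc β * c * K ≤ β * c * (t / m) := by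
          gcongr
          rw [le_div_iff₀ hm]
          exact hKm
      _ = β / w * (c * t * (w / m)) := by field_simp
      _ ≤ β / w * (c * t * ((w / m) ^ ((1 : ℝ) / 2) * (w / m) ^ β)) := by gcongr
      _ = (w / m) ^ ((1 : ℝ) / 2) * (β * (c * t * (w / m) ^ β) / w) := by ring
      _ ≤ (w / m) ^ ((1 : ℝ) / 2) * D := by rw [hD]; gcongr
  calc C ≤ q ^ k * (β * c * K) := h1
    _ ≤ q ^ k * ((w / m) ^ ((1 : ℝ) / 2) * D) := by gcongr
    _ = _ := by ring

set_option maxHeartbeats 1000000 in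
/-- The certificate event for dense sets added to a penalized maximizer. -/
theorem exists_dense_event (k : ℕ) (hk : 3 ≤ k) {γ δ : ℝ} (hγ : 0 < γ) (hγ1 : γ ≤ 1 / 48)
    (hδ : 0 < δ) : ∃ K : ℝ, 1 ≤ K ∧ ∀ᶠ x in 𝓝[>] (0 : ℝ), ∀ p : I, (p : ℝ) = x →
    ∀ (N : ℕ) (t m L : ℝ), Regime N k p K t m → L = √t * (p : ℝ) ^ (-(γ / (4 * k))) →
    √t * (p : ℝ) ^ (-γ) ≤ m →
    ∃ E : ℕ → ℕ → Set (Set ℕ),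
      (∀ w j : ℕ, √t ≤ w → (w : ℝ) ≤ m → (randomSet N p).real (E w j) ≤ Real.exp (-w)) ∧
      ∀ F U : Finset ℕ, F ⊆ U → U ⊆ Finset.Icc 1 N → (U.card : ℝ) ≤ m → (F.card : ℝ) ≤ L / 2 →
        δ * t ≤ exCount N p k U - exCount N p k F →
        (∀ F' ⊆ U, (F'.card : ℝ) ≤ L →
          exCount N p k F' - δ * t / L * F'.card ≤ exCount N p k F - δ * t / L * F.card) →
        ∃ w j : ℕ, √t * (p : ℝ) ^ (-(γ / (4 * k) / 2)) ≤ w ∧ (w : ℝ) ≤ m ∧ j ≤ k ∧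
          ∀ R : Set ℕ, (U : Set ℕ) ⊆ R → R ∈ E w j := by
  have hk0 : (3 : ℝ) ≤ k := by exact_mod_cast hk
  have hkpos : (0 : ℝ) < k := by linarith
  set e : ℝ := γ / (4 * k) with he
  have he0 : 0 < e := by positivity
  have hγe : γ = 4 * k * e := by rw [he]; field_simp
  clear_value e
  set β : ℝ := e / (8 * k) with hβ
  have hβ0 : 0 < β := by positivity
  have heβ : e = 8 * k * β := by rw [hβ]; field_simp
  clear_value β
  have he1 : e ≤ 1 / 48 := by nlinarith
  have hβk : β * k ≤ 1 / 2 := by nlinarith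
  have hβ1 : β ≤ 1 / 2 := by nlinarith
  have hβe : β ≤ e := by nlinarith
  have hexp : 2 * e + k * β + β ≤ 1 / 2 := by nlinarith
  set C : ℝ := 3 * k ^ 3 / γ with hC
  have hC0 : 0 < C := by positivity
  set c : ℝ := δ / (2 * k) with hc
  have hc0 : 0 < c := by positivity
  set C₄ : ℝ := 12 * Real.exp 1 * k * 2 ^ k * C / β with hC₄
  have hC₄0 : 0 < C₄ := by positivity
  set A : ℝ := k / β with hA
  have hA1 : 1 ≤ A := by rw [hA, one_le_div hβ0]; linarith
  obtain ⟨q, hq0, hq1, hqA, hq⟩ := exists_sampling_rate (θ := 1 / (2 * (k : ℝ))) (by positivity)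
    (by rw [div_le_one (by positivity)]; linarith) hA1
  obtain ⟨G, hG1, hGC, hGe⟩ : ∃ G : ℝ, 1 ≤ G ∧ C₄ ≤ G ∧
      Real.exp ((9 + 4 * Real.log C₄) / 3) ≤ G :=
    ⟨max 1 (max C₄ (Real.exp ((9 + 4 * Real.log C₄) / 3))), le_max_left _ _,
      (le_max_left _ _).trans (le_max_right _ _), (le_max_right _ _).trans (le_max_right _ _)⟩
  obtain ⟨K₁, hK₁, hscale⟩ := exists_scale k hk hβ0 hβk hδ hG1
  refine ⟨max K₁ (max (C / (β * c * q ^ k)) (2 * k / δ)), hK₁.trans (le_max_left _ _), ?_⟩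
  set K := max K₁ (max (C / (β * c * q ^ k)) (2 * (k : ℝ) / δ)) with hK
  have hKK₁ : K₁ ≤ K := le_max_left _ _
  have hKC : C / (β * c * q ^ k) ≤ K := (le_max_left _ _).trans (le_max_right _ _)
  have hKδ : 2 * (k : ℝ) / δ ≤ K := (le_max_right _ _).trans (le_max_right _ _)
  have hK1 : 1 ≤ K := hK₁.trans hKK₁
  clear_value K
  have hlogev : ∀ᶠ p in 𝓝[>] (0 : ℝ), 3 * p ^ (e / 2) * (1 - 2 * k * Real.log p) ≤ 1 / 8 := by
    have hr : 0 < e / 2 := by positivity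
    have h1 := tendsto_log_mul_rpow_nhdsGT_zero hr
    have h2 : Tendsto (fun p : ℝ => p ^ (e / 2)) (𝓝[>] 0) (𝓝 0) := by
      have h := (Real.continuousAt_rpow_const 0 (e / 2) (Or.inr hr.le)).tendsto
      rw [Real.zero_rpow hr.ne'] at h
      exact h.mono_left nhdsWithin_le_nhds
    have h3 := (h2.const_mul 3).sub (h1.const_mul (6 * (k : ℝ)))
    rw [mul_zero, mul_zero, sub_zero] at h3
    filter_upwards [h3.eventually_le_const (show (0 : ℝ) < 1 / 8 by norm_num)] with p hp
    linarith
  filter_upwards [self_mem_nhdsWithin, eventually_lt_nhdsGT (show (0 : ℝ) < 1 / 2 by norm_num), hscale, hlogev,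
    eventually_le_rpow_neg (show 0 < e / 2 by positivity) (24 * A),
    eventually_le_rpow_neg (show (0 : ℝ) < 1 / 2 by norm_num) ((k : ℝ) ^ 2 / c),
    (tendsto_rpow_neg_nhdsGT_zero (show -(e / 4) < 0 by linarith)).eventually_gt_atTop (4 * (k : ℝ)),
    eventually_le_rpow_neg (show 0 < e / 2 by positivity) 2]
    with x hx0 hx1 hxscale hxlog hxA hxκ hxk hx2 p hpx N t m L hreg hL hLm
  rw [← hpx] at hx0 hx1 hxscale hxlog hxA hxκ hxk hx2
  clear hscale hlogev hpx
  have hp0 : 0 < (p : ℝ) := hx0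
  have hp1 : (p : ℝ) ≤ 1 := by linarith
  have ht := hreg.t_pos
  have hm := hreg.m_pos
  have hT := hreg.sqrt_pos
  have hTT : √t * √t = t := Real.mul_self_sqrt ht.le
  have hmT := hreg.m_le hK1 hp1
  obtain ⟨g, hgG, hgp, hω1, hlogω, hgδ⟩ := hxscale N t m (hreg.mono hKK₁)
  have hg1 : 1 ≤ g := hG1.trans hgG
  have hg0 : 0 < g := by linarith
  have hL0 : 0 < L := by rw [hL]; positivity
  refine ⟨fun w j => certEvent N k j (sampleSize k q e p L m w)
    (3 * k * 2 ^ k * C * (2 * w / (β * g * p))) ⌈(w : ℝ) / 2⌉₊, ?_, ?_⟩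
  · intro w j hTw hwm
    beta_reduce
    have hw0 : (0 : ℝ) < w := hT.trans_le hTw
    obtain ⟨hr0, hrA, hrlog⟩ := sampleSize_spec (L := L) hk hq0 (by linarith : e ≤ 1) hp0 hp1 hT hTw
      hwm hmT (by linarith) hqA hq hxA hxlog
    generalize sampleSize k q e p L m w = r₀ at hr0 hrA hrlog
    have hn0 : 0 < ⌈(w : ℝ) / 2⌉₊ := Nat.ceil_pos.2 (by positivity)
    have hnw : (w : ℝ) / 2 ≤ (⌈(w : ℝ) / 2⌉₊ : ℝ) := Nat.le_ceil _
    set ω := t / (m ^ 2 * (p : ℝ) ^ (k - 2)) with hω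
    have hωm : t / (m * (p : ℝ) ^ (k - 2)) = ω * m := by rw [hω]; field_simp
    have hrw : r₀ ≤ w / 8 := le_trans (le_mul_of_one_le_right hr0.le hA1) hrA
    have hrY : r₀ ≤ ω * m := by
      have : m ≤ ω * m := le_mul_of_one_le_left hm.le hω1
      linarith
    refine (certEvent_le N k j p hr0 hrY (hωm ▸ hreg.N_mul_le hk hK1) (by positivity) hn0).trans ?_
    refine dense_cost hw0 hr0 hm (by linarith) hC₄0 (hGC.trans hgG) hnw (by positivity) ?_ hrlog
      ?_ ?_
    · calc _ ≤ Real.exp 1 * (3 * k * 2 ^ k * C * (2 * w / (β * g * p))) * p / (w / 2) := by gcongr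
        _ = C₄ / g := by rw [hC₄]; field_simp; ring
    · have hlg : 0 ≤ Real.log g := Real.log_nonneg hg1
      calc r₀ * Real.log ω ≤ r₀ * (A * Real.log g) := by gcongr
        _ = r₀ * A * Real.log g := by ring
        _ ≤ w / 8 * Real.log g := by gcongr
    · have := (Real.le_log_iff_exp_le hg0).2 (hGe.trans hgG)
      linarith
  · intro F U hFU hUN hUm hFL hgain hmax
    have hk1 : k * (m * (N * (p : ℝ) ^ (k - 1))) ≤ δ * t / 2 := by
      rw [div_le_iff₀ hδ] at hKδ
      have h0 : 0 ≤ m * (N * (p : ℝ) ^ (k - 1)) := by positivity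
      have h1 := hreg.K_mul_N_le
      calc k * (m * (N * (p : ℝ) ^ (k - 1))) ≤ (K * δ / 2) * (m * (N * (p : ℝ) ^ (k - 1))) := by
            gcongr; linarith
        _ = δ * (K * (m * (N * (p : ℝ) ^ (k - 1)))) / 2 := by ring
        _ ≤ δ * t / 2 := by gcongr
    obtain ⟨W, hWU, hWne, j, hj3, hjk, a, ha, hdeg, hlow, hcnt⟩ := exists_dense_subset N k hk hp0 hg1
      hβ0.le (by linarith) (by positivity) F U hFU hUm hgain hk1 hgδ
    have hw0 : (0 : ℝ) < W.card := by exact_mod_cast hWne.card_pos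
    have hdisj : Disjoint F W :=
      Finset.disjoint_of_subset_right hWU Finset.disjoint_sdiff
    have hFWU : F ∪ W ⊆ U := Finset.union_subset hFU (hWU.trans Finset.sdiff_subset)
    have hcardFW : ((F ∪ W).card : ℝ) = F.card + W.card := by
      rw [Finset.card_union_of_disjoint hdisj, Nat.cast_add]
    have hwm : (W.card : ℝ) ≤ m :=
      le_trans (by exact_mod_cast Finset.card_le_card (hWU.trans Finset.sdiff_subset)) hUm
    -- If `F ∪ W` still has at most `L` elements, it competes with `F`, so the gain of `W` is at
    -- most `δ t / L` per element and `dense_card_ge` applies. Otherwise `|W| > L / 2`.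
    have hwlarge : √t * (p : ℝ) ^ (-(e / 2)) ≤ W.card := by
      by_cases hwL : (W.card : ℝ) ≤ L / 2
      · have hm1 := hmax (F ∪ W) hFWU (by rw [hcardFW]; linarith)
        have hup := le_exCount_sub N k hp0.le hx1.le (Finset.subset_union_left (s₁ := F) (s₂ := W))
          (j := j) (Finset.mem_Icc.2 ⟨by omega, hjk⟩)
        rw [← ha] at hup
        rw [hcardFW] at hm1
        refine dense_card_ge hw0 hβ0 (by linarith) hg0 hp0 hp1 hT hg1 (by omega) (by positivity)
          hm hlow (hup.trans ?_) hL hgp hmT heβ hxk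
        linarith
      · push Not at hwL
        refine le_trans ?_ hwL.le
        rw [hL]
        have e1 : (p : ℝ) ^ (-e) = (p : ℝ) ^ (-(e / 2)) * (p : ℝ) ^ (-(e / 2)) := by
          rw [← Real.rpow_add hp0]; congr 1; ring
        have h5 : 0 < (p : ℝ) ^ (-(e / 2)) := Real.rpow_pos_of_pos hp0 _
        rw [e1]
        have : √t * (p : ℝ) ^ (-(e / 2)) * 2 ≤ √t * (p : ℝ) ^ (-(e / 2)) * (p : ℝ) ^ (-(e / 2)) := by
          gcongr
        linarith
    have hTw : √t ≤ W.card := by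
      refine le_trans (le_mul_of_one_le_right hT.le ?_) hwlarge
      linarith
    refine ⟨W.card, j, hwlarge, hwm, hjk, fun R hR => ?_⟩
    beta_reduce
    obtain ⟨w, hw⟩ : ∃ w : ℝ, w = W.card := ⟨_, rfl⟩
    rw [← hw] at hw0 hwm hwlarge hTw hdeg hlow hcardFW ⊢
    clear hwlarge
    obtain ⟨hac, hrt⟩ := dense_degree (a := a) hjk hw0 hwm hm hp0 hp1 hg0 hgp hβ0 hβ1 hc0 ht hq0
      hKC hreg.K_mul_m_le (le_of_eq_of_le (by rw [hc]; ring) hlow)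
    have hwm0 : 0 < w / m := div_pos hw0 hm
    have ha0 : 0 < a := lt_of_lt_of_le (by positivity) hac
    have hD0 : 0 < β * a / w := by positivity
    have hCD : C ≤ β * a / w := by
      rw [← div_le_one hD0]
      refine hrt.trans (mul_le_one₀ (pow_le_one₀ hq0.le hq1) (by positivity) ?_)
      exact Real.rpow_le_one hwm0.le ((div_le_one hm).2 hwm) (by norm_num)
    obtain ⟨hr0, hrA, -⟩ := sampleSize_spec (L := L) hk hq0 (by linarith : e ≤ 1) hp0 hp1 hT hTw
      hwm hmT (by linarith) hqA hq hxA hxlog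
    have hrw : sampleSize k q e p L m w ≤ w / 8 :=
      le_trans (le_mul_of_one_le_right hr0.le hA1) hrA
    refine mem_certEvent N k j (by omega) hjk (F ∪ W) W Finset.subset_union_right
      (hFWU.trans hUN) hWne hγ hC hCD hdeg ?_ ?_ ?_ ((Finset.coe_subset.2 hFWU).trans hR)
    · exact le_sampleSize hj3 hjk hq0 hq1 he0 hγe hp0 hp1 hT hTw hwm hL hLm
        (by rw [hcardFW]; linarith) (Nat.cast_nonneg _) (div_pos hC0 hD0) hrt
    · have hcF : (cnt N k (j - 1) F : ℝ) ≤ k ^ 2 * L ^ 2 := by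
        have h1 := cnt_gain_le N k F ∅ (show 2 ≤ j - 1 by omega)
        rw [cnt_empty N k _ (by omega), Finset.sdiff_empty] at h1
        push_cast at h1
        have h2 : (F.card : ℝ) ≤ L := by linarith
        have h3 := mul_le_mul_of_nonneg_left (mul_le_mul h2 h2 (Nat.cast_nonneg _) hL0.le)
          (sq_nonneg (k : ℝ))
        linarith
      have := cnt_div_le (k := k) (κ := (k : ℝ) ^ 2) hw0 hβ0 hg0 hp0 hp1 hT hTT hc0 hac hcnt hcF
        hL hgp hTw hwm hmT (by positivity) hexp hxκ
      gcongr
    · have h1 := Nat.ceil_lt_add_one (a := w / 2) (by positivity)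
      have h2 : γ * w ≤ 1 / 48 * w := by gcongr
      rw [← hw]
      linarith

/-! ### The size of the smallest seed -/

lemma div_le_natCast_div {k r : ℕ} (hk : 0 < k) (hr : 2 * k ≤ r) :
    (r : ℝ) / (4 * k) ≤ ((r / (2 * k) : ℕ) : ℝ) := by
  have hk0 : (0 : ℝ) < k := by exact_mod_cast hk
  have h1 : r < 2 * k * (r / (2 * k) + 1) := Nat.lt_mul_div_succ r (by omega)
  have h2 : 1 ≤ r / (2 * k) := (Nat.one_le_div_iff (by omega)).2 hr
  have h3 : (r : ℝ) < 2 * k * (((r / (2 * k) : ℕ) : ℝ) + 1) := by exact_mod_cast h1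
  have h4 : (1 : ℝ) ≤ ((r / (2 * k) : ℕ) : ℝ) := by exact_mod_cast h2
  rw [div_le_iff₀ (by positivity)]
  nlinarith

/-- A set whose expectation is nearly that of a seed is nearly as large as the smallest seed. -/
theorem exists_card_ge_of_near (k : ℕ) (hk : 2 ≤ k) {ε : ℝ} (hε : 0 < ε) (hε1 : ε ≤ 1) :
    ∃ δ T₀ : ℝ, 0 < δ ∧ δ ≤ 1 / 2 ∧ ∀ (N n : ℕ) (p t : ℝ), 0 ≤ p → p ≤ 1 / 2 → 0 ≤ t → T₀ ≤ √t →
      √t ≤ 2 * k ^ 2 * n → exCount N p k ∅ + t ≤ exCount N p k (Finset.Icc 1 N) →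
      (∀ V ⊆ Finset.Icc 1 N, exCount N p k ∅ + t ≤ exCount N p k V → n ≤ V.card) →
      ∀ S ⊆ Finset.Icc 1 N, exCount N p k ∅ + (1 - δ) * t ≤ exCount N p k S →
        (1 - ε) * n ≤ S.card := by
  have hk0 : (2 : ℝ) ≤ k := by exact_mod_cast hk
  have hkpos : (0 : ℝ) < k := by linarith
  set ε₁ : ℝ := ε / (8 * k ^ 2) with hε₁
  have hε₁0 : 0 < ε₁ := by positivity
  have hε₁1 : ε₁ ≤ 1 := by
    rw [hε₁, div_le_one (by positivity)]
    nlinarith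
  have hδ1 : ε / 2 * ε₁ ^ 2 / (8 * k ^ 2) ≤ 1 / 2 := by
    rw [div_le_iff₀ (by positivity)]
    have h1 : ε₁ ^ 2 ≤ 1 := pow_le_one₀ hε₁0.le hε₁1
    have h2 : (1 : ℝ) ≤ k ^ 2 := one_le_pow₀ (by linarith)
    nlinarith
  refine ⟨ε / 2 * ε₁ ^ 2 / (8 * k ^ 2), 2 * k / ε₁, by positivity, hδ1, ?_⟩
  intro N n p t hp0 hp1 ht hT hTn hfull hmin S hS hnear
  have h1 : 2 * k ≤ ε₁ * √t := by rwa [div_le_iff₀' hε₁0] at hT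
  have hrle : ε₁ * √t ≤ (⌈ε₁ * √t⌉₊ : ℝ) := Nat.le_ceil _
  have hrlt := Nat.ceil_lt_add_one (a := ε₁ * √t) (by positivity)
  generalize ⌈ε₁ * √t⌉₊ = r at hrle hrlt
  have hr2 : 2 * k ≤ r := by exact_mod_cast h1.trans hrle
  obtain ⟨U, hU, hUseed, hUcard⟩ := exists_seed_of_near N k hk hp0 hp1 (η := ε / 2) (by positivity)
    hfull S hS hnear (r := r) (by omega) (by
      have h2 := div_le_natCast_div (by omega) hr2
      calc 2 * k * (ε / 2 * ε₁ ^ 2 / (8 * k ^ 2) * t) = ε / 2 * (ε₁ * √t) * (ε₁ * √t / (4 * k)) := by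
            have : t = √t * √t := (Real.mul_self_sqrt ht).symm
            field_simp
            rw [Real.sq_sqrt ht]
            ring
        _ ≤ ε / 2 * r * (r / (4 * k)) := by gcongr
        _ ≤ _ := by gcongr)
  have hnU : (n : ℝ) ≤ U.card := by exact_mod_cast hmin U hU hUseed
  have h3 : ε₁ * √t ≤ ε / 4 * n := by
    calc ε₁ * √t ≤ ε₁ * (2 * k ^ 2 * n) := by gcongr
      _ = ε / 4 * n := by rw [hε₁]; field_simp; ring
  nlinarith

/-- If `[N]` is a seed, then there are seeds with `O(√t)` elements. -/
theorem le_sqrt_of_forall_seed (N k : ℕ) (hk : 2 ≤ k) {p t : ℝ} {n : ℕ} (hp0 : 0 ≤ p)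
    (hp1 : p ≤ 1 / 2) (ht : 1 ≤ t) (hfull : exCount N p k ∅ + t ≤ exCount N p k (Finset.Icc 1 N))
    (hmin : ∀ V ⊆ Finset.Icc 1 N, exCount N p k ∅ + t ≤ exCount N p k V → n ≤ V.card) :
    n ≤ 10 * k * √t := by
  have hk0 : (2 : ℝ) ≤ k := by exact_mod_cast hk
  have hT : 1 ≤ √t := Real.one_le_sqrt.2 ht
  have hrle : 4 * k * √t ≤ (⌈4 * k * √t⌉₊ : ℝ) := Nat.le_ceil _
  have hrlt := Nat.ceil_lt_add_one (a := 4 * k * √t) (by positivity)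
  generalize ⌈4 * k * √t⌉₊ = r at hrle hrlt
  have hr2 : 2 * k ≤ r := by
    have : (2 * k : ℝ) ≤ r := by nlinarith
    exact_mod_cast this
  -- With `δ = 1` the empty set counts as nearly a seed, so one interval of length about `4k√t`, or
  -- `[N]` itself, suffices.
  obtain ⟨U, hU, hUseed, hUcard⟩ := exists_seed_of_near N k hk hp0 hp1 (η := 1 / 2) (δ := 1)
    (by norm_num) hfull ∅ (Finset.empty_subset _) (by simp) (r := r) (by omega) (by
      have h2 := div_le_natCast_div (by omega) hr2
      calc 2 * k * (1 * t) = 1 / 2 * (4 * k * √t) * (4 * k * √t / (4 * k)) := by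
            field_simp
            rw [Real.sq_sqrt (by linarith)]
            ring
        _ ≤ 1 / 2 * r * (r / (4 * k)) := by gcongr
        _ ≤ _ := by gcongr)
  have hnU : (n : ℝ) ≤ U.card := by exact_mod_cast hmin U hU hUseed
  rw [Finset.card_empty, Nat.cast_zero] at hUcard
  nlinarith

/-- A seed has at least of the order of `√t` elements. -/
lemma sqrt_le_of_seed {N k : ℕ} (hk : 2 ≤ k) {p K t m : ℝ} (hp0 : 0 ≤ p) (hp1 : p ≤ 1)
    (hK : 4 * k ≤ K) (hm : K * (m * (N * p ^ (k - 1))) ≤ t) {S : Finset ℕ}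
    (hSm : S.card ≤ m) (hS : exCount N p k ∅ + t / 2 ≤ exCount N p k S) :
    √t ≤ 2 * k ^ 2 * S.card := by
  have hm0 : 0 ≤ m := le_trans (Nat.cast_nonneg _) hSm
  have h := le_card_sq_of_exCount N k hk hp0 hp1 S (t := t) (by
    have h0 : 0 ≤ m * (N * p ^ (k - 1)) := by positivity
    have h1 : k * (S.card * (N * p ^ (k - 1))) ≤ k * (m * (N * p ^ (k - 1))) := by gcongr
    nlinarith) hS
  have hk0 : (1 : ℝ) ≤ k := by exact_mod_cast (by omega : 1 ≤ k)
  rw [Real.sqrt_le_left (by positivity)]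
  refine h.trans ?_
  calc 4 * (k : ℝ) ^ 3 * S.card ^ 2 ≤ 4 * (k : ℝ) ^ 4 * S.card ^ 2 := by
        gcongr
        norm_num
    _ = _ := by ring

/-- Combines `K m ≤ t` with `√t = O(m)`: a large `K` forces `t` to be large. -/
lemma Regime.le_sqrt {N k : ℕ} {p K t m : ℝ} (h : Regime N k p K t m) :
    K ≤ 2 * k ^ 2 * √t := by
  have hm := h.m_pos
  refine le_of_mul_le_mul_right ?_ hm
  calc K * m ≤ t := h.K_mul_m_le
    _ = √t * √t := (Real.mul_self_sqrt h.t_pos.le).symm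
    _ ≤ √t * (2 * k ^ 2 * m) := by gcongr; exact h.sqrt_le
    _ = _ := by ring

/-! ### Covering all small seeds, and the union bound -/

set_option maxHeartbeats 800000 in
/-- Every small seed contained in the random set triggers one of few unlikely events. -/
theorem exists_cover (k : ℕ) (hk : 3 ≤ k) {ε : ℝ} (hε : 0 < ε) (hε1 : ε ≤ 1 / 2) :
    ∃ K : ℝ, 1 ≤ K ∧ ∀ᶠ x in 𝓝[>] (0 : ℝ), ∀ p : I, (p : ℝ) = x → ∀ (N n : ℕ) (t m : ℝ),
    Regime N k p K t m → 1 ≤ t → 0 < n → √t ≤ 2 * k ^ 2 * n →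
    exCount N p k ∅ + t ≤ exCount N p k (Finset.Icc 1 N) →
    (∀ V ⊆ Finset.Icc 1 N, exCount N p k ∅ + t ≤ exCount N p k V → n ≤ V.card) →
    ∃ (E : ℕ → Set (Set ℕ)) (E' : ℕ → ℕ → Set (Set ℕ)),
      (∀ f : ℕ, (1 - ε / 4) * n ≤ f →
        (randomSet N p).real (E f) ≤ (p : ℝ) ^ ((1 - ε / 4) * f)) ∧
      (∀ w j : ℕ, √t ≤ w → (w : ℝ) ≤ m → (randomSet N p).real (E' w j) ≤ Real.exp (-w)) ∧
      ∀ U ⊆ Finset.Icc 1 N, (U.card : ℝ) ≤ m → exCount N p k ∅ + t ≤ exCount N p k U →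
        ∀ R : Set ℕ, (U : Set ℕ) ⊆ R →
          (∃ f : ℕ, (1 - ε / 4) * n ≤ f ∧ (f : ℝ) ≤ m ∧ R ∈ E f) ∨
          ∃ w j : ℕ, √t * (p : ℝ) ^ (-(ε / 24 / (4 * k) / 2)) ≤ w ∧ (w : ℝ) ≤ m ∧ j ≤ k ∧
            R ∈ E' w j := by
  have hk0 : (3 : ℝ) ≤ k := by exact_mod_cast hk
  obtain ⟨γ, hγ⟩ : ∃ γ : ℝ, γ = ε / 24 := ⟨_, rfl⟩
  have hγ0 : 0 < γ := by rw [hγ]; positivity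
  have hγ1 : γ ≤ 1 / 48 := by linarith
  have hγε : 1 - 6 * γ = 1 - ε / 4 := by rw [hγ]; ring
  have haγ : γ / (4 * k) ≤ γ := div_le_self hγ0.le (by linarith)
  rw [← hγ]
  obtain ⟨δ, T₀, hδ0, hδ1, hnear⟩ := exists_card_ge_of_near k (by omega)
    (show 0 < ε / 4 by positivity) (by linarith)
  obtain ⟨K₁, hK₁, hcore⟩ := exists_core_event k hk hγ0 hγ1 hδ0
  obtain ⟨K₂, hK₂, hdense⟩ := exists_dense_event k hk hγ0 hγ1 hδ0
  refine ⟨max (max K₁ K₂) (2 * k ^ 2 * T₀), hK₁.trans ((le_max_left _ _).trans (le_max_left _ _)),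
    ?_⟩
  filter_upwards [self_mem_nhdsWithin, eventually_lt_nhdsGT (show (0 : ℝ) < 1 / 2 by norm_num),
    hcore, hdense, eventually_le_rpow_neg (show 0 < γ / (4 * k) by positivity) (20 * (k : ℝ))]
    with x hx0 hx1 hxcore hxdense hx20 p hpx N n t m hreg ht1 hn hTn hfull hmin
  have hxcore' := hxcore p hpx N t m
  have hxdense' := hxdense p hpx N t m
  rw [← hpx] at hx0 hx1 hx20
  clear hcore hdense hxcore hxdense hpx
  have hp0 : 0 < (p : ℝ) := hx0
  have hp1 : (p : ℝ) ≤ 1 := by linarith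
  have ht := hreg.t_pos
  have hm := hreg.m_pos
  have hT := hreg.sqrt_pos
  have hT₀ : T₀ ≤ √t := by
    have h1 := (hreg.mono (le_max_right _ _)).le_sqrt
    exact le_of_mul_le_mul_left h1 (by positivity)
  have hreg₁ := hreg.mono ((le_max_left K₁ K₂).trans (le_max_left _ _))
  have hreg₂ := hreg.mono ((le_max_right K₁ K₂).trans (le_max_left _ _))
  have hlarge := hnear N n p t hp0.le hx1.le ht.le hT₀ hTn hfull hmin
  have hnC := le_sqrt_of_forall_seed N k (by omega) hp0.le hx1.le ht1 hfull hmin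
  have hn0 : (1 : ℝ) ≤ n := by exact_mod_cast hn
  have hTf : ∀ f : ℕ, (1 - ε / 4) * n ≤ f → √t ≤ 4 * k ^ 2 * f := by
    intro f hf
    have h1 : (n : ℝ) ≤ 2 * f := by nlinarith
    calc √t ≤ 2 * k ^ 2 * n := hTn
      _ ≤ 2 * k ^ 2 * (2 * f) := by gcongr
      _ = _ := by ring
  have hmarg : ∀ (L : ℝ) (F U : Finset ℕ), F ⊆ U → (F.card : ℝ) ≤ L →
      (∀ F' ⊆ U, (F'.card : ℝ) ≤ L →
        exCount N p k F' - δ * t / L * F'.card ≤ exCount N p k F - δ * t / L * F.card) →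
      ∀ u ∈ F, δ * t / L ≤ exCount N p k F - exCount N p k (F.erase u) := by
    intro L F U hFU hFL hmax u hu
    have h1 : ((F.erase u).card : ℝ) + 1 = F.card := by
      exact_mod_cast Finset.card_erase_add_one hu
    have h2 := hmax _ ((Finset.erase_subset u F).trans hFU) (by linarith)
    rw [← h1] at h2
    linarith
  have hne : ∀ F : Finset ℕ, (1 - ε / 4) * n ≤ F.card → F.Nonempty := by
    intro F hF
    rw [← Finset.card_pos]
    have : (0 : ℝ) < F.card := by nlinarith
    exact_mod_cast this
  classical
  by_cases hmγ : m ≤ √t * (p : ℝ) ^ (-γ)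
  · obtain ⟨E, hE, hcov⟩ := hxcore' m hreg₁ hm le_rfl hmγ
    refine ⟨fun f => if (f : ℝ) ≤ m then E f else ∅, fun _ _ => ∅, ?_, ?_, ?_⟩
    · intro f hf
      beta_reduce
      split_ifs with hfm
      · rw [← hγε]
        exact hE f (hTf f hf) hfm
      · rw [measureReal_empty]
        exact Real.rpow_nonneg hp0.le _
    · intro w j _ _
      rw [measureReal_empty]
      positivity
    · intro U hUN hUm hU R hUR
      obtain ⟨F, hFU, hFm, hmax⟩ := exists_penalized_max N k p (δ * t / m) U hm.le
      have h1 := hmax U le_rfl hUm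
      -- With `L = m`, `U` itself is a competitor and its penalty is at most `δ t`, so the maximizer
      -- is always nearly a seed.
      have h2 : δ * t / m * U.card ≤ δ * t := by
        calc δ * t / m * U.card ≤ δ * t / m * m := by gcongr
          _ = δ * t := by field_simp
      have h3 : 0 ≤ δ * t / m * F.card := by positivity
      have hFn := hlarge F (hFU.trans hUN) (by linarith)
      refine Or.inl ⟨F.card, hFn, hFm, ?_⟩
      beta_reduce
      rw [if_pos hFm]
      exact hcov F (hFU.trans hUN) (hne F hFn) hFm (hmarg m F U hFU hFm hmax) R
        ((Finset.coe_subset.2 hFU).trans hUR)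
  · push Not at hmγ
    obtain ⟨L, hL⟩ : ∃ L : ℝ, L = √t * (p : ℝ) ^ (-(γ / (4 * k))) := ⟨_, rfl⟩
    have hL0 : 0 < L := by rw [hL]; positivity
    have hLγ : L ≤ √t * (p : ℝ) ^ (-γ) := by
      rw [hL]
      gcongr ?_ * ?_
      exact Real.rpow_le_rpow_of_exponent_ge hp0 hp1 (by linarith)
    have hLm : L ≤ m := hLγ.trans hmγ.le
    have hLn : (n : ℝ) ≤ L / 2 := by
      have : √t * (20 * k) ≤ L := by rw [hL]; gcongr
      linarith
    obtain ⟨E, hE, hcov⟩ := hxcore' L hreg₁ hL0 hLm hLγ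
    obtain ⟨E', hE', hcov'⟩ := hxdense' L hreg₂ hL hmγ.le
    refine ⟨fun f => if (f : ℝ) ≤ L then E f else ∅, E', ?_, hE', ?_⟩
    · intro f hf
      beta_reduce
      split_ifs with hfm
      · rw [← hγε]
        exact hE f (hTf f hf) hfm
      · rw [measureReal_empty]
        exact Real.rpow_nonneg hp0.le _
    · intro U hUN hUm hU R hUR
      obtain ⟨F, hFU, hFL, hmax⟩ := exists_penalized_max N k p (δ * t / L) U hL0.le
      -- `F` is large if it is nearly a seed, and also if `|F| > L / 2 ≥ n`; in the remaining case
      -- `U` gains at least `δ t` over `F`.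
      have hkey : (1 - ε / 4) * n ≤ F.card ∨
          ((F.card : ℝ) ≤ L / 2 ∧ δ * t ≤ exCount N p k U - exCount N p k F) := by
        by_cases h1 : exCount N p k ∅ + (1 - δ) * t ≤ exCount N p k F
        · exact Or.inl (hlarge F (hFU.trans hUN) h1)
        · by_cases h2 : (F.card : ℝ) ≤ L / 2
          · exact Or.inr ⟨h2, by linarith⟩
          · left
            have h3 : 0 ≤ ε * n := by positivity
            linarith
      rcases hkey with hFn | ⟨hF2, hgain⟩
      · refine Or.inl ⟨F.card, hFn, hFL.trans hLm, ?_⟩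
        beta_reduce
        rw [if_pos hFL]
        exact hcov F (hFU.trans hUN) (hne F hFn) hFL (hmarg L F U hFU hFL hmax) R
          ((Finset.coe_subset.2 hFU).trans hUR)
      · obtain ⟨w, j, hw, hwm, hj, hR⟩ := hcov' F U hFU hUN hUm hF2 hgain hmax
        exact Or.inr ⟨w, j, hw, hwm, hj, hR R hUR⟩

lemma sum_Icc_pow_le {x : ℝ} (hx0 : 0 ≤ x) (hx1 : x ≤ 1 / 2) (a b : ℕ) :
    ∑ i ∈ Finset.Icc a b, x ^ i ≤ 2 * x ^ a := by
  by_cases hab : a ≤ b + 1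
  · have h := geom_sum_Ico_mul_neg x hab
    have h1 : Finset.Icc a b = Finset.Ico a (b + 1) := by ext; simp
    rw [h1]
    have h2 : 0 ≤ ∑ i ∈ Finset.Ico a (b + 1), x ^ i := Finset.sum_nonneg fun i _ => by positivity
    have h3 : 0 ≤ x ^ (b + 1) := by positivity
    nlinarith
  · rw [Finset.Icc_eq_empty (by omega), Finset.sum_empty]
    positivity

/-- The upper bound on the probability that the random set contains a small seed, where `n` is the
size of the smallest seed. -/
theorem measureReal_exists_seed_le (k : ℕ) (hk : 3 ≤ k) {ε : ℝ} (hε : 0 < ε) (hε1 : ε ≤ 1 / 2) :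
    ∃ K : ℝ, 1 ≤ K ∧ ∀ᶠ x in 𝓝[>] (0 : ℝ), ∀ p : I, (p : ℝ) = x → ∀ (N n : ℕ) (t m : ℝ),
    Regime N k p K t m → 1 ≤ t → 0 < n → √t ≤ 2 * k ^ 2 * n →
    exCount N p k ∅ + t ≤ exCount N p k (Finset.Icc 1 N) →
    (∀ V ⊆ Finset.Icc 1 N, exCount N p k ∅ + t ≤ exCount N p k V → n ≤ V.card) →
    (randomSet N p).real {R | ∃ U ⊆ Finset.Icc 1 N, exCount N p k ∅ + t ≤ exCount N p k U ∧
      (U.card : ℝ) ≤ m ∧ (U : Set ℕ) ⊆ R} ≤ (p : ℝ) ^ ((1 - ε) * n) := by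
  have hk0 : (3 : ℝ) ≤ k := by exact_mod_cast hk
  obtain ⟨K, hK, hcover⟩ := exists_cover k hk hε hε1
  refine ⟨K, hK, ?_⟩
  obtain ⟨a, ha⟩ : ∃ a : ℝ, a = ε / 24 / (4 * k) / 2 := ⟨_, rfl⟩
  have ha0 : 0 < a := by rw [ha]; positivity
  rw [← ha] at hcover
  have hlogev : ∀ᶠ p in 𝓝[>] (0 : ℝ),
      p ^ a * Real.log (4 * (k + 1)) - 10 * k * (Real.log p * p ^ a) ≤ 1 := by
    have h1 := tendsto_log_mul_rpow_nhdsGT_zero ha0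
    have h2 : Tendsto (fun p : ℝ => p ^ a) (𝓝[>] 0) (𝓝 0) := by
      have h := (Real.continuousAt_rpow_const 0 a (Or.inr ha0.le)).tendsto
      rw [Real.zero_rpow ha0.ne'] at h
      exact h.mono_left nhdsWithin_le_nhds
    have h3 := (h2.mul_const (Real.log (4 * (k + 1)))).sub (h1.const_mul (10 * (k : ℝ)))
    rw [mul_zero, zero_mul, sub_zero] at h3
    exact h3.eventually_le_const one_pos
  filter_upwards [self_mem_nhdsWithin, eventually_lt_nhdsGT (show (0 : ℝ) < 1 / 4 by norm_num),
    hcover, hlogev, eventually_le_rpow_neg (show 0 < ε / 2 by positivity) 4]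
    with x hx0 hx1 hxcover hxlog hx4 p hpx N n t m hreg ht1 hn hTn hfull hmin
  obtain ⟨E, E', hE, hE', hcov⟩ := hxcover p hpx N n t m hreg ht1 hn hTn hfull hmin
  rw [← hpx] at hx0 hx1 hx4 hxlog
  clear hcover hxcover hlogev hpx
  have hp0 : 0 < (p : ℝ) := hx0
  have hp1 : (p : ℝ) ≤ 1 := by linarith
  have hT := hreg.sqrt_pos
  have hT1 : 1 ≤ √t := Real.one_le_sqrt.2 ht1
  have hn0 : (1 : ℝ) ≤ n := by exact_mod_cast hn
  have hpa1 : 1 ≤ (p : ℝ) ^ (-a) := Real.one_le_rpow_of_pos_of_le_one_of_nonpos hp0 hp1 (by linarith)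
  set f₀ := ⌈(1 - ε / 4) * n⌉₊ with hf₀
  set w₀ := ⌈√t * (p : ℝ) ^ (-a)⌉₊ with hw₀
  set M := ⌊m⌋₊ with hM
  have hsub : {R : Set ℕ | ∃ U ⊆ Finset.Icc 1 N, exCount N p k ∅ + t ≤ exCount N p k U ∧
      (U.card : ℝ) ≤ m ∧ (U : Set ℕ) ⊆ R} ⊆ (⋃ f ∈ Finset.Icc f₀ M, E f) ∪
      ⋃ w ∈ Finset.Icc w₀ M, ⋃ j ∈ Finset.range (k + 1), E' w j := by
    rintro R ⟨U, hUN, hU, hUm, hUR⟩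
    rcases hcov U hUN hUm hU R hUR with ⟨f, h1, h2, h3⟩ | ⟨w, j, h1, h2, h3, h4⟩
    · left
      rw [Set.mem_iUnion₂]
      exact ⟨f, Finset.mem_Icc.2 ⟨Nat.ceil_le.2 h1, Nat.le_floor h2⟩, h3⟩
    · right
      rw [Set.mem_iUnion₂]
      refine ⟨w, Finset.mem_Icc.2 ⟨Nat.ceil_le.2 h1, Nat.le_floor h2⟩, ?_⟩
      rw [Set.mem_iUnion₂]
      exact ⟨j, Finset.mem_range.2 (by omega), h4⟩
  have hle : ∀ f ∈ Finset.Icc f₀ M, (randomSet N p).real (E f) ≤ ((p : ℝ) ^ (1 - ε / 4)) ^ f := by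
    intro f hf
    rw [Finset.mem_Icc] at hf
    rw [← Real.rpow_natCast, ← Real.rpow_mul hp0.le]
    exact hE f (Nat.ceil_le.1 hf.1)
  have hle' : ∀ w ∈ Finset.Icc w₀ M,
      (randomSet N p).real (⋃ j ∈ Finset.range (k + 1), E' w j) ≤
        (k + 1) * (Real.exp (-1)) ^ w := by
    intro w hw
    rw [Finset.mem_Icc] at hw
    have h1 : √t * (p : ℝ) ^ (-a) ≤ w := Nat.ceil_le.1 hw.1
    have h2 : √t ≤ w := le_trans (le_mul_of_one_le_right hT.le hpa1) h1
    have h3 : (w : ℝ) ≤ m := (Nat.le_floor_iff hreg.m_pos.le).1 hw.2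
    refine (measureReal_biUnion_finset_le _ _).trans ?_
    calc _ ≤ ∑ j ∈ Finset.range (k + 1), Real.exp (-w) :=
          Finset.sum_le_sum fun j _ => hE' w j h2 h3
      _ = (k + 1) * (Real.exp (-1)) ^ w := by
          rw [Finset.sum_const, nsmul_eq_mul, Finset.card_range, ← Real.exp_nat_mul]
          push_cast
          congr 2
          ring
  have hhalf : (p : ℝ) ^ (1 - ε / 4) ≤ 1 / 2 := by
    calc (p : ℝ) ^ (1 - ε / 4) ≤ (p : ℝ) ^ ((1 : ℝ) / 2) :=
          Real.rpow_le_rpow_of_exponent_ge hp0 hp1 (by linarith)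
      _ ≤ (1 / 4 : ℝ) ^ ((1 : ℝ) / 2) := by gcongr
      _ = 1 / 2 := by
          rw [← Real.sqrt_eq_rpow, show (1 / 4 : ℝ) = (1 / 2) ^ 2 by norm_num,
            Real.sqrt_sq (by norm_num)]
  have hexp1 : Real.exp (-1) ≤ 1 / 2 := by
    have := Real.exp_one_gt_d9
    rw [Real.exp_neg, inv_le_comm₀ (Real.exp_pos _) (by norm_num)]
    linarith
  have hsum1 : ∑ f ∈ Finset.Icc f₀ M, (randomSet N p).real (E f) ≤
      (p : ℝ) ^ ((1 - ε) * n) / 2 := by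
    calc _ ≤ ∑ f ∈ Finset.Icc f₀ M, ((p : ℝ) ^ (1 - ε / 4)) ^ f := Finset.sum_le_sum hle
      _ ≤ 2 * ((p : ℝ) ^ (1 - ε / 4)) ^ f₀ := sum_Icc_pow_le (by positivity) hhalf _ _
      _ = 2 * (p : ℝ) ^ ((1 - ε / 4) * f₀) := by
          rw [← Real.rpow_natCast, ← Real.rpow_mul hp0.le]
      _ ≤ 2 * (p : ℝ) ^ ((1 - ε) * n + ε / 2) := by
          gcongr 2 * ?_
          refine Real.rpow_le_rpow_of_exponent_ge hp0 hp1 ?_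
          have h1 : (1 - ε / 4) * n ≤ f₀ := Nat.le_ceil _
          have h2 : (1 - ε / 4) * ((1 - ε / 4) * n) ≤ (1 - ε / 4) * f₀ :=
            mul_le_mul_of_nonneg_left h1 (by linarith)
          nlinarith [sq_nonneg ε]
      _ = 2 * ((p : ℝ) ^ ((1 - ε) * n) * (p : ℝ) ^ (ε / 2)) := by rw [Real.rpow_add hp0]
      _ ≤ 2 * ((p : ℝ) ^ ((1 - ε) * n) * (1 / 4)) := by
          gcongr 2 * (_ * ?_)
          rw [Real.rpow_neg hp0.le, le_inv_comm₀ (by norm_num) (by positivity)] at hx4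
          linarith
      _ = _ := by ring
  have hsum2 : ∑ w ∈ Finset.Icc w₀ M,
      (randomSet N p).real (⋃ j ∈ Finset.range (k + 1), E' w j) ≤ (p : ℝ) ^ ((1 - ε) * n) / 2 := by
    have hnC := le_sqrt_of_forall_seed N k (by omega) hp0.le (by linarith) ht1 hfull hmin
    have hlogp : Real.log p ≤ 0 := Real.log_nonpos hp0.le hp1
    have hlogk : 0 ≤ Real.log (4 * (k + 1)) := Real.log_nonneg (by linarith)
    have h1 : Real.log (4 * (k + 1)) - 10 * k * Real.log p ≤ (p : ℝ) ^ (-a) := by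
      rw [Real.rpow_neg hp0.le, ← one_div, le_div_iff₀ (by positivity)]
      linarith
    -- Since `n ≤ 10 k √t` and `p ^ (-a)` beats `log (1 / p)`, the dense sets are large enough for
    -- `exp (-w₀)` to be below `p ^ n / (4 (k + 1))`.
    have h2 : Real.log (4 * (k + 1)) - n * Real.log p ≤ √t * (p : ℝ) ^ (-a) := by
      calc Real.log (4 * (k + 1)) - n * Real.log p
          ≤ √t * Real.log (4 * (k + 1)) - 10 * k * √t * Real.log p := by nlinarith
        _ = √t * (Real.log (4 * (k + 1)) - 10 * k * Real.log p) := by ring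
        _ ≤ _ := by gcongr
    calc _ ≤ ∑ w ∈ Finset.Icc w₀ M, (k + 1) * (Real.exp (-1)) ^ w := Finset.sum_le_sum hle'
      _ = (k + 1) * ∑ w ∈ Finset.Icc w₀ M, (Real.exp (-1)) ^ w := by rw [Finset.mul_sum]
      _ ≤ (k + 1) * (2 * (Real.exp (-1)) ^ w₀) := by
          gcongr
          exact sum_Icc_pow_le (Real.exp_pos _).le hexp1 _ _
      _ = 2 * (k + 1) * Real.exp (-w₀) := by
          rw [← Real.exp_nat_mul]
          ring_nf
      _ ≤ 2 * (k + 1) * Real.exp (n * Real.log p - Real.log (4 * (k + 1))) := by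
          gcongr
          have := Nat.le_ceil (√t * (p : ℝ) ^ (-a))
          linarith
      _ = (p : ℝ) ^ (n : ℝ) / 2 := by
          rw [Real.exp_sub, Real.exp_log (by positivity), Real.rpow_def_of_pos hp0,
            mul_comm (n : ℝ)]
          field_simp
          ring
      _ ≤ _ := by
          gcongr ?_ / 2
          exact Real.rpow_le_rpow_of_exponent_ge hp0 hp1 (by nlinarith)
  calc _ ≤ (randomSet N p).real ((⋃ f ∈ Finset.Icc f₀ M, E f) ∪
        ⋃ w ∈ Finset.Icc w₀ M, ⋃ j ∈ Finset.range (k + 1), E' w j) :=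
        measureReal_mono hsub (measure_ne_top _ _)
    _ ≤ _ := measureReal_union_le _ _
    _ ≤ (p : ℝ) ^ ((1 - ε) * n) / 2 + (p : ℝ) ^ ((1 - ε) * n) / 2 :=
        add_le_add ((measureReal_biUnion_finset_le _ _).trans hsum1)
          ((measureReal_biUnion_finset_le _ _).trans hsum2)
    _ = _ := by ring

/-! ### From the estimates to seeds and `Ψ` -/

lemma mem_seeds_iff {N k : ℕ} {p : I} (hp : 0 < p) {t : ℝ} {U : Finset ℕ} :
    U ∈ seeds N p k t ↔
      U ⊆ Finset.Icc 1 N ∧ exCount N p k ∅ + t ≤ exCount N p k U := by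
  rw [seeds, Set.mem_ofPred_eq, mean_eq]
  refine and_congr_right fun hU => ?_
  rw [condMean_eq N p hp k U hU]

lemma smallSeedEvent_eq {N k : ℕ} {p : I} (hp : 0 < p) (t m : ℝ) :
    smallSeedEvent N p k t m = {R | ∃ U ⊆ Finset.Icc 1 N,
      exCount N p k ∅ + t ≤ exCount N p k U ∧ (U.card : ℝ) ≤ m ∧ (U : Set ℕ) ⊆ R} := by
  ext R
  simp only [smallSeedEvent, mem_seeds_iff hp, Set.mem_ofPred_eq, and_assoc]

lemma exists_Psi_eq {N k : ℕ} {p : I} {t : ℝ} (h : (seeds N p k t).Nonempty) :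
    ∃ U ∈ seeds N p k t, Psi N p k t = U.card ∧ ∀ V ∈ seeds N p k t, U.card ≤ V.card := by
  obtain ⟨U, hU, hmin⟩ : ∃ U ∈ seeds N p k t, ∀ V ∈ seeds N p k t, U.card ≤ V.card :=
    ⟨Function.argminOn Finset.card _ h, Function.argminOn_mem _ _ _,
      fun V hV => Function.argminOn_le _ _ hV⟩
  refine ⟨U, hU, le_antisymm (iInf₂_le U hU) (le_iInf₂ fun V hV => ?_), hmin⟩
  exact_mod_cast hmin V hV

/-- The non-asymptotic form of the main theorem. -/
theorem exists_log_measure_smallSeedEvent_le (k : ℕ) (hk : 3 ≤ k) {ε : ℝ} (hε : 0 < ε) :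
    ∃ K : ℝ, 0 < K ∧ ∀ (N : ℕ) (p : I) (t m : ℝ), 0 < p → 0 ≤ t → K * m ≤ t →
      K * (m * (N * (p : ℝ) ^ (k - 1))) ≤ t → K * (m ^ 2 * (p : ℝ) ^ (k - 2)) ≤ t →
      ENNReal.log (randomSet N p (smallSeedEvent N p k t m)) ≤
        ((1 - ε : ℝ) : EReal) * (((Psi N p k t : ℕ∞) : ENNReal) : EReal) *
          ((Real.log (p : ℝ) : ℝ) : EReal) := by
  have hk0 : (3 : ℝ) ≤ k := by exact_mod_cast hk
  obtain ⟨ε', hε', hε'1, hε'ε⟩ : ∃ ε' : ℝ, 0 < ε' ∧ ε' ≤ 1 / 2 ∧ ε' ≤ ε :=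
    ⟨min ε (1 / 2), lt_min hε (by norm_num), min_le_right _ _, min_le_left _ _⟩
  obtain ⟨K₁, hK₁, hev⟩ := measureReal_exists_seed_le k hk hε' hε'1
  obtain ⟨p₀, hp₀, hmain⟩ := mem_nhdsGT_iff_exists_Ioo_subset.1 hev
  rw [Set.mem_Ioi] at hp₀
  set K := max (max K₁ (4 * (k : ℝ))) (max (2 * k ^ 2) (8 * k ^ 4 / p₀ ^ (k - 2))) with hK
  have hKK₁ : K₁ ≤ K := (le_max_left _ _).trans (le_max_left _ _)
  have hKk : 4 * (k : ℝ) ≤ K := (le_max_right _ _).trans (le_max_left _ _)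
  have hKk2 : 2 * (k : ℝ) ^ 2 ≤ K := (le_max_left _ _).trans (le_max_right _ _)
  have hKp₀ : 8 * (k : ℝ) ^ 4 / p₀ ^ (k - 2) ≤ K := (le_max_right _ _).trans (le_max_right _ _)
  have hK0 : 0 < K := by linarith
  clear_value K
  refine ⟨K, hK0, ?_⟩
  intro N p t m hp ht h1 h2 h3
  have hp0 : (0 : ℝ) < p := hp
  have hp1 : (p : ℝ) ≤ 1 := p.2.2
  -- Without a seed of size at most `m` the event is empty and its logarithm is `⊥`; this also
  -- disposes of `Ψ = ∞`.
  by_cases hex : ∃ U ∈ seeds N p k t, (U.card : ℝ) ≤ m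
  swap
  · have : smallSeedEvent N p k t m = ∅ := by
      refine Set.eq_empty_of_forall_notMem fun R ⟨U, hU, hUm, _⟩ => hex ⟨U, hU, hUm⟩
    rw [this, measure_empty, ENNReal.log_zero]
    exact bot_le
  obtain ⟨U₀, hU₀, hU₀m⟩ := hex
  obtain ⟨U, hU, hPsi, hmin⟩ := exists_Psi_eq ⟨U₀, hU₀⟩
  rw [hPsi]
  have hcast : ((1 - ε : ℝ) : EReal) * ((((U.card : ℕ) : ℕ∞) : ENNReal) : EReal) *
      ((Real.log (p : ℝ) : ℝ) : EReal) = (((1 - ε) * U.card * Real.log p : ℝ) : EReal) := by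
    rw [ENat.toENNReal_coe, EReal.coe_mul, EReal.coe_mul]
    rfl
  rw [hcast]
  -- If the empty set is a seed, the right side is 0 and the trivial bound suffices.
  rcases Nat.eq_zero_or_pos U.card with hn | hn
  · rw [hn, Nat.cast_zero, mul_zero, zero_mul, EReal.coe_zero, ← ENNReal.log_one]
    exact ENNReal.log_monotone prob_le_one
  have hUm : (U.card : ℝ) ≤ m := le_trans (by exact_mod_cast hmin U₀ hU₀) hU₀m
  have hn0 : (1 : ℝ) ≤ U.card := by exact_mod_cast hn
  have hm : 0 < m := by linarith
  have ht0 : 0 < t := by nlinarith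
  obtain ⟨hUN, hUs⟩ := (mem_seeds_iff hp).1 hU
  have hTn : √t ≤ 2 * k ^ 2 * U.card :=
    sqrt_le_of_seed (by omega) hp0.le hp1 hKk h2 hUm (by linarith)
  have hreg : Regime N k p K t m := ⟨hp0, ht0, hm, h1, h2, h3, hTn.trans (by gcongr)⟩
  have hT1 : 1 ≤ √t := by
    have h4 := hreg.le_sqrt
    have h5 : (2 : ℝ) * k ^ 2 * 1 ≤ 2 * k ^ 2 * √t := by linarith
    exact le_of_mul_le_mul_left h5 (by positivity)
  -- Smallness of `p` is automatic: a seed of size at most `m` forces `t ≤ 4 k⁴ m²`, whereas `K m² p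
  -- ^ (k - 2) ≤ t`.
  have hpp₀ : (p : ℝ) < p₀ := by
    refine lt_of_pow_lt_pow_left₀ (k - 2) hp₀.le ?_
    have h4 : t ≤ 4 * k ^ 4 * m ^ 2 := by
      calc t = √t ^ 2 := (Real.sq_sqrt ht).symm
        _ ≤ (2 * k ^ 2 * m) ^ 2 := by gcongr; exact hreg.sqrt_le
        _ = _ := by ring
    have h5 : K * (p : ℝ) ^ (k - 2) ≤ 4 * k ^ 4 := by
      refine le_of_mul_le_mul_right ?_ (pow_pos hm 2)
      linarith
    rw [div_le_iff₀ (by positivity)] at hKp₀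
    have h6 : K * (p : ℝ) ^ (k - 2) < K * p₀ ^ (k - 2) := by
      have : (0 : ℝ) < k ^ 4 := by positivity
      linarith
    exact lt_of_mul_lt_mul_left h6 hK0.le
  have hfull : exCount N p k ∅ + t ≤ exCount N p k (Finset.Icc 1 N) :=
    hUs.trans (exCount_mono N hp0.le hp1 k hUN)
  have hbound := hmain ⟨hp0, hpp₀⟩ p rfl N U.card t m (hreg.mono hKK₁) (Real.one_le_sqrt.1 hT1) hn
    hTn hfull fun V hVN hV => hmin V ((mem_seeds_iff hp).2 ⟨hVN, hV⟩)
  rw [← smallSeedEvent_eq hp] at hbound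
  calc ENNReal.log (randomSet N p (smallSeedEvent N p k t m))
      ≤ ENNReal.log (ENNReal.ofReal ((p : ℝ) ^ ((1 - ε') * U.card))) := by
        refine ENNReal.log_monotone ?_
        rw [← ofReal_measureReal]
        exact ENNReal.ofReal_le_ofReal hbound
    _ = ((Real.log ((p : ℝ) ^ ((1 - ε') * U.card)) : ℝ) : EReal) :=
        ENNReal.log_ofReal_of_pos (by positivity)
    _ ≤ (((1 - ε) * U.card * Real.log p : ℝ) : EReal) := by
        rw [EReal.coe_le_coe_iff, Real.log_rpow hp0]
        refine mul_le_mul_of_nonpos_right ?_ (Real.log_nonpos hp0.le hp1)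
        gcongr

end APTail

theorem theorem1p3 (k : ℕ) (hk : 3 ≤ k) (p : ℕ → I) (t m : ℕ → ℝ)
    (hp : ∀ N, 0 < p N) (ht : ∀ N, 0 ≤ t N) (hm : ∀ N, 0 ≤ m N)
    (h₁ : (fun N : ℕ => m N * max 1 ((N : ℝ) * (p N : ℝ) ^ (k - 1))) =o[atTop] t)
    (h₂ : (fun N : ℕ => m N ^ 2 * (p N : ℝ) ^ (k - 2) *
        (N : ℝ) ^ (((k : ℝ) - 2) * (m N / t N) ^ (1 / ((k : ℝ) - 1)))) =o[atTop] t) :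
    ∀ ε : ℝ, 0 < ε → ∀ᶠ N : ℕ in atTop,
      ENNReal.log (APTail.randomSet N (p N) (APTail.smallSeedEvent N (p N) k (t N) (m N))) ≤
        ((1 - ε : ℝ) : EReal) * (((APTail.Psi N (p N) k (t N) : ℕ∞) : ENNReal) : EReal) *
          ((Real.log (p N : ℝ) : ℝ) : EReal) := by
  intro ε hε
  obtain ⟨K, hK, hbound⟩ := APTail.exists_log_measure_smallSeedEvent_le k hk hε
  have hk0 : (3 : ℝ) ≤ k := by exact_mod_cast hk
  filter_upwards [h₁.def (inv_pos.2 hK), h₂.def (inv_pos.2 hK), eventually_ge_atTop 1]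
    with N hN₁ hN₂ hN
  have hN1 : (1 : ℝ) ≤ N := by exact_mod_cast hN
  have hpN : (0 : ℝ) < p N := hp N
  have hmN := hm N
  have htN := ht N
  have hle : ∀ x : ℝ, 0 ≤ x → ∀ y : ℝ, x ≤ y → ‖y‖ ≤ K⁻¹ * ‖t N‖ → K * x ≤ t N := by
    intro x hx y hxy hy
    rw [Real.norm_of_nonneg (hx.trans hxy), Real.norm_of_nonneg htN] at hy
    calc K * x ≤ K * (K⁻¹ * t N) := by gcongr; exact hxy.trans hy
      _ = t N := by field_simp
  refine hbound N (p N) (t N) (m N) (hp N) htN ?_ ?_ ?_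
  · exact hle _ hmN _ (le_mul_of_one_le_right hmN (le_max_left _ _)) hN₁
  · exact hle _ (by positivity) _ (mul_le_mul_of_nonneg_left (le_max_right _ _) hmN) hN₁
  -- The power of `N` has nonnegative exponent, so it is at least 1.
  · refine hle _ (by positivity) _ (le_mul_of_one_le_right (by positivity) ?_) hN₂
    refine Real.one_le_rpow hN1 (mul_nonneg (by linarith) (Real.rpow_nonneg ?_ _))
    positivity
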